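/- Let $d\ge 2$ and $N\ge 0$ be integers, let $p\in[1,\infty]$ with dual exponent $p'$ (that is, $\frac1p+\frac1{p'}=1$), and let $q\in[1,\infty]$ satisfy $$q=\tfrac{d(d+1)}2\,p',\qquad q>\tfrac{d^2+d+2}2$$ (for $p=1$ this means $q=\infty$). For a polynomial curve $\gamma=(\gamma_1,\dots,\gamma_d):\mathbb R\to\mathbb R^d$ put $$L_\gamma(t)=\det\bigl(\gamma'(t),\dots,\gamma^{(d)}(t)\bigr),\qquad \lambda_\gamma(t)=|L_\gamma(t)|^{\frac{2}{d(d+1)}},\qquad \mathcal E_\gamma f(x)=\int_{\mathbb R}e^{ix\cdot\gamma(t)}f(t)\,\lambda_\gamma(t)\,dt\quad(x\in\mathbb R^d),$$ and let $L^p(\lambda_\gamma)$ be the space of complex-valued $L^p$ functions on $\mathbb R$ for the measure $\lambda_\gamma(t)\,dt$. Then for every number $R$ there is a finite constant $C=C_{d,N,p,R}$ such that the following holds for all real numbers $C_1,C_2$ with $C_1>0$ and $C_2/C_1=R$, every interval $I\subseteq\mathbb R$ (bounded or unbounded), and every polynomial curve $\gamma$ of degree at most $N$ such that $$C_1\le |L_\gamma(t)|\le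 C_2\qquad\text{for all } t\in I.$$ 1. If $I$ is bounded, then $\chi_I f\in L^1(\lambda_\gamma)$ for every $f\in L^p(\lambda_\gamma)$, so the integral defining $\mathcal E_\gamma(\chi_I f)$ converges absolutely. 2. For every $f\in L^p(\lambda_\gamma)$ with $\chi_I f\in L^1(\lambda_\gamma)$, the function $\mathcal E_\gamma(\chi_I f)$ belongs to $L^q(\mathbb R^d)$ and $$\|\mathcal E_\gamma(\chi_I f)\|_{L^q(\mathbb R^d)}\le C\,\|f\|_{L^p(\lambda_\gamma)}.$$ 3. There is a linear operator $T:L^p(\lambda_\gamma)\to L^q(\mathbb R^d)$ with $\|Tf\|_{L^q(\mathbb R^d)}\le C\,\|f\|_{L^p(\lambda_\gamma)}$ for all $f\in L^p(\lambda_\gamma)$ and $Tf=\mathcal E_\gamma(\chi_I f)$ almost everywhere whenever $\chi_I f\in L^1(\lambda_\gamma)$. -/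

import Mathlib

open MeasureTheory
open scoped ENNReal NNReal Polynomial

noncomputable section

/-- The polynomial curve `t ↦ (γ₁(t), …, γ_d(t))` in Euclidean space with components `γ i`. -/
def curvePoint {d : ℕ} (γ : Fin d → ℝ[X]) (t : ℝ) : EuclideanSpace ℝ (Fin d) :=
  WithLp.toLp 2 fun i => (γ i).eval t

/-- The torsion `L_γ(t) = det(γ'(t), …, γ^{(d)}(t))`; column `j = 0, …, d - 1` of the matrix
is the derivative of order `j + 1`. -/
def torsion {d : ℕ} (γ : Fin d → ℝ[X]) (t : ℝ) : ℝ :=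
  (Matrix.of fun i j : Fin d =>
    ((Polynomial.derivative^[(j : ℕ) + 1]) (γ i)).eval t).det

/-- The affine arclength measure `λ_γ dt = |L_γ(t)|^{2/(d(d+1))} dt` on `ℝ`. -/
def affineArclength {d : ℕ} (γ : Fin d → ℝ[X]) : Measure ℝ :=
  (volume : Measure ℝ).withDensity fun t =>
    ENNReal.ofReal (|torsion γ t| ^ ((2 : ℝ) / ((d : ℝ) * ((d : ℝ) + 1))))

/-- The extension operator `E_γ f(x) = ∫ e^{i x·γ(t)} f(t) λ_γ(t) dt`. -/
def extensionOp {d : ℕ} (γ : Fin d → ℝ[X]) (f : ℝ → ℂ) (x : EuclideanSpace ℝ (Fin d)) : ℂ :=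
  ∫ t, Complex.exp (Complex.I * ((inner ℝ x (curvePoint γ t) : ℝ) : ℂ)) * f t
    ∂(affineArclength γ)

end

/-!
The proof is Drury's method of offspring curves, started from the trivial `L¹ → L^∞` estimate, for a
class of curves that is stable under taking sums of translates, followed by a compactness argument
which reduces polynomial curves to this class. Throughout `d = n + 1` and `D = d (d + 1) / 2`, and the
pairs of exponents are parametrised by `w = 1 / p'`, so that `1 / p = 1 - w` and `1 / q = w / D`
(`exists_weight_of_exponents`); the range to be covered is `0 ≤ w < D / (D + 1)`.

*Good curves.* A curve is a `GoodCurve` on an interval if the matrix of its derivatives of orders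
`1, …, d` is close to the identity there, up to the scale of each row. This is a system of linear
inequalities, hence it is inherited by the offspring curves `γ(s) + Σ_l γ(s + h l)`
(`GoodCurve.offspring`). For a good curve the sum map `t ↦ γ(t 0) + ⋯ + γ(t n)` is injective on
increasing tuples (`eq_of_sum_eval_eq`), and its Jacobian is at least a constant times the Vandermonde
product (`le_det_velocityMatrix`).

*Restricted bounds.* For `f` bounded by the indicator of a set `E`, the power `(E_γ f)^d` is an integral
over `d`-tuples of points of `E` with phase `x · (γ(t 0) + ⋯ + γ(t n))`. The tuples are ordered and
sorted by the dyadic sizes of their gaps. One piece is bounded in `L²` by Plancherel's theorem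
and the lower bound for the Jacobian (`eLpNorm_two_multiFourier_le`). It is bounded in `L^q` by an
already known restricted bound, applied to the offspring curves
(`eLpNorm_multiFourier_le_of_restrictedBound`). Between the two the norm is log-convex, and for suitable
weights the pieces sum to a geometric series (`exists_restrictedBound_step`). This turns a restricted
bound at `w₀` into one at every `w` just below the image of `w₀` under a contraction with fixed point
`D / (D + 1)`, so that the iteration exhausts the range (`exists_restrictedBound`). As the range is
open at the upper end, restricted bounds on both sides of `w` are available for `w > 0`, and they give
the strong-type bound by summing over the level sets of `f` (`eLpNorm_sum_rpow_le_of_levels`,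
`exists_strongBound`).

*Polynomial curves.* The estimate is invariant under affine maps of the curve and of the parameter, up
to powers of the torsion that are accounted for. On the unit interval, a curve whose torsion varies by a
bounded factor, normalised so that its derivative matrix at one point is the identity, has
derivative matrix near the identity in a neighbourhood of a size that depends only on `d`, the
degree and that factor (`exists_torsionMatrix_near_one`). Indeed it is a linear image of a curve with
orthonormal coefficient vectors, these form a compact set, and their torsion does not vanish
identically (`wronskian_ne_zero`). Hence every compact interval is a union of boundedly many intervals on
which the curve is, after an affine map, good (`exists_bound_compact_interval`). Unbounded intervals
follow by Fatou's lemma (`exists_bound_interval`), and the affine arclength density is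
absorbed by the bounds on the torsion (`exists_extensionOp_bound`). As `p < ∞`, the functions for
which the integral converges are dense, and the operator extends to `L^p`
(`exists_linearMap_of_bound`).
-/

section Plancherel

/-! ### Plancherel's theorem on `L¹ ∩ L²` -/

open FourierTransform SchwartzMap

variable {E : Type*} [NormedAddCommGroup E] [InnerProductSpace ℝ E] [FiniteDimensional ℝ E]
  [MeasurableSpace E] [BorelSpace E]

/-- The Fourier transform on `L²`, defined by extension, agrees with the Fourier integral of an
integrable function: both have the same integrals against Schwartz functions. -/
theorem toLp_fourier_ae_eq {f : E → ℂ} (hf : Integrable f) (hf2 : MemLp f 2) :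
    (𝓕 (hf2.toLp f) : Lp ℂ 2 (volume : Measure E)) =ᵐ[volume] 𝓕 f := by
  have hcont : Continuous (𝓕 f) :=
    VectorFourier.fourierIntegral_continuous Real.continuous_fourierChar
      (by exact continuous_inner) hf
  have key : ∀ g : 𝓢(E, ℂ), ∫ x, g x • (𝓕 (hf2.toLp f) : Lp ℂ 2 (volume : Measure E)) x
      = ∫ x, g x • 𝓕 f x := by
    intro g
    have h1 := congrArg (fun u : 𝓢'(E, ℂ) => u g)
      (Lp.fourier_toTemperedDistribution_eq (hf2.toLp f))
    simp only [TemperedDistribution.fourier_apply, Lp.toTemperedDistribution_apply] at h1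
    rw [← h1]
    have h2 : ∫ x, (𝓕 g) x • (hf2.toLp f) x = ∫ x, (𝓕 g) x • f x := by
      refine integral_congr_ae ?_
      filter_upwards [hf2.coeFn_toLp] with x hx
      rw [hx]
    rw [h2]
    have h3 := VectorFourier.integral_fourierIntegral_smul_eq_flip (L := innerₗ E)
      (μ := (volume : Measure E)) (ν := volume) Real.continuous_fourierChar
      (by exact continuous_inner) (SchwartzMap.integrable g) hf
    have hflip : (innerₗ E).flip = innerₗ E := by
      ext x y; simp
    rw [hflip] at h3
    exact h3
  refine ae_eq_of_integral_contDiff_smul_eq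
    ((Lp.memLp _).locallyIntegrable (by norm_num)) hcont.locallyIntegrable ?_
  intro g g_smooth g_cpt
  have hg₁ : HasCompactSupport (Complex.ofRealCLM ∘ g) := g_cpt.comp_left rfl
  have hg₂ : ContDiff ℝ ((⊤ : ℕ∞) : WithTop ℕ∞) (Complex.ofRealCLM ∘ g) := by fun_prop
  simpa using key (hg₁.toSchwartzMap hg₂)

/-- Plancherel's theorem for the Fourier integral. -/
theorem eLpNorm_fourier_eq {f : E → ℂ} (hf : Integrable f) (hf2 : MemLp f 2) :
    eLpNorm (𝓕 f) 2 (volume : Measure E) = eLpNorm f 2 volume := by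
  rw [← eLpNorm_congr_ae (toLp_fourier_ae_eq hf hf2), ← eLpNorm_congr_ae hf2.coeFn_toLp]
  have h := Lp.norm_fourier_eq (hf2.toLp f)
  rw [Lp.norm_def, Lp.norm_def] at h
  exact (ENNReal.toReal_eq_toReal_iff' (Lp.eLpNorm_ne_top _) (Lp.eLpNorm_ne_top _)).1 h

end Plancherel

section LinearChange

/-! ### Linear changes of variables -/

variable {E : Type*} [NormedAddCommGroup E] [NormedSpace ℝ E] [MeasurableSpace E] [BorelSpace E]
  [FiniteDimensional ℝ E]

theorem eLpNorm_comp_linearMap (μ : Measure E) [μ.IsAddHaarMeasure] {L : E →ₗ[ℝ] E}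
    (hL : LinearMap.det L ≠ 0) {f : E → ℂ} (hf : AEStronglyMeasurable f μ) (p : ℝ≥0∞) :
    eLpNorm (fun x => f (L x)) p μ
      = ENNReal.ofReal |(LinearMap.det L)⁻¹| ^ (1 / p).toReal * eLpNorm f p μ := by
  have hmap := Measure.map_linearMap_addHaar_eq_smul_addHaar μ hL
  have hc : ENNReal.ofReal |(LinearMap.det L)⁻¹| ≠ 0 := by
    simpa using hL
  have hLm : Measurable (L : E → E) := (L.continuous_of_finiteDimensional).measurable
  rw [← smul_eq_mul, ← eLpNorm_smul_measure_of_ne_zero hc, ← hmap, eLpNorm_map_measure _ hLm.aemeasurable]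
  · rfl
  · rw [hmap]; exact hf.smul_measure _

end LinearChange

section ChangeOfVariables

/-! ### Oscillatory integrals over injective maps -/

open FourierTransform

variable {ι : Type*} [Fintype ι]

/-- The `L²` estimate for an oscillatory integral with phase `x · Φ(t)`, where `Φ` is injective with
Jacobian at least `c`. In the variable `y = Φ(t)` the integral is the Fourier transform of the density
`F / |det Φ'|`, to which Plancherel's theorem applies; the power of `2π` comes from the phase
`x · y` in place of `2π x · y`. -/
theorem eLpNorm_two_oscillatory_le {U : Set (ι → ℝ)} (hU : MeasurableSet U)
    {Φ : (ι → ℝ) → (ι → ℝ)} {Φ' : (ι → ℝ) → (ι → ℝ) →L[ℝ] (ι → ℝ)}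
    (hΦ' : ∀ t ∈ U, HasFDerivWithinAt Φ (Φ' t) U t) (hinj : Set.InjOn Φ U)
    (hdet : Measurable fun t => (Φ' t).det)
    {c : ℝ} (hc : 0 < c) (hlow : ∀ t ∈ U, c ≤ |(Φ' t).det|)
    {F : (ι → ℝ) → ℂ} (hF : Measurable F) (hFint : IntegrableOn F U)
    (hF2 : ∫⁻ t in U, ‖F t‖ₑ ^ (2 : ℝ) ≠ ⊤) :
    eLpNorm (fun x : EuclideanSpace ℝ ι =>
      ∫ t in U, Complex.exp (Complex.I * ((inner ℝ x (WithLp.toLp 2 (Φ t)) : ℝ) : ℂ)) * F t) 2 volume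
    ≤ ENNReal.ofReal ((2 * Real.pi) ^ Fintype.card ι) ^ (1 / 2 : ℝ) *
      (ENNReal.ofReal c⁻¹ * ∫⁻ t in U, ‖F t‖ₑ ^ (2 : ℝ)) ^ (1 / 2 : ℝ) := by
  classical
  have hemb := measurableEmbedding_of_fderivWithin hU hΦ' hinj
  have himg : MeasurableSet (Φ '' U) := measurable_image_of_fderivWithin hU hΦ' hinj
  -- the density of the image under `Φ` of the measure `F dt`
  set G : (ι → ℝ) → ℂ := Function.extend (U.domRestrict Φ)
    (fun t : U => F t / ((|(Φ' t).det| : ℝ) : ℂ)) 0 with hG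
  have hGm : Measurable G := by
    refine hemb.measurable_extend ?_ measurable_zero
    have h1 : Measurable fun t => F t / ((|(Φ' t).det| : ℝ) : ℂ) :=
      hF.div (Complex.measurable_ofReal.comp (continuous_abs.measurable.comp hdet))
    exact h1.comp measurable_subtype_coe
  have hGU : ∀ t ∈ U, G (Φ t) = F t / ((|(Φ' t).det| : ℝ) : ℂ) := by
    intro t ht
    have := hemb.injective.extend_apply (fun t : U => F t / ((|(Φ' t).det| : ℝ) : ℂ)) 0 ⟨t, ht⟩
    simpa [hG] using this
  have hG0 : ∀ y, y ∉ Φ '' U → G y = 0 := by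
    intro y hy
    rw [hG, Function.extend_apply' _ _ _ ?_]
    · rfl
    · rintro ⟨⟨t, ht⟩, h⟩
      exact hy ⟨t, ht, h⟩
  have hpos : ∀ t ∈ U, 0 < |(Φ' t).det| := fun t ht => hc.trans_le (hlow t ht)
  -- the `L¹` and `L²` norms of the pushed forward density
  have hG1 : ∫⁻ y, ‖G y‖ₑ = ∫⁻ t in U, ‖F t‖ₑ := by
    rw [← setLIntegral_eq_of_support_subset (s := Φ '' U),
      lintegral_image_eq_lintegral_abs_det_fderiv_mul volume hU hΦ' hinj]
    · refine setLIntegral_congr_fun hU fun t ht => ?_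
      have := hpos t ht
      simp only [hGU t ht]
      rw [← ofReal_norm, ← ofReal_norm, ← ENNReal.ofReal_mul (abs_nonneg _), norm_div,
        Complex.norm_real, Real.norm_eq_abs, abs_abs]
      congr 1
      field_simp
    · intro y hy
      by_contra h
      exact hy (by simp [hG0 y h])
  have hG2 : ∫⁻ y, ‖G y‖ₑ ^ (2 : ℝ) ≤ ENNReal.ofReal c⁻¹ * ∫⁻ t in U, ‖F t‖ₑ ^ (2 : ℝ) := by
    rw [← setLIntegral_eq_of_support_subset (s := Φ '' U),
      lintegral_image_eq_lintegral_abs_det_fderiv_mul volume hU hΦ' hinj,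
      ← lintegral_const_mul' _ _ ENNReal.ofReal_ne_top]
    · refine setLIntegral_mono' hU fun t ht => ?_
      have h1 := hpos t ht
      simp only [hGU t ht]
      rw [← ofReal_norm, ← ofReal_norm, ENNReal.ofReal_rpow_of_nonneg (norm_nonneg _) (by norm_num),
        ENNReal.ofReal_rpow_of_nonneg (norm_nonneg _) (by norm_num),
        ← ENNReal.ofReal_mul (abs_nonneg _), ← ENNReal.ofReal_mul (by positivity), norm_div,
        Complex.norm_real, Real.norm_eq_abs, abs_abs]
      refine ENNReal.ofReal_le_ofReal ?_
      rw [Real.rpow_two, Real.rpow_two]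
      have h2 : |(Φ' t).det| * (‖F t‖ / |(Φ' t).det|) ^ 2 = |(Φ' t).det|⁻¹ * ‖F t‖ ^ 2 := by
        field_simp
      rw [h2]
      gcongr
      exact hlow t ht
    · intro y hy
      by_contra h
      exact hy (by simp [hG0 y h])
  set H : EuclideanSpace ℝ ι → ℂ := fun y => G (WithLp.ofLp y) with hH
  have hmp := EuclideanSpace.volume_preserving_symm_measurableEquiv_toLp ι
  have hHm : Measurable H := hGm.comp (MeasurableEquiv.toLp 2 (ι → ℝ)).symm.measurable
  have hH1 : Integrable H := by
    refine ⟨hHm.aestronglyMeasurable, ?_⟩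
    rw [hasFiniteIntegral_iff_enorm]
    have := hmp.lintegral_comp (f := fun y => ‖G y‖ₑ) hGm.enorm
    calc ∫⁻ y, ‖H y‖ₑ = ∫⁻ y, ‖G y‖ₑ := this
      _ < ⊤ := by rw [hG1]; exact hFint.2
  have hH2eq : ∫⁻ y, ‖H y‖ₑ ^ (2 : ℝ) = ∫⁻ y, ‖G y‖ₑ ^ (2 : ℝ) :=
    hmp.lintegral_comp (f := fun y => ‖G y‖ₑ ^ (2 : ℝ)) (hGm.enorm.pow_const _)
  have hH2n : eLpNorm H 2 volume = (∫⁻ y, ‖G y‖ₑ ^ (2 : ℝ)) ^ (1 / 2 : ℝ) := by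
    rw [eLpNorm_eq_lintegral_rpow_enorm_toReal (by norm_num) (by norm_num), ← hH2eq]
    norm_num
  have hH2 : MemLp H 2 := by
    refine ⟨hHm.aestronglyMeasurable, ?_⟩
    rw [hH2n]
    refine ENNReal.rpow_lt_top_of_nonneg (by norm_num) ?_
    exact ne_top_of_le_ne_top (ENNReal.mul_ne_top ENNReal.ofReal_ne_top hF2) hG2
  -- the oscillatory integral is a rescaled Fourier transform
  have hFour : ∀ x : EuclideanSpace ℝ ι,
      ∫ t in U, Complex.exp (Complex.I * ((inner ℝ x (WithLp.toLp 2 (Φ t)) : ℝ) : ℂ)) * F t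
      = 𝓕 H ((-(2 * Real.pi)⁻¹ : ℝ) • (LinearMap.id (R := ℝ) x)) := by
    intro x
    have e1 : ∫ t in U, Complex.exp (Complex.I * ((inner ℝ x (WithLp.toLp 2 (Φ t)) : ℝ) : ℂ)) * F t
        = ∫ t in U, |(Φ' t).det| •
          (Complex.exp (Complex.I * ((inner ℝ x (WithLp.toLp 2 (Φ t)) : ℝ) : ℂ)) * G (Φ t)) := by
      refine setIntegral_congr_fun hU fun t ht => ?_
      have h1 := (hpos t ht).ne'
      have h2 : ((|(Φ' t).det| : ℝ) : ℂ) ≠ 0 := by exact_mod_cast h1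
      simp only [hGU t ht, Complex.real_smul]
      field_simp
    rw [e1, ← integral_image_eq_integral_abs_det_fderiv_smul volume hU hΦ' hinj
      (fun y => Complex.exp (Complex.I * ((inner ℝ x (WithLp.toLp 2 y) : ℝ) : ℂ)) * G y),
      setIntegral_eq_integral_of_forall_compl_eq_zero (fun y hy => by simp [hG0 y hy]),
      ← hmp.integral_comp', Real.fourier_eq']
    refine integral_congr_ae (Filter.Eventually.of_forall fun y => ?_)
    simp only [MeasurableEquiv.toLp_symm_apply, WithLp.toLp_ofLp, smul_eq_mul, hH,
      LinearMap.id_coe, id_eq, inner_smul_right, real_inner_comm x y]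
    congr 2
    rw [mul_comm]
    congr 1
    push_cast
    have : (Real.pi : ℂ) ≠ 0 := by exact_mod_cast Real.pi_ne_zero
    field_simp
  simp_rw [hFour]
  have hdetL : LinearMap.det ((-(2 * Real.pi)⁻¹ : ℝ) • (LinearMap.id (R := ℝ) (M := EuclideanSpace ℝ ι)))
      = (-(2 * Real.pi)⁻¹) ^ Fintype.card ι := by
    rw [LinearMap.det_smul, LinearMap.det_id, mul_one, finrank_euclideanSpace]
  have hcont : Continuous (𝓕 H) :=
    VectorFourier.fourierIntegral_continuous Real.continuous_fourierChar
      (by exact continuous_inner) hH1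
  have hsc := eLpNorm_comp_linearMap (volume : Measure (EuclideanSpace ℝ ι))
    (L := (-(2 * Real.pi)⁻¹ : ℝ) • LinearMap.id)
    (by rw [hdetL]; exact pow_ne_zero _ (neg_ne_zero.2 (inv_ne_zero Real.two_pi_pos.ne')))
    hcont.aestronglyMeasurable 2
  simp only [LinearMap.smul_apply] at hsc
  rw [hsc, hdetL, eLpNorm_fourier_eq hH1 hH2, hH2n]
  have e2 : |((-(2 * Real.pi)⁻¹) ^ Fintype.card ι)⁻¹| = (2 * Real.pi) ^ Fintype.card ι := by
    rw [abs_inv, abs_pow, abs_neg, abs_of_pos (inv_pos.2 Real.two_pi_pos), inv_pow, inv_inv]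
  rw [e2]
  have e3 : (1 / (2 : ℝ≥0∞)).toReal = 1 / 2 := by simp
  rw [e3]
  gcongr

end ChangeOfVariables

section Minkowski

/-! ### Minkowski's integral inequality -/

variable {X H : Type*} [MeasurableSpace X] [MeasurableSpace H] {μ : Measure X} {ν : Measure H}
  [SFinite μ] [SFinite ν]

/-- Minkowski's integral inequality with a measurable majorant `a h` of the norms of the slices.
Hölder's inequality with the weight `a` replaces duality, so that the norms of the slices need not
be measurable in `h`. -/
theorem eLpNorm_integral_le_of_forall {q : ℝ} (hq : 1 ≤ q) {K : X → H → ℂ}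
    (hK : Measurable (Function.uncurry K)) {a : H → ℝ≥0∞} (ha : Measurable a)
    (hatop : ∀ h, a h ≠ ⊤) (ha0 : ∀ h, a h = 0 → ∀ x, K x h = 0)
    (hbound : ∀ h, eLpNorm (fun x => K x h) (ENNReal.ofReal q) μ ≤ a h) :
    eLpNorm (fun x => ∫ h, K x h ∂ν) (ENNReal.ofReal q) μ ≤ ∫⁻ h, a h ∂ν := by
  have hq0 : 0 < q := by linarith
  have hq0' : ENNReal.ofReal q ≠ 0 := by simpa using hq0
  have hKe : Measurable fun z : X × H => ‖K z.1 z.2‖ₑ := hK.enorm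
  have hpow : ∀ g : X → ℂ, eLpNorm g (ENNReal.ofReal q) μ = (∫⁻ x, ‖g x‖ₑ ^ q ∂μ) ^ (1 / q) := by
    intro g
    rw [eLpNorm_eq_lintegral_rpow_enorm_toReal hq0' ENNReal.ofReal_ne_top,
      ENNReal.toReal_ofReal hq0.le]
  have hb' : ∀ h, ∫⁻ x, ‖K x h‖ₑ ^ q ∂μ ≤ a h ^ q := by
    intro h
    have h1 := hbound h
    rw [hpow] at h1
    calc _ = ((∫⁻ x, ‖K x h‖ₑ ^ q ∂μ) ^ (1 / q)) ^ q := by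
            rw [← ENNReal.rpow_mul]; field_simp; simp
      _ ≤ _ := by gcongr
  have hpt : ∀ x, ‖∫ h, K x h ∂ν‖ₑ ^ q ≤
      (∫⁻ h, ‖K x h‖ₑ ^ q * a h ^ (1 - q) ∂ν) * (∫⁻ h, a h ∂ν) ^ (q - 1) := by
    intro x
    have h1 : ‖∫ h, K x h ∂ν‖ₑ ≤ ∫⁻ h, ‖K x h‖ₑ ∂ν := enorm_integral_le_lintegral_enorm _
    have h2 : ∫⁻ h, ‖K x h‖ₑ ∂ν ≤ ∫⁻ h, (‖K x h‖ₑ ^ q * a h ^ (1 - q)) ^ (1 / q) * a h ^ (1 - 1 / q) ∂ν := by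
      refine lintegral_mono fun h => ?_
      by_cases h0 : a h = 0
      · simp [ha0 h h0 x]
      · rw [ENNReal.mul_rpow_of_nonneg _ _ (by positivity), ← ENNReal.rpow_mul, ← ENNReal.rpow_mul,
          mul_one_div_cancel hq0.ne', ENNReal.rpow_one, mul_assoc, ← ENNReal.rpow_add _ _ h0 (hatop h)]
        have : (1 - q) * (1 / q) + (1 - 1 / q) = 0 := by field_simp; ring
        rw [this]; simp
    have hmx : Measurable fun h => ‖K x h‖ₑ ^ q * a h ^ (1 - q) := by
      have : Measurable fun h => ‖K x h‖ₑ := hKe.comp measurable_prodMk_left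
      exact (this.pow_const _).mul (ha.pow_const _)
    have h3 := ENNReal.lintegral_mul_norm_pow_le (μ := ν) hmx.aemeasurable ha.aemeasurable
      (p := 1 / q) (q := 1 - 1 / q) (by positivity)
      (by rw [sub_nonneg, div_le_one hq0]; exact hq) (by ring)
    have h4 := (h1.trans h2).trans h3
    calc _ ≤ ((∫⁻ h, ‖K x h‖ₑ ^ q * a h ^ (1 - q) ∂ν) ^ (1 / q) * (∫⁻ h, a h ∂ν) ^ (1 - 1 / q)) ^ q := by
          gcongr
      _ = _ := by
        rw [ENNReal.mul_rpow_of_nonneg _ _ hq0.le, ← ENNReal.rpow_mul, ← ENNReal.rpow_mul]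
        have e1 : 1 / q * q = 1 := by field_simp
        have e2 : (1 - 1 / q) * q = q - 1 := by field_simp
        rw [e1, e2, ENNReal.rpow_one]
  have hswap : ∫⁻ x, ∫⁻ h, ‖K x h‖ₑ ^ q * a h ^ (1 - q) ∂ν ∂μ ≤ ∫⁻ h, a h ∂ν := by
    rw [lintegral_lintegral_swap]
    · refine lintegral_mono fun h => ?_
      by_cases h0 : a h = 0
      · simp [ha0 h h0, h0, hq0]
      · have hKx : Measurable fun x => ‖K x h‖ₑ ^ q := (hKe.comp measurable_prodMk_right).pow_const _
        rw [lintegral_mul_const _ hKx]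
        calc _ ≤ a h ^ q * a h ^ (1 - q) := by gcongr; exact hb' h
          _ = a h := by rw [← ENNReal.rpow_add _ _ h0 (hatop h)]; simp
    · exact ((hKe.pow_const _).mul ((ha.comp measurable_snd).pow_const _)).aemeasurable
  rw [hpow]
  calc _ ≤ (∫⁻ x, (∫⁻ h, ‖K x h‖ₑ ^ q * a h ^ (1 - q) ∂ν) * (∫⁻ h, a h ∂ν) ^ (q - 1) ∂μ) ^ (1 / q) := by
        gcongr with x; exact hpt x
    _ ≤ ((∫⁻ h, a h ∂ν) * (∫⁻ h, a h ∂ν) ^ (q - 1)) ^ (1 / q) := by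
        gcongr
        rw [lintegral_mul_const]
        · gcongr
        · exact Measurable.lintegral_prod_right' (f := fun z : X × H => ‖K z.1 z.2‖ₑ ^ q * a z.2 ^ (1 - q))
            ((hKe.pow_const _).mul ((ha.comp measurable_snd).pow_const _))
    _ = _ := by
        set A := ∫⁻ h, a h ∂ν
        have : A * A ^ (q - 1) = A ^ q := by
          nth_rewrite 1 [← ENNReal.rpow_one A]
          rw [← ENNReal.rpow_add_of_nonneg _ _ (by norm_num) (by linarith)]
          ring_nf
        rw [this, ← ENNReal.rpow_mul, mul_one_div_cancel hq0.ne', ENNReal.rpow_one]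

end Minkowski

section LogConvexity

/-! ### Log-convexity of the Lebesgue norms -/

variable {X : Type*} [MeasurableSpace X] {μ : Measure X}

/-- Log-convexity of the `L^p` norms. -/
theorem eLpNorm_le_rpow_mul_rpow {g : X → ℂ} (hg : AEStronglyMeasurable g μ) {θ : ℝ}
    (h0 : 0 < θ) (h1 : θ < 1) {p q r : ℝ≥0∞}
    (hr : r⁻¹ = p⁻¹ * ENNReal.ofReal θ + q⁻¹ * ENNReal.ofReal (1 - θ)) :
    eLpNorm g r μ ≤ eLpNorm g p μ ^ θ * eLpNorm g q μ ^ (1 - θ) := by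
  have h1' : 0 < 1 - θ := by linarith
  have e : ∀ (p : ℝ≥0∞) (θ : ℝ), 0 < θ → p / ENNReal.ofReal θ * ENNReal.ofReal θ = p :=
    fun p θ h => ENNReal.div_mul_cancel (by simpa using h) ENNReal.ofReal_ne_top
  have hT : ENNReal.HolderTriple (p / ENNReal.ofReal θ) (q / ENNReal.ofReal (1 - θ)) r := by
    constructor
    rw [hr, ENNReal.inv_div (by simp) (by simp [h0]), ENNReal.inv_div (by simp) (by simp [h1]),
      div_eq_mul_inv, div_eq_mul_inv, mul_comm, mul_comm (ENNReal.ofReal (1 - θ))]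
  have hθ : AEStronglyMeasurable (fun x => ‖g x‖ ^ θ) μ :=
    (hg.norm.aemeasurable.pow_const _).aestronglyMeasurable
  have hθ' : AEStronglyMeasurable (fun x => ‖g x‖ ^ (1 - θ)) μ :=
    (hg.norm.aemeasurable.pow_const _).aestronglyMeasurable
  have := eLpNorm_smul_le_mul_eLpNorm (p := p / ENNReal.ofReal θ) (q := q / ENNReal.ofReal (1 - θ))
    (r := r) hθ' hθ
  rw [eLpNorm_norm_rpow _ h0, eLpNorm_norm_rpow _ h1', e _ _ h0, e _ _ h1'] at this
  refine le_trans (le_of_eq ?_) this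
  refine eLpNorm_congr_norm_ae (Filter.Eventually.of_forall fun x => ?_)
  simp only [Pi.smul_apply', smul_eq_mul, norm_mul]
  rw [Real.norm_of_nonneg (by positivity), Real.norm_of_nonneg (by positivity),
    ← Real.rpow_add_of_nonneg (norm_nonneg _) h0.le h1'.le]
  simp

end LogConvexity

section Newton

/-! ### Newton interpolation -/

open Polynomial Finset

/-- Iterated Rolle theorem: a polynomial with `m + 1` distinct zeros in an interval has a zero of its
`m`-th derivative there. -/
theorem exists_iterate_derivative_eval_eq_zero {J : Set ℝ} (hJ : J.OrdConnected) (m : ℕ) :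
    ∀ (g : ℝ[X]) (t : ℕ → ℝ), (∀ j, j < m → t j < t (j + 1)) → (∀ j, j ≤ m → t j ∈ J) →
      (∀ j, j ≤ m → g.eval (t j) = 0) → ∃ ξ ∈ J, (derivative^[m] g).eval ξ = 0 := by
  induction m with
  | zero => intro g t _ hJt h0; exact ⟨t 0, hJt 0 le_rfl, h0 0 le_rfl⟩
  | succ m ih =>
    intro g t hmono hJt h0
    have hex : ∀ j, ∃ u, j ≤ m → (t j < u ∧ u < t (j + 1)) ∧ (derivative g).eval u = 0 := by
      intro j
      by_cases hj : j ≤ m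
      · obtain ⟨u, hu, hu0⟩ := exists_hasDerivAt_eq_zero (f := fun x => g.eval x)
          (f' := fun x => (derivative g).eval x) (hmono j (by omega))
          g.continuous.continuousOn (by rw [h0 j (by omega), h0 (j + 1) (by omega)])
          (fun x _ => g.hasDerivAt x)
        exact ⟨u, fun _ => ⟨hu, hu0⟩⟩
      · exact ⟨0, fun h => absurd h hj⟩
    choose u hu using hex
    obtain ⟨ξ, hξ, h⟩ := ih (derivative g) u
      (fun j hj => ((hu j (by omega)).1.2).trans (hu (j + 1) (by omega)).1.1)
      (fun j hj => hJ.out (hJt j (by omega)) (hJt (j + 1) (by omega))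
        ⟨(hu j hj).1.1.le, (hu j hj).1.2.le⟩)
      (fun j hj => (hu j hj).2)
    exact ⟨ξ, hξ, by rwa [Function.iterate_succ_apply]⟩

/-- Newton interpolation on increasing nodes in `J`, with the mean value form of the divided
differences: the `k`-th coefficient is `f⁽ᵏ⁾(ξ) / k!` for some `ξ` in `J`. -/
theorem exists_newton_interpolation {J : Set ℝ} (hJ : J.OrdConnected) (f : ℝ[X]) (t : ℕ → ℝ) (m : ℕ)
    (hmono : ∀ i j, i < j → j < m → t i < t j) (hJt : ∀ j, j < m → t j ∈ J) :
    ∃ c : ℕ → ℝ, (∀ k, k < m → ∃ ξ ∈ J, c k = (derivative^[k] f).eval ξ / (k.factorial : ℝ)) ∧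
      ∀ j, j < m → f.eval (t j) = ∑ k ∈ range m, c k * ∏ l ∈ range k, (t j - t l) := by
  induction m with
  | zero => exact ⟨0, by simp, by simp⟩
  | succ m ih =>
    obtain ⟨c, hc, hcf⟩ := ih (fun i j hij hj => hmono i j hij (by omega))
      (fun j hj => hJt j (by omega))
    set N : ℕ → ℝ[X] := fun k => ∏ l ∈ range k, (X - C (t l)) with hN
    have hNmonic : ∀ k, (N k).Monic := fun k => monic_prod_of_monic _ _ fun l _ => monic_X_sub_C _
    have hNdeg : ∀ k, (N k).natDegree = k := fun k => by
      rw [hN]; simp [natDegree_prod_of_monic _ _ (fun l _ => monic_X_sub_C (t l))]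
    have hNeval : ∀ k x, (N k).eval x = ∏ l ∈ range k, (x - t l) := fun k x => by
      simp [hN, eval_prod]
    set P : ℝ[X] := ∑ k ∈ range m, C (c k) * N k with hP
    have hPeval : ∀ x, P.eval x = ∑ k ∈ range m, c k * ∏ l ∈ range k, (x - t l) := fun x => by
      simp [hP, eval_finsetSum, hNeval]
    set cm : ℝ := (f.eval (t m) - P.eval (t m)) / (N m).eval (t m) with hcm
    have hNm : (N m).eval (t m) ≠ 0 := by
      rw [hNeval, prod_ne_zero_iff]
      intro l hl
      exact sub_ne_zero.2 (hmono l m (mem_range.1 hl) (by omega)).ne'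
    have hzero : ∀ j, j ≤ m → (f - (P + C cm * N m)).eval (t j) = 0 := by
      intro j hj
      rcases hj.lt_or_eq with hj | rfl
      · have h1 : (N m).eval (t j) = 0 := by
          rw [hNeval]
          exact prod_eq_zero (mem_range.2 hj) (sub_self _)
        simp [h1, hcf j hj, hPeval]
      · simp only [eval_sub, eval_add, eval_mul, eval_C, hcm]
        field_simp
        ring
    obtain ⟨ξ, hξ, hξ0⟩ := exists_iterate_derivative_eval_eq_zero hJ m _ t
      (fun j hj => hmono j (j + 1) (by omega) (by omega)) (fun j hj => hJt j (by omega)) hzero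
    have hPder : derivative^[m] P = 0 := by
      rw [hP, iterate_derivative_sum]
      refine sum_eq_zero fun k hk => iterate_derivative_eq_zero ?_
      calc (C (c k) * N k).natDegree ≤ (N k).natDegree := natDegree_C_mul_le _ _
        _ < m := by rw [hNdeg]; exact mem_range.1 hk
    have hNder : derivative^[m] (N m) = C (m.factorial : ℝ) := by
      have h1 : (derivative^[m] (N m)).natDegree ≤ 0 := by
        have := natDegree_iterate_derivative (N m) m
        rwa [hNdeg, Nat.sub_self] at this
      rw [eq_C_of_natDegree_le_zero h1, coeff_iterate_derivative]
      have h2 : (N m).coeff m = 1 := by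
        have := (hNmonic m).coeff_natDegree
        rwa [hNdeg] at this
      simp [h2, Nat.descFactorial_self]
    have hcm' : cm = (derivative^[m] f).eval ξ / (m.factorial : ℝ) := by
      rw [iterate_derivative_sub, iterate_map_add derivative, hPder, iterate_derivative_C_mul, hNder] at hξ0
      simp only [eval_sub, eval_mul, eval_C, zero_add] at hξ0
      have : (m.factorial : ℝ) ≠ 0 := by positivity
      field_simp
      linarith
    refine ⟨fun k => if k < m then c k else cm, ?_, ?_⟩
    · intro k hk
      by_cases hkm : k < m
      · simpa [hkm] using hc k hkm
      · have : k = m := by omega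
        subst this
        exact ⟨ξ, hξ, by simpa using hcm'⟩
    · intro j hj
      have h1 := hzero j (by omega)
      rw [eval_sub, sub_eq_zero, eval_add, hPeval, eval_mul, eval_C, hNeval] at h1
      rw [h1, sum_range_succ]
      congr 1
      · refine sum_congr rfl fun k hk => ?_
        simp only [if_pos (mem_range.1 hk)]
      · simp

end Newton

section Vandermonde

/-! ### Products of differences and of gaps -/

open Finset

variable {n : ℕ}

/-- The Vandermonde product of the differences `t j - t l`, `l < j`. -/
def diffProd (t : Fin (n + 1) → ℝ) : ℝ := ∏ j, ∏ l ∈ Iio j, (t j - t l)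

/-- The length of the `l`-th gap of `t`. -/
def gap (t : Fin (n + 1) → ℝ) (l : Fin n) : ℝ := t l.succ - t l.castSucc

theorem gap_pos {t : Fin (n + 1) → ℝ} (ht : StrictMono t) (l : Fin n) : 0 < gap t l :=
  sub_pos.2 (ht (Fin.castSucc_lt_succ))

theorem gap_le_abs_sub {t : Fin (n + 1) → ℝ} (ht : StrictMono t) (i : Fin (n + 1)) (l : Fin n) :
    gap t l ≤ |t i - t (i.succAbove l)| := by
  unfold gap
  rcases lt_or_ge l.castSucc i with h | h
  · rw [Fin.succAbove_of_castSucc_lt _ _ h]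
    have h1 : t l.succ ≤ t i := ht.monotone (Fin.castSucc_lt_iff_succ_le.1 h)
    exact le_trans (by linarith) (le_abs_self _)
  · rw [Fin.succAbove_of_le_castSucc _ _ h]
    have h1 : t i ≤ t l.castSucc := ht.monotone h
    exact le_trans (by linarith) (neg_le_abs _)

theorem diffProd_pos {t : Fin (n + 1) → ℝ} (ht : StrictMono t) : 0 < diffProd t :=
  prod_pos fun _ _ => prod_pos fun _ hl => sub_pos.2 (ht (mem_Iio.1 hl))

/-- Each point is joined to the other points by a star, so that the product of its distances to
them is at least the product of all gaps. -/
theorem prod_gap_pow_le_diffProd_sq {t : Fin (n + 1) → ℝ} (ht : StrictMono t) :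
    (∏ l, gap t l) ^ (n + 1) ≤ diffProd t ^ 2 := by
  have h1 : ∏ i, ∏ l, |t i - t (Fin.succAbove i l)| = diffProd t ^ 2 := by
    have h2 : ∀ i : Fin (n + 1), ∏ l, |t i - t (Fin.succAbove i l)|
        = (∏ j ∈ Iio i, (t i - t j)) * ∏ j ∈ Ioi i, (t j - t i) := by
      intro i
      rw [← prod_image (s := univ) (g := i.succAbove) (f := fun j => |t i - t j|)
        (fun a _ b _ h => Fin.succAbove_right_injective h), Fin.image_succAbove_univ]
      have h3 : ({i}ᶜ : Finset (Fin (n + 1))) = Iio i ∪ Ioi i := by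
        ext j; simp [lt_or_lt_iff_ne]
      rw [h3, prod_union]
      · congr 1
        · exact prod_congr rfl fun j hj => abs_of_pos (sub_pos.2 (ht (mem_Iio.1 hj)))
        · refine prod_congr rfl fun j hj => ?_
          rw [abs_sub_comm]
          exact abs_of_pos (sub_pos.2 (ht (mem_Ioi.1 hj)))
      · rw [disjoint_left]
        intro j hj hj'
        exact lt_asymm (mem_Iio.1 hj) (mem_Ioi.1 hj')
    rw [prod_congr rfl fun i _ => h2 i, prod_mul_distrib, pow_two]
    congr 1
    unfold diffProd
    refine prod_comm' ?_
    intro x y; simp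
  rw [← h1]
  calc (∏ l, gap t l) ^ (n + 1) = ∏ _i : Fin (n + 1), ∏ l, gap t l := by simp
    _ ≤ _ := prod_le_prod (fun i _ => prod_nonneg fun l _ => (gap_pos ht l).le) fun i _ =>
      prod_le_prod (fun l _ => (gap_pos ht l).le) fun l _ => gap_le_abs_sub ht i l

/-- The form in which the Vandermonde product enters the estimates: the exponent `(n + 1) / 2` of
the product of the gaps is the same for all gaps. -/
theorem prod_gap_rpow_le_diffProd {t : Fin (n + 1) → ℝ} (ht : StrictMono t) :
    (∏ l, gap t l) ^ (((n : ℝ) + 1) / 2) ≤ diffProd t := by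
  have h0 : 0 ≤ ∏ l, gap t l := prod_nonneg fun l _ => (gap_pos ht l).le
  have h1 := Real.sqrt_le_sqrt (prod_gap_pow_le_diffProd_sq ht)
  rw [Real.sqrt_sq (diffProd_pos ht).le, Real.sqrt_eq_rpow, ← Real.rpow_natCast,
    ← Real.rpow_mul h0] at h1
  convert h1 using 2
  push_cast; ring

end Vandermonde

section GoodCurves

/-! ### Good curves and the Jacobian of the sum map -/

open Polynomial Finset

variable {n : ℕ}

/-- The number `ε` is so small that every matrix whose diagonal entries are at least `1` and whose
off-diagonal entries are at most `ε` times the diagonal entry of their row has determinant at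
least `1 / 2`. -/
def DetMargin (n : ℕ) (ε : ℝ) : Prop :=
  ∀ M : Matrix (Fin (n + 1)) (Fin (n + 1)) ℝ, (∀ i, 1 ≤ M i i) →
    (∀ i j, i ≠ j → |M i j| ≤ ε * M i i) → 1 / 2 ≤ M.det

/-- Divide each row by its diagonal entry and use the continuity of the determinant at the identity. -/
theorem exists_detMargin (n : ℕ) : ∃ ε : ℝ, 0 < ε ∧ DetMargin n ε := by
  have hc : ContinuousAt (fun M : Fin (n + 1) → Fin (n + 1) → ℝ => (Matrix.of M).det)
      (fun i j => if i = j then 1 else 0) := by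
    have : Continuous (fun M : Matrix (Fin (n + 1)) (Fin (n + 1)) ℝ => M.det) :=
      continuous_id.matrix_det
    exact this.continuousAt
  have h1 : (Matrix.of (fun i j : Fin (n + 1) => if i = j then (1 : ℝ) else 0)).det = 1 := by
    have : Matrix.of (fun i j : Fin (n + 1) => if i = j then (1 : ℝ) else 0) = 1 := by
      ext i j; simp [Matrix.one_apply]
    rw [this, Matrix.det_one]
  obtain ⟨δ, hδ, h⟩ := Metric.continuousAt_iff.1 hc (1 / 2) (by norm_num)
  refine ⟨δ / 2, by positivity, fun M hd ho => ?_⟩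
  have hpos : ∀ i, 0 < M i i := fun i => lt_of_lt_of_le one_pos (hd i)
  set A : Fin (n + 1) → Fin (n + 1) → ℝ := fun i j => M i j / M i i with hA
  have hM : M = Matrix.diagonal (fun i => M i i) * Matrix.of A := by
    ext i j
    rw [Matrix.diagonal_mul]
    simp only [hA, Matrix.of_apply]
    field_simp [(hpos i).ne']
  have hdist : dist A (fun i j => if i = j then 1 else 0) < δ := by
    refine lt_of_le_of_lt ?_ (half_lt_self hδ)
    refine (dist_pi_le_iff (by positivity)).2 fun i => (dist_pi_le_iff (by positivity)).2 fun j => ?_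
    by_cases hij : i = j
    · subst hij
      simp only [hA, div_self (hpos i).ne', if_true, dist_self]
      positivity
    · simp only [hA, hij, if_false, Real.dist_eq, sub_zero, abs_div, abs_of_pos (hpos i)]
      rw [div_le_iff₀ (hpos i)]
      exact ho i j hij
  have hdet := h hdist
  rw [h1, Real.dist_eq, abs_lt] at hdet
  rw [hM, Matrix.det_mul, Matrix.det_diagonal]
  have hprod : (1 : ℝ) ≤ ∏ i, M i i := by
    calc (1 : ℝ) = ∏ _i : Fin (n + 1), 1 := by simp
      _ ≤ _ := prod_le_prod (fun _ _ => zero_le_one) fun i _ => hd i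
  nlinarith

/-- A curve whose derivatives of orders `1, …, n + 1` on `J` are, up to a positive factor in each
coordinate, within `ε` of the standard basis. The class is stable under sums of translates. -/
structure GoodCurve (ε : ℝ) (γ : Fin (n + 1) → ℝ[X]) (J : Set ℝ) : Prop where
  diag : ∀ i : Fin (n + 1), ∀ t ∈ J, 1 ≤ (derivative^[(i : ℕ) + 1] (γ i)).eval t
  off : ∀ i j : Fin (n + 1), i ≠ j → ∀ s ∈ J, ∀ t ∈ J,
    |(derivative^[(j : ℕ) + 1] (γ i)).eval s| ≤ ε * (derivative^[(i : ℕ) + 1] (γ i)).eval t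

/-- The matrix with columns `γ'(t 0), …, γ'(t n)`, which is the Jacobian matrix of the sum map
`t ↦ γ(t 0) + ⋯ + γ(t n)`. -/
noncomputable def velocityMatrix (γ : Fin (n + 1) → ℝ[X]) (t : Fin (n + 1) → ℝ) :
    Matrix (Fin (n + 1)) (Fin (n + 1)) ℝ :=
  Matrix.of fun i j => (derivative (γ i)).eval (t j)

/-- The constant in the lower bound for the Jacobian. -/
noncomputable def jacobianConst (n : ℕ) : ℝ :=
  1 / 2 * ∏ k : Fin (n + 1), (((k : ℕ).factorial : ℝ))⁻¹

theorem jacobianConst_pos (n : ℕ) : 0 < jacobianConst n := by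
  unfold jacobianConst
  have : 0 < ∏ k : Fin (n + 1), (((k : ℕ).factorial : ℝ))⁻¹ := prod_pos fun k _ => by positivity
  positivity

/-- The Jacobian of the sum map of a good curve is at least a constant times the Vandermonde product.
Newton interpolation of each component of `γ'` at the nodes `t` writes the velocity matrix as a
product `M * diag(1 / k!) * B`, where row `i` of `M` holds the derivatives of `γ i` at intermediate
points that may differ from entry to entry, and `B` is triangular with determinant `diffProd t`. -/
theorem le_det_velocityMatrix {ε : ℝ} (hε : DetMargin n ε) {γ : Fin (n + 1) → ℝ[X]} {J : Set ℝ}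
    (hJ : J.OrdConnected) (hγ : GoodCurve ε γ J) {t : Fin (n + 1) → ℝ} (ht : StrictMono t)
    (htJ : ∀ j, t j ∈ J) : jacobianConst n * diffProd t ≤ (velocityMatrix γ t).det := by
  set t' : ℕ → ℝ := fun j => if h : j < n + 1 then t ⟨j, h⟩ else 0 with ht'
  have ht'j : ∀ j : Fin (n + 1), t' j = t j := fun j => dif_pos j.2
  have hN := fun i : Fin (n + 1) => exists_newton_interpolation hJ (derivative (γ i)) t' (n + 1)
    (fun a b hab hb => by
      have ha : a < n + 1 := by omega
      simp only [ht', dif_pos ha, dif_pos hb]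
      exact ht (show (⟨a, ha⟩ : Fin (n + 1)) < ⟨b, hb⟩ from hab))
    (fun j hj => by simp only [ht', dif_pos hj]; exact htJ ⟨j, hj⟩)
  choose c hc hcf using hN
  have hξ : ∀ i k : Fin (n + 1), ∃ ξ ∈ J, c i k
      = (derivative^[(k : ℕ) + 1] (γ i)).eval ξ / ((k : ℕ).factorial : ℝ) := fun i k => hc i k k.2
  choose ξ hξJ hξ using hξ
  set M : Matrix (Fin (n + 1)) (Fin (n + 1)) ℝ :=
    Matrix.of fun i k => (derivative^[(k : ℕ) + 1] (γ i)).eval (ξ i k) with hM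
  set B : Matrix (Fin (n + 1)) (Fin (n + 1)) ℝ :=
    Matrix.of fun k j => ∏ l ∈ Iio k, (t j - t l) with hB
  have hrange : ∀ (k : Fin (n + 1)) (x : ℝ),
      ∏ l ∈ range (k : ℕ), (x - t' l) = ∏ l ∈ Iio k, (x - t l) := by
    intro k x
    rw [← Nat.Iio_eq_range, ← Fin.map_valEmbedding_Iio, prod_map]
    exact prod_congr rfl fun l _ => by rw [Fin.valEmbedding_apply, ht'j]
  have hfac : velocityMatrix γ t
      = M * Matrix.diagonal (fun k : Fin (n + 1) => (((k : ℕ).factorial : ℝ))⁻¹) * B := by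
    ext i j
    have h1 := hcf i j j.2
    rw [ht'j] at h1
    rw [velocityMatrix, Matrix.of_apply, h1, ← Fin.sum_univ_eq_sum_range
      (fun k => c i k * ∏ l ∈ range k, (t j - t' l)), Matrix.mul_apply]
    refine sum_congr rfl fun k _ => ?_
    rw [hrange, hξ, Matrix.mul_diagonal, hM, hB, Matrix.of_apply, Matrix.of_apply, div_eq_mul_inv]
  have hdetB : B.det = diffProd t := by
    rw [Matrix.det_of_isUpperTriangular]
    · rfl
    · intro k j hkj
      exact prod_eq_zero (mem_Iio.2 hkj) (sub_self _)
  have hdetM : 1 / 2 ≤ M.det := hε M (fun i => hγ.diag i _ (hξJ i i))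
    (fun i j hij => hγ.off i j hij _ (hξJ i j) _ (hξJ i i))
  rw [hfac, Matrix.det_mul, Matrix.det_mul, Matrix.det_diagonal, hdetB, jacobianConst]
  have h3 : 0 < ∏ k : Fin (n + 1), (((k : ℕ).factorial : ℝ))⁻¹ := prod_pos fun k _ => by positivity
  have := diffProd_pos ht
  gcongr

theorem det_velocityMatrix_pos {ε : ℝ} (hε : DetMargin n ε) {γ : Fin (n + 1) → ℝ[X]} {J : Set ℝ}
    (hJ : J.OrdConnected) (hγ : GoodCurve ε γ J) {t : Fin (n + 1) → ℝ} (ht : StrictMono t)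
    (htJ : ∀ j, t j ∈ J) : 0 < (velocityMatrix γ t).det :=
  (mul_pos (jacobianConst_pos n) (diffProd_pos ht)).trans_le (le_det_velocityMatrix hε hJ hγ ht htJ)

end GoodCurves

section Injectivity

/-! ### Injectivity of the sum map -/

open Polynomial Finset

variable {n : ℕ}

/-- A sum of increments of `G` over `[lo, hi]`, clipped at the points of `t` and, with the opposite
sign, of `s`. Above each level between `lo` and `hi = t j` there are at least as many points of `t` as
of `s`, and strictly more near `hi`. So the sum is the integral of `G'` against a nonnegative weight
that is not identically zero, and it can vanish only if `G'` has a zero inside. -/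
theorem exists_root_of_sum_clipped_eq_zero {G : ℝ[X]} {lo hi : ℝ} {s t : Fin (n + 1) → ℝ}
    (ht : StrictMono t) (j : Fin (n + 1)) (hst : s j < t j) (hhi : hi = t j)
    (hlo : lo < hi) (hbelow : ∀ i, i < j → s i ≤ lo ∧ t i ≤ lo)
    (hsum : ∑ i, ((G.eval (min (t i) hi) - G.eval (min (t i) lo))
      - (G.eval (min (s i) hi) - G.eval (min (s i) lo))) = 0) :
    ∃ u, lo < u ∧ u < hi ∧ (derivative G).eval u = 0 := by
  by_contra hcon
  push Not at hcon
  -- the sum is positive if `G` increases on the interval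
  have key : ∀ P : ℝ[X], (∀ u, lo < u → u < hi → 0 < (derivative P).eval u) →
      0 < ∑ i, ((P.eval (min (t i) hi) - P.eval (min (t i) lo))
        - (P.eval (min (s i) hi) - P.eval (min (s i) lo))) := by
    intro P hP
    have hmono : StrictMonoOn (fun x => P.eval x) (Set.Icc lo hi) := by
      refine strictMonoOn_of_deriv_pos (convex_Icc lo hi) P.continuous.continuousOn ?_
      intro x hx
      rw [interior_Icc] at hx
      simpa using hP x hx.1 hx.2
    have hterm : ∀ u v : ℝ, min u hi ≤ min v hi →
        P.eval (min u hi) - P.eval (min u lo) ≤ P.eval (min v hi) - P.eval (min v lo) := by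
      intro u v huv
      have hval : ∀ w : ℝ, P.eval (min w hi) - P.eval (min w lo)
          = P.eval (max lo (min w hi)) - P.eval lo := by
        intro w
        rcases le_total w lo with h | h
        · rw [min_eq_left (h.trans hlo.le), min_eq_left h, max_eq_left h]; ring
        · rw [min_eq_right h, max_eq_right (le_min h hlo.le)]
      rw [hval, hval]
      have hm : ∀ w : ℝ, max lo (min w hi) ∈ Set.Icc lo hi := fun w =>
        ⟨le_max_left _ _, max_le hlo.le (min_le_right _ _)⟩
      have := hmono.monotoneOn (hm u) (hm v) (max_le_max le_rfl huv)
      linarith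
    refine sum_pos' (fun i _ => ?_) ⟨j, mem_univ j, ?_⟩
    · rw [sub_nonneg]
      rcases lt_or_ge i j with h | h
      · obtain ⟨h1, h2⟩ := hbelow i h
        rw [min_eq_left h1, min_eq_left h2, min_eq_left (h1.trans hlo.le),
          min_eq_left (h2.trans hlo.le)]
        simp
      · refine hterm _ _ ?_
        have : hi ≤ t i := by rw [hhi]; exact ht.monotone h
        rw [min_eq_right this]
        exact min_le_right _ _
    · rw [sub_pos]
      have e1 : min (t j) hi = hi := by rw [hhi, min_self]
      have e2 : min (t j) lo = lo := min_eq_right (by rw [← hhi]; exact hlo.le)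
      rw [e1, e2, min_eq_left (hst.le.trans hhi.ge)]
      rcases le_total (s j) lo with h | h
      · rw [min_eq_left h, sub_self, sub_pos]
        exact hmono ⟨le_rfl, hlo.le⟩ ⟨hlo.le, le_rfl⟩ hlo
      · rw [min_eq_right h]
        have := hmono ⟨h, hst.le.trans hhi.ge⟩ ⟨hlo.le, le_rfl⟩ (by rw [hhi]; exact hst)
        simp only at this
        linarith
  -- otherwise `G'` has constant sign there
  have hcont : ContinuousOn (fun x => (derivative G).eval x) (Set.Ioo lo hi) :=
    (derivative G).continuous.continuousOn
  have hconn : IsPreconnected (Set.Ioo lo hi) := isPreconnected_Ioo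
  have hne : ∀ x ∈ Set.Ioo lo hi, (derivative G).eval x ≠ 0 := fun x hx => hcon x hx.1 hx.2
  have hmid : (lo + hi) / 2 ∈ Set.Ioo lo hi := ⟨by linarith, by linarith⟩
  rcases lt_or_gt_of_ne (hne _ hmid) with hneg | hpos
  · have h2 := key (-G) (fun u h1 h2 => by
      rw [derivative_neg, eval_neg, neg_pos]
      by_contra hge
      push Not at hge
      obtain ⟨x, hx, hx0⟩ := hconn.intermediate_value hmid ⟨h1, h2⟩ hcont ⟨hneg.le, hge⟩
      exact hne x hx hx0)
    simp only [eval_neg] at h2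
    have : ∑ i, ((-G.eval (min (t i) hi) - -G.eval (min (t i) lo))
        - (-G.eval (min (s i) hi) - -G.eval (min (s i) lo)))
        = -∑ i, ((G.eval (min (t i) hi) - G.eval (min (t i) lo))
        - (G.eval (min (s i) hi) - G.eval (min (s i) lo))) := by
      rw [← sum_neg_distrib]; exact sum_congr rfl fun i _ => by ring
    rw [this, hsum] at h2
    simp at h2
  · have h2 := key G (fun u h1 h2 => by
      by_contra hge
      push Not at hge
      obtain ⟨x, hx, hx0⟩ := hconn.intermediate_value ⟨h1, h2⟩ hmid hcont ⟨hge, hpos.le⟩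
      exact hne x hx hx0)
    rw [hsum] at h2
    exact lt_irrefl _ h2

/-- The sum map `t ↦ γ(t 0) + ⋯ + γ(t n)` is injective on increasing tuples. For two tuples `s ≠ t`,
cut the line at the points `max (s j) (t j)`. On the `j`-th interval the counting functions of `s`
and `t` differ by a function of constant sign, which vanishes if `s j = t j`. If the two sums of `γ`
agree, some nontrivial combination `G` of the components of `γ` has zero increment against the
counting function on every one of the intervals, hence a zero of `G'` in each of them. These zeros
form an increasing tuple at which the velocity matrix is singular, against the positivity of the
Jacobian. -/
theorem eq_of_sum_eval_eq {ε : ℝ} (hε : DetMargin n ε) {γ : Fin (n + 1) → ℝ[X]} {J : Set ℝ}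
    (hJ : J.OrdConnected) (hγ : GoodCurve ε γ J) {s t : Fin (n + 1) → ℝ}
    (hs : StrictMono s) (ht : StrictMono t) (hsJ : ∀ j, s j ∈ J) (htJ : ∀ j, t j ∈ J)
    (hsum : ∀ i, ∑ j, (γ i).eval (t j) = ∑ j, (γ i).eval (s j)) : s = t := by
  by_contra hne
  obtain ⟨j₀, hj₀⟩ := Function.ne_iff.1 hne
  -- the `j`-th interval runs from `B j` to `M j`
  set M : Fin (n + 1) → ℝ := fun j => max (s j) (t j) with hM
  have hMmono : StrictMono M := fun a b hab => max_lt_max (hs hab) (ht hab)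
  set B : Fin (n + 1) → ℝ := Fin.cases (min (s 0) (t 0)) (fun l => M l.castSucc) with hB
  have hB0 : B 0 = min (s 0) (t 0) := rfl
  have hBs : ∀ l : Fin n, B l.succ = M l.castSucc := fun l => rfl
  have hBJ : ∀ j, B j ∈ J := by
    refine Fin.cases ?_ fun l => ?_
    · rw [hB0]; rcases min_choice (s 0) (t 0) with h | h <;> rw [h]
      exacts [hsJ 0, htJ 0]
    · rw [hBs]; rcases max_choice (s l.castSucc) (t l.castSucc) with h | h <;> simp only [hM] <;> rw [h]
      exacts [hsJ _, htJ _]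
  have hMJ : ∀ j, M j ∈ J := fun j => by
    rcases max_choice (s j) (t j) with h | h <;> simp only [hM] <;> rw [h]
    exacts [hsJ _, htJ _]
  have hbelow : ∀ j i, i < j → s i ≤ B j ∧ t i ≤ B j := by
    refine Fin.cases ?_ fun l => ?_
    · intro i hi; exact absurd hi (Fin.not_lt_zero i)
    · intro i hi
      rw [hBs]
      have : M i ≤ M l.castSucc := hMmono.monotone (Fin.le_castSucc_iff.2 hi)
      exact ⟨(le_max_left _ _).trans this, (le_max_right _ _).trans this⟩
  have hBM : ∀ j, s j ≠ t j → B j < M j := by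
    refine Fin.cases ?_ fun l => ?_
    · intro h; rw [hB0]; exact min_lt_max.2 h
    · intro _; rw [hBs]; exact hMmono Fin.castSucc_lt_succ
  have hBM' : ∀ j, B j ≤ M j := by
    refine Fin.cases ?_ fun l => ?_
    · rw [hB0]; exact min_le_max
    · rw [hBs]; exact (hMmono Fin.castSucc_lt_succ).le
  have hMB : ∀ i j, i < j → M i ≤ B j := fun i j hij => max_le (hbelow j i hij).1 (hbelow j i hij).2
  -- the difference of the sums of `G` over `t` and `s`, restricted to the `j`-th interval
  set W : ℝ[X] → Fin (n + 1) → ℝ := fun G j => ∑ i, ((G.eval (min (t i) (M j)) - G.eval (min (t i) (B j)))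
      - (G.eval (min (s i) (M j)) - G.eval (min (s i) (B j)))) with hW
  have htel : ∀ G : ℝ[X], ∑ j, W G j = ∑ i, G.eval (t i) - ∑ i, G.eval (s i) := by
    intro G
    have h1 : ∀ u : ℝ, ∑ j, (G.eval (min u (M j)) - G.eval (min u (B j)))
        = G.eval (min u (M (Fin.last n))) - G.eval (min u (B 0)) := by
      intro u
      rw [sum_sub_distrib, Fin.sum_univ_castSucc (fun j => G.eval (min u (M j))),
        Fin.sum_univ_succ (fun j => G.eval (min u (B j)))]
      simp only [hBs]
      ring
    simp only [hW]
    rw [sum_comm, ← sum_sub_distrib]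
    refine sum_congr rfl fun i _ => ?_
    rw [sum_sub_distrib, h1, h1]
    have h2 : M i ≤ M (Fin.last n) := hMmono.monotone (Fin.le_last i)
    have h3 : B 0 ≤ s i := by rw [hB0]; exact (min_le_left _ _).trans (hs.monotone (Fin.zero_le i))
    have h4 : B 0 ≤ t i := by rw [hB0]; exact (min_le_right _ _).trans (ht.monotone (Fin.zero_le i))
    rw [min_eq_left ((le_max_right _ _).trans h2), min_eq_left ((le_max_left _ _).trans h2),
      min_eq_right h3, min_eq_right h4]
    ring
  have hWzero : ∀ G j, s j = t j → W G j = 0 := by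
    intro G j hj
    refine sum_eq_zero fun i _ => ?_
    rcases lt_or_ge i j with h | h
    · obtain ⟨h1, h2⟩ := hbelow j i h
      have h3 := hBM' j
      rw [min_eq_left h1, min_eq_left h2, min_eq_left (h1.trans h3), min_eq_left (h2.trans h3)]
      ring
    · have e1 : M j = s j := by simp [hM, hj]
      have e2 : M j = t j := by simp [hM, hj]
      have h1 : M j ≤ s i := by rw [e1]; exact hs.monotone h
      have h2 : M j ≤ t i := by rw [e2]; exact ht.monotone h
      have h3 := hBM' j
      rw [min_eq_right h1, min_eq_right h2, min_eq_right (h3.trans h1), min_eq_right (h3.trans h2)]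
      ring
  classical
  -- an empty interval, where `s j = t j`, is replaced by the derivative at the common point;
  -- the sum of the remaining columns vanishes
  set Z : Matrix (Fin (n + 1)) (Fin (n + 1)) ℝ :=
    Matrix.of fun i j => if s j = t j then (derivative (γ i)).eval (M j) else W (γ i) j with hZ
  have hdetZ : Z.det = 0 := by
    rw [← Matrix.exists_mulVec_eq_zero_iff]
    refine ⟨fun j => if s j = t j then 0 else 1, ?_, ?_⟩
    · intro h
      have := congrFun h j₀
      simp [hj₀] at this
    · ext i
      have h1 := htel (γ i)
      rw [hsum i, sub_self] at h1
      change ∑ j, Z i j * (if s j = t j then (0 : ℝ) else 1) = 0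
      refine Eq.trans (sum_congr rfl fun j _ => ?_) h1
      by_cases hj : s j = t j
      · simp [hj, hWzero _ _ hj]
      · simp [hZ, hj]
  obtain ⟨a, ha, haZ⟩ := Matrix.exists_vecMul_eq_zero_iff.2 hdetZ
  set G : ℝ[X] := ∑ i, C (a i) * γ i with hG
  have hGeval : ∀ x, G.eval x = ∑ i, a i * (γ i).eval x := fun x => by
    simp [hG, eval_finsetSum]
  have hGder : ∀ x, (derivative G).eval x = ∑ i, a i * (derivative (γ i)).eval x := fun x => by
    simp [hG, eval_finsetSum]
  have hGW : ∀ j, W G j = ∑ i, a i * W (γ i) j := by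
    intro j
    simp only [hW, hGeval, mul_sum]
    rw [sum_comm]
    refine sum_congr rfl fun k _ => ?_
    rw [← sum_sub_distrib, ← sum_sub_distrib, ← sum_sub_distrib]
    exact sum_congr rfl fun i _ => by ring
  have hroot : ∀ j, ∃ u, B j ≤ u ∧ u ≤ M j ∧ (∀ i, i < j → M i < u) ∧ (derivative G).eval u = 0 := by
    intro j
    have hj0 : ∑ i, a i * Z i j = 0 := congrFun haZ j
    by_cases hj : s j = t j
    · refine ⟨M j, hBM' j, le_rfl, fun i hi => hMmono hi, ?_⟩
      rw [hGder]
      simpa [hZ, hj] using hj0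
    · have hWj : W G j = 0 := by
        rw [hGW]; simpa [hZ, hj] using hj0
      have hlt := hBM j hj
      have hex : ∃ u, B j < u ∧ u < M j ∧ (derivative G).eval u = 0 := by
        rcases lt_or_gt_of_ne hj with h | h
        · exact exists_root_of_sum_clipped_eq_zero ht j h (by simp [hM, h.le]) hlt (hbelow j) hWj
        · refine exists_root_of_sum_clipped_eq_zero hs j h (by simp [hM, h.le]) hlt
            (fun i hi => (hbelow j i hi).symm) ?_
          have : W G j = -∑ i, ((G.eval (min (s i) (M j)) - G.eval (min (s i) (B j)))
              - (G.eval (min (t i) (M j)) - G.eval (min (t i) (B j)))) := by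
            simp only [hW]
            rw [← sum_neg_distrib]; exact sum_congr rfl fun i _ => by ring
          rw [hWj] at this
          linarith
      obtain ⟨u, h1, h2, h3⟩ := hex
      exact ⟨u, h1.le, h2.le, fun i hi => (hMB i j hi).trans_lt h1, h3⟩
  choose u huB huM hulow hu0 using hroot
  have humono : StrictMono u := fun i j hij => (huM i).trans_lt (hulow j i hij)
  have huJ : ∀ j, u j ∈ J := fun j => hJ.out (hBJ j) (hMJ j) ⟨huB j, huM j⟩
  have hpos := det_velocityMatrix_pos hε hJ hγ humono huJ
  refine hpos.ne' (Matrix.exists_vecMul_eq_zero_iff.1 ⟨a, ha, ?_⟩)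
  ext j
  have := hu0 j
  rw [hGder] at this
  simpa [Matrix.vecMul, dotProduct, velocityMatrix] using this

end Injectivity

section Shear

/-! ### Coordinates adapted to translates -/

variable {n : ℕ}

/-- The map `(s, h) ↦ (s, s + h 0, …, s + h (n - 1))`: in these coordinates a tuple consists of the
first point and the differences of the others to it. -/
def shearEquiv (n : ℕ) : (ℝ × (Fin n → ℝ)) ≃ᵐ (Fin (n + 1) → ℝ) :=
  (MeasurableEquiv.mk
    { toFun := fun z : ℝ × (Fin n → ℝ) => (z.1, fun l => z.1 + z.2 l)
      invFun := fun z : ℝ × (Fin n → ℝ) => (z.1, fun l => z.2 l - z.1)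
      left_inv := fun z => by ext <;> simp
      right_inv := fun z => by ext <;> simp }
    (by
      refine measurable_fst.prodMk (measurable_pi_lambda _ fun l => ?_)
      exact measurable_fst.add ((measurable_pi_apply l).comp measurable_snd))
    (by
      refine measurable_fst.prodMk (measurable_pi_lambda _ fun l => ?_)
      exact ((measurable_pi_apply l).comp measurable_snd).sub measurable_fst)).trans
  (MeasurableEquiv.piFinSuccAbove (fun _ : Fin (n + 1) => ℝ) 0).symm

@[simp] theorem shearEquiv_zero (z : ℝ × (Fin n → ℝ)) : shearEquiv n z 0 = z.1 := rfl

@[simp] theorem shearEquiv_succ (z : ℝ × (Fin n → ℝ)) (l : Fin n) :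
    shearEquiv n z l.succ = z.1 + z.2 l := rfl

theorem measurePreserving_shearEquiv (n : ℕ) :
    MeasurePreserving (shearEquiv n) (volume : Measure (ℝ × (Fin n → ℝ))) volume := by
  have h1 := (volume_preserving_piFinSuccAbove (fun _ : Fin (n + 1) => ℝ) 0).symm
  suffices h2 : MeasurePreserving (fun z : ℝ × (Fin n → ℝ) => (z.1, fun l => z.1 + z.2 l))
      volume (volume : Measure (ℝ × (Fin n → ℝ))) from h1.comp h2
  refine MeasurePreserving.skew_product (f := id) (g := fun (s : ℝ) (h : Fin n → ℝ) => fun l => s + h l)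
    (MeasurePreserving.id _) ?_ ?_
  · refine measurable_pi_lambda _ fun l => ?_
    exact measurable_fst.add ((measurable_pi_apply l).comp measurable_snd)
  · refine Filter.Eventually.of_forall fun s => ?_
    exact (measurePreserving_add_left (volume : Measure (Fin n → ℝ)) (fun _ => s)).map_eq

theorem gap_shearEquiv (s : ℝ) (h : Fin n → ℝ) (l : Fin n) :
    gap (shearEquiv n (s, h)) l = gap (shearEquiv n (0, h)) l := by
  unfold gap
  have key : ∀ j : Fin (n + 1), shearEquiv n (s, h) j = s + shearEquiv n (0, h) j := by
    refine Fin.cases ?_ fun l => ?_ <;> simp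
  rw [key, key]; ring

end Shear

section Extension

/-! ### The multilinear extension operator and sums of translates -/

open Polynomial

variable {n : ℕ}

/-- The extension operator with respect to Lebesgue measure on the parameter line. -/
noncomputable def curveFourier {d : ℕ} (γ : Fin d → ℝ[X]) (f : ℝ → ℂ)
    (x : EuclideanSpace ℝ (Fin d)) : ℂ :=
  ∫ t, Complex.exp (Complex.I * ((inner ℝ x (curvePoint γ t) : ℝ) : ℂ)) * f t

/-- The sum `γ(t 0) + ⋯ + γ(t n)`. -/
noncomputable def sumCurve (γ : Fin (n + 1) → ℝ[X]) (t : Fin (n + 1) → ℝ) : Fin (n + 1) → ℝ :=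
  fun i => ∑ j, (γ i).eval (t j)

/-- The `(n + 1)`-linear extension operator, whose phase is `x · (γ(t 0) + ⋯ + γ(t n))`. -/
noncomputable def multiFourier (γ : Fin (n + 1) → ℝ[X]) (F : (Fin (n + 1) → ℝ) → ℂ)
    (x : EuclideanSpace ℝ (Fin (n + 1))) : ℂ :=
  ∫ t, Complex.exp (Complex.I * ((inner ℝ x (WithLp.toLp 2 (sumCurve γ t)) : ℝ) : ℂ)) * F t

theorem norm_exp_I_mul_ofReal (r : ℝ) : ‖Complex.exp (Complex.I * (r : ℂ))‖ = 1 := by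
  rw [mul_comm]; exact Complex.norm_exp_ofReal_mul_I r

theorem enorm_exp_I_mul_ofReal (r : ℝ) : ‖Complex.exp (Complex.I * (r : ℂ))‖ₑ = 1 := by
  rw [← ofReal_norm, norm_exp_I_mul_ofReal]; simp

/-- Homogeneous dimension `d(d+1)/2` in dimension `d = n + 1`. -/
noncomputable def homDim (n : ℕ) : ℝ := ((n : ℝ) + 1) * ((n : ℝ) + 2) / 2

theorem homDim_pos (n : ℕ) : 0 < homDim n := by unfold homDim; positivity

/-- The exponent `q` with `1 / q = w / D`, where `D = d (d + 1) / 2` and `w = 1 / p'`. All pairs of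
exponents on the critical line are parametrised by `w`; for `w = 0` the value is `⊤`. -/
noncomputable def critExp (n : ℕ) (w : ℝ) : ℝ≥0∞ := (ENNReal.ofReal (w / homDim n))⁻¹

theorem critExp_zero (n : ℕ) : critExp n 0 = ⊤ := by simp [critExp]

theorem critExp_of_pos {n : ℕ} {w : ℝ} (hw : 0 < w) :
    critExp n w = ENNReal.ofReal (homDim n / w) := by
  rw [critExp, ← ENNReal.ofReal_inv_of_pos (div_pos hw (homDim_pos n)), inv_div]

/-- The restricted strong type estimate `‖E_γ f‖_q ≤ A |E|^{1/p}` for `|f| ≤ χ_E`, where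
`1 / p = 1 - w` and `q` is the critical exponent. It is uniform over good curves. -/
def RestrictedBound (n : ℕ) (ε w : ℝ) (A : ℝ≥0) : Prop :=
  ∀ (γ : Fin (n + 1) → ℝ[X]) (J : Set ℝ), J.OrdConnected → GoodCurve ε γ J →
    ∀ E : Set ℝ, MeasurableSet E → E ⊆ J → volume E ≠ ⊤ →
    ∀ f : ℝ → ℂ, Measurable f → (∀ t, ‖f t‖ₑ ≤ E.indicator 1 t) →
      eLpNorm (curveFourier γ f) (critExp n w) volume ≤ A * volume E ^ (1 - w)

theorem continuous_curvePoint {d : ℕ} (γ : Fin d → ℝ[X]) : Continuous (curvePoint γ) := by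
  unfold curvePoint
  exact (PiLp.continuous_toLp 2 _).comp (continuous_pi fun i => (γ i).continuous)

theorem continuous_sumCurve (γ : Fin (n + 1) → ℝ[X]) : Continuous (sumCurve γ) :=
  continuous_pi fun i => continuous_finsetSum _ fun j _ => (γ i).continuous.comp (continuous_apply j)

/-- The offspring curve `s ↦ γ(s) + Σ_l γ(s + h l)`, a sum of translates of `γ`. -/
noncomputable def offspring (γ : Fin (n + 1) → ℝ[X]) (h : Fin n → ℝ) : Fin (n + 1) → ℝ[X] :=
  fun i => γ i + ∑ l, (γ i).comp (X + C (h l))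

theorem iterate_derivative_comp_X_add_C (p : ℝ[X]) (a : ℝ) (k : ℕ) :
    derivative^[k] (p.comp (X + C a)) = (derivative^[k] p).comp (X + C a) := by
  induction k with
  | zero => rfl
  | succ k ih => rw [Function.iterate_succ_apply', ih, Function.iterate_succ_apply', derivative_comp]; simp

theorem eval_iterate_derivative_offspring (γ : Fin (n + 1) → ℝ[X]) (h : Fin n → ℝ) (i : Fin (n + 1))
    (k : ℕ) (s : ℝ) : (derivative^[k] (offspring γ h i)).eval s
      = ∑ j, (derivative^[k] (γ i)).eval (shearEquiv n (s, h) j) := by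
  rw [Fin.sum_univ_succ, offspring, iterate_map_add derivative, iterate_derivative_sum, eval_add,
    eval_finsetSum]
  simp [iterate_derivative_comp_X_add_C]

theorem curvePoint_offspring (γ : Fin (n + 1) → ℝ[X]) (h : Fin n → ℝ) (s : ℝ) :
    curvePoint (offspring γ h) s = WithLp.toLp 2 (sumCurve γ (shearEquiv n (s, h))) := by
  unfold curvePoint sumCurve
  congr 1
  ext i
  exact eval_iterate_derivative_offspring γ h i 0 s

/-- Sums of translates of a good curve are good: the conditions defining good curves are linear
inequalities between derivatives at arbitrary pairs of points, so they can be added. -/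
theorem GoodCurve.offspring {ε : ℝ} {γ : Fin (n + 1) → ℝ[X]} {J : Set ℝ} (hγ : GoodCurve ε γ J)
    (h : Fin n → ℝ) :
    GoodCurve ε (offspring γ h) {s | ∀ j, shearEquiv n (s, h) j ∈ J} := by
  refine ⟨fun i t ht => ?_, fun i j hij s hs t ht => ?_⟩
  · rw [eval_iterate_derivative_offspring]
    refine (hγ.diag i _ (ht 0)).trans ?_
    refine Finset.single_le_sum (f := fun j => (derivative^[(i : ℕ) + 1] (γ i)).eval (shearEquiv n (t, h) j))
      (fun j _ => zero_le_one.trans (hγ.diag i _ (ht j))) (Finset.mem_univ 0)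
  · rw [eval_iterate_derivative_offspring, eval_iterate_derivative_offspring, Finset.mul_sum]
    exact (Finset.abs_sum_le_sum_abs _ _).trans
      (Finset.sum_le_sum fun k _ => hγ.off i j hij _ (hs k) _ (ht k))

theorem ordConnected_shear_preimage {J : Set ℝ} (hJ : J.OrdConnected) (h : Fin n → ℝ) :
    {s | ∀ j, shearEquiv n (s, h) j ∈ J}.OrdConnected := by
  refine ⟨fun a ha b hb c hc j => hJ.out (ha j) (hb j) ?_⟩
  revert j
  refine Fin.cases ?_ fun l => ?_
  · exact hc
  · simp only [shearEquiv_succ]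
    exact ⟨by linarith [hc.1], by linarith [hc.2]⟩

/-- For fixed differences `h` the multilinear operator is the extension operator of the offspring
curve. -/
theorem multiFourier_eq_integral_offspring (γ : Fin (n + 1) → ℝ[X]) {F : (Fin (n + 1) → ℝ) → ℂ}
    (hF : Integrable F) (x : EuclideanSpace ℝ (Fin (n + 1))) :
    multiFourier γ F x
      = ∫ h, curveFourier (offspring γ h) (fun s => F (shearEquiv n (s, h))) x := by
  have hm : Continuous fun t => Complex.exp (Complex.I *
      ((inner ℝ x (WithLp.toLp 2 (sumCurve γ t)) : ℝ) : ℂ)) := by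
    have := (PiLp.continuous_toLp 2 (fun _ : Fin (n + 1) => ℝ)).comp (continuous_sumCurve γ)
    fun_prop
  have hint : Integrable fun t => Complex.exp (Complex.I *
      ((inner ℝ x (WithLp.toLp 2 (sumCurve γ t)) : ℝ) : ℂ)) * F t :=
    hF.bdd_mul hm.aestronglyMeasurable
      (Filter.Eventually.of_forall fun t => (norm_exp_I_mul_ofReal _).le)
  unfold multiFourier curveFourier
  rw [← (measurePreserving_shearEquiv n).integral_comp' (g := fun t => Complex.exp (Complex.I *
      ((inner ℝ x (WithLp.toLp 2 (sumCurve γ t)) : ℝ) : ℂ)) * F t), Measure.volume_eq_prod,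
    integral_prod_symm]
  · simp_rw [curvePoint_offspring]
  · rw [← Measure.volume_eq_prod]
    exact ((measurePreserving_shearEquiv n).integrable_comp_emb
      (shearEquiv n).measurableEmbedding).2 hint

theorem enorm_multiFourier_le (γ : Fin (n + 1) → ℝ[X]) (F : (Fin (n + 1) → ℝ) → ℂ)
    (x : EuclideanSpace ℝ (Fin (n + 1))) : ‖multiFourier γ F x‖ₑ ≤ ∫⁻ t, ‖F t‖ₑ := by
  refine (enorm_integral_le_lintegral_enorm _).trans (le_of_eq ?_)
  simp_rw [enorm_mul, enorm_exp_I_mul_ofReal, one_mul]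

theorem enorm_curveFourier_le {d : ℕ} (γ : Fin d → ℝ[X]) (f : ℝ → ℂ)
    (x : EuclideanSpace ℝ (Fin d)) : ‖curveFourier γ f x‖ₑ ≤ ∫⁻ t, ‖f t‖ₑ := by
  refine (enorm_integral_le_lintegral_enorm _).trans (le_of_eq ?_)
  simp_rw [enorm_mul, enorm_exp_I_mul_ofReal, one_mul]

/-- Minkowski's inequality for the slices of a multilinear piece, followed by the restricted bound
for each sum of translates and Hölder's inequality in the differences `h`. -/
theorem eLpNorm_multiFourier_le_of_restrictedBound {ε w : ℝ} {A : ℝ≥0} (hw0 : 0 ≤ w) (hw1 : w < 1)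
    (hA : RestrictedBound n ε w A) {γ : Fin (n + 1) → ℝ[X]} {J : Set ℝ} (hJ : J.OrdConnected)
    (hγ : GoodCurve ε γ J) {S : Set (Fin (n + 1) → ℝ)} (hS : MeasurableSet S) (hSv : volume S ≠ ⊤)
    {E : Set ℝ} (hEJ : E ⊆ J) (hE : volume E ≠ ⊤) (hSE : ∀ t ∈ S, ∀ j, t j ∈ E)
    {H : Set (Fin n → ℝ)} (hH : MeasurableSet H)
    (hSH : ∀ s h, shearEquiv n (s, h) ∈ S → h ∈ H)
    {F : (Fin (n + 1) → ℝ) → ℂ} (hF : Measurable F) (hFS : ∀ t, ‖F t‖ₑ ≤ S.indicator 1 t) :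
    eLpNorm (multiFourier γ F) (critExp n w) volume
      ≤ (A + 1 : ℝ≥0) * (volume S ^ (1 - w) * volume H ^ w) := by
  have hFint : ∫⁻ t, ‖F t‖ₑ ≤ volume S := by
    calc ∫⁻ t, ‖F t‖ₑ ≤ ∫⁻ t, S.indicator 1 t := lintegral_mono hFS
      _ = volume S := by rw [lintegral_indicator_one hS]
  have hFI : Integrable F := ⟨hF.aestronglyMeasurable, by
    rw [hasFiniteIntegral_iff_enorm]; exact hFint.trans_lt hSv.lt_top⟩
  set m : (Fin n → ℝ) → ℝ≥0∞ := fun h => volume {s | shearEquiv n (s, h) ∈ S} with hm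
  have hS' : MeasurableSet (shearEquiv n ⁻¹' S) := (shearEquiv n).measurable hS
  have hmm : Measurable m := measurable_measure_prodMk_right hS'
  have hmtop : ∀ h, m h ≠ ⊤ := fun h => by
    refine ne_top_of_le_ne_top hE (measure_mono fun s hs => ?_)
    exact hSE _ hs 0
  have hmint : ∫⁻ h, m h = volume S := by
    rw [← (measurePreserving_shearEquiv n).measure_preimage hS.nullMeasurableSet,
      Measure.volume_eq_prod, Measure.prod_apply_symm hS']
    rfl
  have hAA : (A : ℝ≥0∞) ≤ ((A + 1 : ℝ≥0) : ℝ≥0∞) := by exact_mod_cast le_self_add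
  rcases hw0.eq_or_lt with rfl | hw0
  · rw [critExp_zero]
    refine (eLpNormEssSup_le_of_ae_enorm_bound (C := volume S) (Filter.Eventually.of_forall fun x =>
      (enorm_multiFourier_le γ F x).trans hFint)).trans ?_
    simp only [sub_zero, ENNReal.rpow_one, ENNReal.rpow_zero, mul_one]
    exact le_mul_of_one_le_left zero_le (by exact_mod_cast le_add_self)
  have hq1 : 1 ≤ homDim n / w := by
    rw [le_div_iff₀ hw0, homDim]
    have : (0 : ℝ) ≤ n := Nat.cast_nonneg n
    nlinarith
  rw [critExp_of_pos hw0]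
  have hKm : Measurable (Function.uncurry fun (x : EuclideanSpace ℝ (Fin (n + 1))) (h : Fin n → ℝ) =>
      curveFourier (offspring γ h) (fun s => F (shearEquiv n (s, h))) x) := by
    unfold curveFourier
    simp_rw [curvePoint_offspring]
    refine StronglyMeasurable.measurable ?_
    refine StronglyMeasurable.integral_prod_right
      (f := fun (z : EuclideanSpace ℝ (Fin (n + 1)) × (Fin n → ℝ)) (s : ℝ) => Complex.exp (Complex.I *
      ((inner ℝ z.1 (WithLp.toLp 2 (sumCurve γ (shearEquiv n (s, z.2)))) : ℝ) : ℂ))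
        * F (shearEquiv n (s, z.2))) ?_
    refine Measurable.stronglyMeasurable ?_
    have h1 : Measurable fun z : (EuclideanSpace ℝ (Fin (n + 1)) × (Fin n → ℝ)) × ℝ =>
        shearEquiv n (z.2, z.1.2) :=
      (shearEquiv n).measurable.comp (measurable_snd.prodMk (measurable_snd.comp measurable_fst))
    have h2 : Measurable fun t : Fin (n + 1) → ℝ => WithLp.toLp 2 (sumCurve γ t) :=
      ((PiLp.continuous_toLp 2 (fun _ : Fin (n + 1) => ℝ)).comp (continuous_sumCurve γ)).measurable
    refine Measurable.mul ?_ (hF.comp h1)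
    refine Complex.measurable_exp.comp (measurable_const.mul (Complex.measurable_ofReal.comp ?_))
    exact (measurable_fst.comp measurable_fst).inner (h2.comp h1)
  have hmain := eLpNorm_integral_le_of_forall (μ := (volume : Measure (EuclideanSpace ℝ (Fin (n + 1)))))
    (ν := (volume : Measure (Fin n → ℝ))) hq1 hKm
    (a := fun h => ((A + 1 : ℝ≥0) : ℝ≥0∞) * m h ^ (1 - w)) ((hmm.pow_const _).const_mul _)
    (fun h => ENNReal.mul_ne_top ENNReal.coe_ne_top
      (ENNReal.rpow_ne_top_of_nonneg (by linarith) (hmtop h)))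
    (fun h h0 x => by
      have hmh : m h = 0 := by
        rcases mul_eq_zero.1 h0 with h1 | h1
        · have : (A + 1 : ℝ≥0) = 0 := by exact_mod_cast h1
          simp at this
        · rcases ENNReal.rpow_eq_zero_iff.1 h1 with h2 | h2
          · exact h2.1
          · exact absurd h2.1 (hmtop h)
      have h1 : ∫⁻ s, ‖F (shearEquiv n (s, h))‖ₑ ≤ m h := by
        calc _ ≤ ∫⁻ s, {s | shearEquiv n (s, h) ∈ S}.indicator 1 s := by
              refine lintegral_mono fun s => ?_
              exact hFS _
          _ = m h := by
              rw [lintegral_indicator_one]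
              exact measurable_prodMk_right hS'
      have := (enorm_curveFourier_le (offspring γ h) (fun s => F (shearEquiv n (s, h))) x).trans h1
      rw [hmh] at this
      simpa using this)
    (fun h => by
      have hEh : MeasurableSet {s | shearEquiv n (s, h) ∈ S} := measurable_prodMk_right hS'
      rw [← critExp_of_pos hw0]
      refine (hA (offspring γ h) _ (ordConnected_shear_preimage hJ h) (hγ.offspring h)
        {s | shearEquiv n (s, h) ∈ S} hEh (fun s hs j => hEJ (hSE _ hs j)) (hmtop h)
        (fun s => F (shearEquiv n (s, h)))
        (hF.comp ((shearEquiv n).measurable.comp measurable_prodMk_right)) fun s => hFS _).trans ?_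
      gcongr)
  have heq : multiFourier γ F = fun x => ∫ h, curveFourier (offspring γ h) (fun s => F (shearEquiv n (s, h))) x :=
    funext fun x => multiFourier_eq_integral_offspring γ hFI x
  rw [heq]
  refine hmain.trans ?_
  rw [lintegral_const_mul _ (hmm.pow_const _)]
  gcongr
  have hHol := ENNReal.lintegral_mul_norm_pow_le (μ := (volume : Measure (Fin n → ℝ)))
    hmm.aemeasurable (g := H.indicator 1) (measurable_one.indicator hH).aemeasurable
    (p := 1 - w) (q := w) (by linarith) hw0.le (by ring)
  rw [hmint, lintegral_indicator_one hH] at hHol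
  refine le_trans (lintegral_mono fun h => ?_) hHol
  by_cases hh : h ∈ H
  · simp [hh]
  · have : m h = 0 := by
      have : {s | shearEquiv n (s, h) ∈ S} = ∅ := by
        ext s; simp only [Set.mem_ofPred_eq, Set.mem_empty_iff_false, iff_false]
        exact fun hs => hh (hSH s h hs)
      simp only [hm, this, measure_empty]
    rw [this, ENNReal.zero_rpow_of_pos (by linarith)]
    exact zero_le

end Extension

section Pieces

/-! ### Dyadic boxes of gaps -/

open Polynomial

variable {n : ℕ}

theorem hasFDerivAt_sumCurve (γ : Fin (n + 1) → ℝ[X]) (t : Fin (n + 1) → ℝ) :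
    HasFDerivAt (sumCurve γ) (LinearMap.toContinuousLinearMap (Matrix.toLin' (velocityMatrix γ t))) t := by
  rw [hasFDerivAt_pi']
  intro i
  have h : ∀ j : Fin (n + 1), HasFDerivAt (fun s : Fin (n + 1) → ℝ => (γ i).eval (s j))
      ((derivative (γ i)).eval (t j) • ContinuousLinearMap.proj (R := ℝ) (φ := fun _ : Fin (n + 1) => ℝ) j) t := by
    intro j
    have h1 := (γ i).hasDerivAt (t j)
    exact h1.comp_hasFDerivAt t (ContinuousLinearMap.proj (R := ℝ) (φ := fun _ : Fin (n + 1) => ℝ) j).hasFDerivAt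
  have h2 := HasFDerivAt.fun_sum (u := Finset.univ) (fun j _ => h j)
  refine h2.congr_fderiv ?_
  ext v
  simp [velocityMatrix, Matrix.mulVec, dotProduct]

theorem det_fderiv_sumCurve (γ : Fin (n + 1) → ℝ[X]) (t : Fin (n + 1) → ℝ) :
    (LinearMap.toContinuousLinearMap (Matrix.toLin' (velocityMatrix γ t))).det
      = (velocityMatrix γ t).det := by
  rw [ContinuousLinearMap.det, LinearMap.coe_toContinuousLinearMap, LinearMap.det_toLin']

/-- The `L²` bound for a multilinear piece, from Plancherel's theorem and the lower bound for the
Jacobian on tuples with given gaps. -/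
theorem eLpNorm_two_multiFourier_le {ε : ℝ} (hε : DetMargin n ε) {γ : Fin (n + 1) → ℝ[X]}
    {J : Set ℝ} (hJ : J.OrdConnected) (hγ : GoodCurve ε γ J)
    {S : Set (Fin (n + 1) → ℝ)} (hS : MeasurableSet S) (hSv : volume S ≠ ⊤)
    (hSJ : ∀ t ∈ S, ∀ j, t j ∈ J) (hSm : ∀ t ∈ S, StrictMono t) {P : ℝ} (hP : 0 < P)
    (hgap : ∀ t ∈ S, P ≤ ∏ l, gap t l)
    {F : (Fin (n + 1) → ℝ) → ℂ} (hF : Measurable F) (hFS : ∀ t, ‖F t‖ₑ ≤ S.indicator 1 t) :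
    eLpNorm (multiFourier γ F) 2 volume
      ≤ ENNReal.ofReal ((2 * Real.pi) ^ (n + 1)) ^ (1 / 2 : ℝ) *
        (ENNReal.ofReal (jacobianConst n * P ^ (((n : ℝ) + 1) / 2))⁻¹ * volume S) ^ (1 / 2 : ℝ) := by
  have hF0 : ∀ t, t ∉ S → F t = 0 := fun t ht => by
    have := hFS t
    simpa [ht] using this
  have hF1 : ∀ t, ‖F t‖ₑ ≤ 1 := fun t => (hFS t).trans (Set.indicator_le_self' (by simp) t)
  have hF2 : ∫⁻ t in S, ‖F t‖ₑ ^ (2 : ℝ) ≤ volume S := by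
    calc _ ≤ ∫⁻ t in S, 1 := by
          refine lintegral_mono fun t => ?_
          calc ‖F t‖ₑ ^ (2 : ℝ) ≤ 1 ^ (2 : ℝ) := by gcongr; exact hF1 t
            _ = 1 := by simp
      _ = volume S := by simp
  have hFI : IntegrableOn F S := by
    refine ⟨hF.aestronglyMeasurable, ?_⟩
    rw [hasFiniteIntegral_iff_enorm]
    calc _ ≤ ∫⁻ t in S, 1 := lintegral_mono fun t => hF1 t
      _ < ⊤ := by simpa using hSv.lt_top
  have hc : 0 < jacobianConst n * P ^ (((n : ℝ) + 1) / 2) :=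
    mul_pos (jacobianConst_pos n) (Real.rpow_pos_of_pos hP _)
  have hinj : Set.InjOn (sumCurve γ) S := by
    intro s hs t ht hst
    exact eq_of_sum_eval_eq hε hJ hγ (hSm s hs) (hSm t ht) (hSJ s hs) (hSJ t ht)
      (fun i => (congrFun hst i).symm)
  have hdetm : Measurable fun t => (velocityMatrix γ t).det := by
    have : Continuous fun t => velocityMatrix γ t := by
      refine continuous_matrix fun i j => ?_
      exact (derivative (γ i)).continuous.comp (continuous_apply j)
    exact this.matrix_det.measurable
  have hmain := eLpNorm_two_oscillatory_le hS
    (Φ := sumCurve γ) (fun t _ => (hasFDerivAt_sumCurve γ t).hasFDerivWithinAt) hinj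
    (by simpa only [det_fderiv_sumCurve] using hdetm) hc
    (fun t ht => by
      rw [det_fderiv_sumCurve]
      refine le_trans ?_ (le_abs_self _)
      refine le_trans ?_ (le_det_velocityMatrix hε hJ hγ (hSm t ht) (hSJ t ht))
      have h1 := jacobianConst_pos n
      gcongr
      refine le_trans ?_ (prod_gap_rpow_le_diffProd (hSm t ht))
      exact Real.rpow_le_rpow hP.le (hgap t ht) (by positivity))
    hF hFI (ne_top_of_le_ne_top hSv hF2)
  rw [Fintype.card_fin] at hmain
  refine le_trans (le_of_eq ?_) (hmain.trans ?_)
  · congr 1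
    ext x
    unfold multiFourier
    rw [setIntegral_eq_integral_of_forall_compl_eq_zero (fun t ht => by simp [hF0 t ht])]
  · gcongr

theorem measurableSet_forall {α ι : Type*} [MeasurableSpace α] [Countable ι] {p : ι → α → Prop}
    (h : ∀ i, MeasurableSet {x | p i x}) : MeasurableSet {x | ∀ i, p i x} := by
  have : {x | ∀ i, p i x} = ⋂ i, {x | p i x} := by ext; simp
  rw [this]
  exact MeasurableSet.iInter h

theorem measurable_gap (l : Fin n) : Measurable fun y : Fin (n + 1) → ℝ => gap y l :=
  (measurable_pi_apply _).sub (measurable_pi_apply _)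

/-- Volume of the tuples with prescribed gap ranges and coordinate ranges. -/
theorem volume_gaps_le (n : ℕ) (A : Set ℝ) (hA : MeasurableSet A) (B D : Fin n → Set ℝ)
    (hB : ∀ l, MeasurableSet (B l)) (hD : ∀ l, MeasurableSet (D l)) :
    volume {y : Fin (n + 1) → ℝ | y 0 ∈ A ∧ ∀ l, y l.succ ∈ B l ∧ gap y l ∈ D l}
      ≤ volume A * ∏ l, min (volume (B l)) (volume (D l)) := by
  have hSm : ∀ (n : ℕ) (B D : Fin n → Set ℝ), (∀ l, MeasurableSet (B l)) → (∀ l, MeasurableSet (D l)) →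
      MeasurableSet {y : Fin (n + 1) → ℝ | y 0 ∈ A ∧ ∀ l, y l.succ ∈ B l ∧ gap y l ∈ D l} := by
    intro n B D hB hD
    refine (measurable_pi_apply 0 hA).inter ?_
    refine measurableSet_forall fun l => ?_
    exact (measurable_pi_apply l.succ (hB l)).inter (measurable_gap l (hD l))
  induction n with
  | zero =>
    simp only [Finset.univ_eq_empty, Finset.prod_empty, mul_one]
    have := (volume_preserving_funUnique (Fin 1) ℝ).measure_preimage hA.nullMeasurableSet
    rw [← this]
    refine measure_mono fun y hy => ?_
    exact hy.1
  | succ n ih =>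
    set S' : Set (Fin (n + 1) → ℝ) := {y | y 0 ∈ A ∧ ∀ l : Fin n, y l.succ ∈ B l.castSucc ∧ gap y l ∈ D l.castSucc}
    have hS' : MeasurableSet S' := hSm n _ _ (fun l => hB _) (fun l => hD _)
    have ih' := ih (fun l => B l.castSucc) (fun l => D l.castSucc) (fun l => hB _) (fun l => hD _)
    set T : Set (ℝ × (Fin (n + 1) → ℝ)) :=
      {z | z.2 ∈ S' ∧ z.1 ∈ B (Fin.last n) ∧ z.1 - z.2 (Fin.last n) ∈ D (Fin.last n)}
    have hT : MeasurableSet T := by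
      refine (measurable_snd hS').inter ((measurable_fst (hB _)).inter ?_)
      have h1 : Measurable fun z : ℝ × (Fin (n + 1) → ℝ) => z.1 - z.2 (Fin.last n) :=
        measurable_fst.sub ((measurable_pi_apply _).comp measurable_snd)
      exact h1 (hD _)
    have hmp := volume_preserving_piFinSuccAbove (fun _ : Fin (n + 2) => ℝ) (Fin.last (n + 1))
    have hsub : {y : Fin (n + 2) → ℝ | y 0 ∈ A ∧ ∀ l, y l.succ ∈ B l ∧ gap y l ∈ D l}
        ⊆ (MeasurableEquiv.piFinSuccAbove (fun _ : Fin (n + 2) => ℝ) (Fin.last (n + 1))) ⁻¹' T := by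
      rintro y ⟨hy0, hy⟩
      have hv : ∀ j, (MeasurableEquiv.piFinSuccAbove (fun _ : Fin (n + 2) => ℝ) (Fin.last (n + 1)) y).2 j
          = y j.castSucc := fun j => by
        simp [MeasurableEquiv.piFinSuccAbove, Fin.insertNthEquiv]
        rfl
      have hv1 : (MeasurableEquiv.piFinSuccAbove (fun _ : Fin (n + 2) => ℝ) (Fin.last (n + 1)) y).1
          = y (Fin.last (n + 1)) := rfl
      refine ⟨⟨?_, fun l => ⟨?_, ?_⟩⟩, ?_, ?_⟩
      · rw [hv]; exact hy0
      · rw [hv]; exact (hy l.castSucc).1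
      · unfold gap; rw [hv, hv]; exact (hy l.castSucc).2
      · rw [hv1]; exact (hy (Fin.last n)).1
      · rw [hv1, hv]; exact (hy (Fin.last n)).2
    calc _ ≤ volume T := (measure_mono hsub).trans (hmp.measure_preimage hT.nullMeasurableSet).le
      _ = ∫⁻ y, volume {u | (u, y) ∈ T} := by
        rw [Measure.volume_eq_prod, Measure.prod_apply_symm hT]; rfl
      _ ≤ ∫⁻ y, S'.indicator (fun _ => min (volume (B (Fin.last n))) (volume (D (Fin.last n)))) y := by
        refine lintegral_mono fun y => ?_
        by_cases hy : y ∈ S'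
        · rw [Set.indicator_of_mem hy]
          refine le_min (measure_mono fun u hu => hu.2.1) ?_
          have : {u | (u, y) ∈ T} ⊆ (fun u => u - y (Fin.last n)) ⁻¹' D (Fin.last n) :=
            fun u hu => hu.2.2
          refine (measure_mono this).trans (le_of_eq ?_)
          exact (measurePreserving_sub_right volume (y (Fin.last n))).measure_preimage
            (hD _).nullMeasurableSet
        · have : {u | (u, y) ∈ T} = ∅ := by
            ext u; exact iff_of_false (fun h => hy h.1) (Set.notMem_empty u)
          simp [this]
      _ = volume S' * min (volume (B (Fin.last n))) (volume (D (Fin.last n))) := by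
        rw [lintegral_indicator_const hS', mul_comm]
      _ ≤ _ := by
        rw [Fin.prod_univ_castSucc, ← mul_assoc]
        gcongr

/-- Tuples whose gaps are, in units of `m`, in the dyadic intervals given by `k`. -/
def gapBox (m : ℝ) (k : Fin n → ℤ) : Set (Fin (n + 1) → ℝ) :=
  {t | ∀ l, gap t l ∈ Set.Ico (m * 2 ^ k l) (m * 2 ^ (k l + 1))}

theorem measurableSet_gapBox (m : ℝ) (k : Fin n → ℤ) : MeasurableSet (gapBox m k) := by
  exact measurableSet_forall fun l => measurable_gap l measurableSet_Ico

theorem strictMono_of_mem_gapBox {m : ℝ} (hm : 0 < m) {k : Fin n → ℤ} {t : Fin (n + 1) → ℝ}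
    (ht : t ∈ gapBox m k) : StrictMono t := by
  refine Fin.strictMono_iff_lt_succ.2 fun l => ?_
  have h1 : m * 2 ^ k l ≤ gap t l := (ht l).1
  have : 0 < gap t l := lt_of_lt_of_le (by positivity) h1
  exact sub_pos.1 this

theorem volume_Ico_dyadic (m : ℝ) (k : ℤ) :
    volume (Set.Ico (m * 2 ^ k) (m * 2 ^ (k + 1))) = ENNReal.ofReal (m * 2 ^ k) := by
  rw [Real.volume_Ico, zpow_add_one₀ (by norm_num)]
  congr 1; ring

/-- The tuples in `E` with gaps in a given dyadic box. -/
def boxPiece (E : Set ℝ) (m : ℝ) (k : Fin n → ℤ) : Set (Fin (n + 1) → ℝ) :=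
  {t | (∀ j, t j ∈ E) ∧ t ∈ gapBox m k}

theorem measurableSet_boxPiece {E : Set ℝ} (hE : MeasurableSet E) (m : ℝ) (k : Fin n → ℤ) :
    MeasurableSet (boxPiece E m k) :=
  (measurableSet_forall fun j => measurable_pi_apply j hE).inter (measurableSet_gapBox m k)

theorem volume_boxPiece_le {E : Set ℝ} (hE : MeasurableSet E) {m : ℝ} (hm : 0 < m)
    (hEm : volume E = ENNReal.ofReal m) (k : Fin n → ℤ) :
    volume (boxPiece E m k)
      ≤ ENNReal.ofReal (m ^ ((n : ℝ) + 1) * ∏ l, min 1 ((2 : ℝ) ^ k l)) := by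
  have h1 := volume_gaps_le n E hE (fun _ => E) (fun l => Set.Ico (m * 2 ^ k l) (m * 2 ^ (k l + 1)))
    (fun _ => hE) (fun _ => measurableSet_Ico)
  refine (measure_mono fun t ht => ?_).trans (h1.trans (le_of_eq ?_))
  · exact ⟨ht.1 0, fun l => ⟨ht.1 _, ht.2 l⟩⟩
  · simp_rw [volume_Ico_dyadic, hEm]
    have : ∀ l, min (ENNReal.ofReal m) (ENNReal.ofReal (m * 2 ^ k l))
        = ENNReal.ofReal (m * min 1 ((2 : ℝ) ^ k l)) := fun l => by
      rw [mul_min_of_nonneg _ _ hm.le, mul_one, ENNReal.ofReal_min]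
    simp_rw [this]
    rw [← ENNReal.ofReal_prod_of_nonneg (fun l _ => by positivity), ← ENNReal.ofReal_mul hm.le,
      Finset.prod_mul_distrib, Finset.prod_const, Finset.card_univ, Fintype.card_fin,
      ← mul_assoc, Real.rpow_add_one hm.ne', Real.rpow_natCast, mul_comm m]

/-- The differences `h` of the tuples in a gap box. -/
def gapBoxSlice (m : ℝ) (k : Fin n → ℤ) : Set (Fin n → ℝ) :=
  {h | shearEquiv n (0, h) ∈ gapBox m k}

theorem measurableSet_gapBoxSlice (m : ℝ) (k : Fin n → ℤ) : MeasurableSet (gapBoxSlice m k) :=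
  ((shearEquiv n).measurable.comp measurable_prodMk_left) (measurableSet_gapBox m k)

theorem mem_gapBoxSlice {m : ℝ} {k : Fin n → ℤ} {s : ℝ} {h : Fin n → ℝ} :
    shearEquiv n (s, h) ∈ gapBox m k ↔ h ∈ gapBoxSlice m k :=
  forall_congr' fun l => by rw [gap_shearEquiv]

theorem volume_gapBoxSlice_le {m : ℝ} (hm : 0 < m) (k : Fin n → ℤ) :
    volume (gapBoxSlice m k) ≤ ENNReal.ofReal (m ^ (n : ℝ) * ∏ l, (2 : ℝ) ^ k l) := by
  have h1 := volume_gaps_le n (Set.Icc 0 1) measurableSet_Icc (fun _ => Set.univ)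
    (fun l => Set.Ico (m * 2 ^ k l) (m * 2 ^ (k l + 1)))
    (fun _ => MeasurableSet.univ) (fun _ => measurableSet_Ico)
  set T := {y : Fin (n + 1) → ℝ | y 0 ∈ Set.Icc (0 : ℝ) 1 ∧ ∀ l : Fin n, y l.succ ∈ Set.univ ∧
    gap y l ∈ Set.Ico (m * 2 ^ k l) (m * 2 ^ (k l + 1))} with hT
  have hTm : MeasurableSet T :=
    (measurable_pi_apply 0 measurableSet_Icc).inter
      (measurableSet_forall fun l => MeasurableSet.univ.inter
        (measurable_gap l measurableSet_Ico))
  have h2 : shearEquiv n ⁻¹' T = Set.Icc 0 1 ×ˢ gapBoxSlice m k := by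
    ext ⟨s, h⟩
    refine and_congr Iff.rfl ?_
    refine Iff.trans ?_ (mem_gapBoxSlice (s := s))
    exact forall_congr' fun l => and_iff_right trivial
  have h3 : volume (gapBoxSlice m k) = volume T := by
    rw [← (measurePreserving_shearEquiv n).measure_preimage hTm.nullMeasurableSet, h2,
      Measure.volume_eq_prod, Measure.prod_prod]
    simp
  rw [h3]
  refine h1.trans (le_of_eq ?_)
  simp_rw [volume_Ico_dyadic]
  simp only [Real.volume_Icc, sub_zero, ENNReal.ofReal_one, one_mul, measure_univ_of_isAddLeftInvariant,
    le_top, inf_of_le_right]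
  rw [← ENNReal.ofReal_prod_of_nonneg (fun l _ => by positivity), Finset.prod_mul_distrib,
    Finset.prod_const, Finset.card_univ, Fintype.card_fin, Real.rpow_natCast]

end Pieces

section PieceBound

/-! ### The estimate for one gap box -/

open Polynomial

variable {n : ℕ}

/-- The factor contributed by a gap of relative size `2 ^ k`: the first power comes from the Jacobian
and from the range of the differences, the second from the volume of the piece, to which a gap
longer than the measure of the set contributes no more than that measure. -/
noncomputable def gapWeight (a b : ℝ) (k : ℤ) : ℝ := ((2 : ℝ) ^ k) ^ a * (min 1 ((2 : ℝ) ^ k)) ^ b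

theorem gapWeight_nonneg (a b : ℝ) (k : ℤ) : 0 ≤ gapWeight a b k := by
  unfold gapWeight; positivity

/-- The weights form a geometric series at both ends: the exponent is `a` for long gaps and `a + b`
for short ones. -/
theorem exists_gapWeight_sum_le {a b : ℝ} (ha : a < 0) (hab : 0 < a + b) :
    ∃ B : ℝ, 0 ≤ B ∧ ∀ N : ℕ, ∑ k ∈ Finset.Ico (-(N : ℤ)) N, gapWeight a b k ≤ B := by
  have hpos : ∀ k : ℕ, gapWeight a b (k : ℤ) = ((2 : ℝ) ^ a) ^ k := by
    intro k
    have h1 : (1 : ℝ) ≤ 2 ^ (k : ℤ) := by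
      rw [zpow_natCast]; exact one_le_pow₀ (by norm_num)
    rw [gapWeight, min_eq_left h1, Real.one_rpow, mul_one, zpow_natCast, ← Real.rpow_natCast,
      ← Real.rpow_natCast, ← Real.rpow_mul (by norm_num), ← Real.rpow_mul (by norm_num), mul_comm]
  have hneg : ∀ k : ℕ, gapWeight a b (-((k : ℤ) + 1)) ≤ ((2 : ℝ) ^ (-(a + b))) ^ k := by
    intro k
    have h1 : (2 : ℝ) ^ (-((k : ℤ) + 1)) ≤ 1 := zpow_le_one_of_nonpos₀ (by norm_num) (by omega)
    have h0 : (0 : ℝ) < 2 ^ (-((k : ℤ) + 1)) := by positivity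
    rw [gapWeight, min_eq_right h1, ← Real.rpow_add h0, ← Real.rpow_intCast, ← Real.rpow_natCast,
      ← Real.rpow_mul (by norm_num), ← Real.rpow_mul (by norm_num)]
    refine Real.rpow_le_rpow_of_exponent_le (by norm_num) ?_
    push_cast
    nlinarith
  have hs1 : Summable fun k : ℕ => ((2 : ℝ) ^ a) ^ k :=
    summable_geometric_of_lt_one (by positivity) (Real.rpow_lt_one_of_one_lt_of_neg (by norm_num) ha)
  have hs2 : Summable fun k : ℕ => ((2 : ℝ) ^ (-(a + b))) ^ k :=
    summable_geometric_of_lt_one (by positivity)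
      (Real.rpow_lt_one_of_one_lt_of_neg (by norm_num) (by linarith))
  have hs : Summable (gapWeight a b) := by
    refine Summable.of_nat_of_neg_add_one ?_ ?_
    · simpa only [hpos] using hs1
    · exact Summable.of_nonneg_of_le (fun k => gapWeight_nonneg _ _ _) hneg hs2
  exact ⟨∑' k, gapWeight a b k, tsum_nonneg (gapWeight_nonneg a b), fun N =>
    hs.sum_le_tsum _ fun k _ => gapWeight_nonneg a b k⟩

theorem measurable_multiFourier (γ : Fin (n + 1) → ℝ[X]) {F : (Fin (n + 1) → ℝ) → ℂ}
    (hF : Measurable F) : Measurable (multiFourier γ F) := by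
  refine StronglyMeasurable.measurable ?_
  refine StronglyMeasurable.integral_prod_right
    (f := fun (x : EuclideanSpace ℝ (Fin (n + 1))) (t : Fin (n + 1) → ℝ) => Complex.exp (Complex.I *
    ((inner ℝ x (WithLp.toLp 2 (sumCurve γ t)) : ℝ) : ℂ)) * F t) ?_
  refine Measurable.stronglyMeasurable ?_
  have h2 : Measurable fun t : Fin (n + 1) → ℝ => WithLp.toLp 2 (sumCurve γ t) :=
    ((PiLp.continuous_toLp 2 (fun _ : Fin (n + 1) => ℝ)).comp (continuous_sumCurve γ)).measurable
  refine Measurable.mul ?_ (hF.comp measurable_snd)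
  refine Complex.measurable_exp.comp (measurable_const.mul (Complex.measurable_ofReal.comp ?_))
  exact measurable_fst.inner (h2.comp measurable_snd)

theorem measurable_curveFourier {d : ℕ} (γ : Fin d → ℝ[X]) {f : ℝ → ℂ}
    (hf : Measurable f) : Measurable (curveFourier γ f) := by
  refine StronglyMeasurable.measurable ?_
  refine StronglyMeasurable.integral_prod_right
    (f := fun (x : EuclideanSpace ℝ (Fin d)) (t : ℝ) => Complex.exp (Complex.I *
    ((inner ℝ x (curvePoint γ t) : ℝ) : ℂ)) * f t) ?_
  refine Measurable.stronglyMeasurable ?_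
  refine Measurable.mul ?_ (hf.comp measurable_snd)
  refine Complex.measurable_exp.comp (measurable_const.mul (Complex.measurable_ofReal.comp ?_))
  exact measurable_fst.inner ((continuous_curvePoint γ).measurable.comp measurable_snd)

/-- Interpolation for one gap box between the `L²` bound, with weight `θ`, and the bound at the
critical exponent of `w`, with weight `1 - θ`. The power of `m` collects the scaling of both bounds,
and each gap contributes a `gapWeight`. -/
theorem exists_multiFourier_piece_bound {ε w θ : ℝ} {A : ℝ≥0} (hε : DetMargin n ε) (hw0 : 0 ≤ w)
    (hw1 : w < 1) (hθ0 : 0 < θ) (hθ1 : θ < 1) (hA : RestrictedBound n ε w A) :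
    ∃ K : ℝ, 0 ≤ K ∧ ∀ (γ : Fin (n + 1) → ℝ[X]) (J : Set ℝ), J.OrdConnected → GoodCurve ε γ J →
      ∀ (E : Set ℝ), MeasurableSet E → E ⊆ J → ∀ m : ℝ, 0 < m → volume E = ENNReal.ofReal m →
      ∀ (k : Fin n → ℤ) (F : (Fin (n + 1) → ℝ) → ℂ), Measurable F →
      (∀ t, ‖F t‖ₑ ≤ (boxPiece E m k).indicator 1 t) →
      eLpNorm (multiFourier γ F) (ENNReal.ofReal (θ / 2 + (1 - θ) * (w / homDim n)))⁻¹ volume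
        ≤ ENNReal.ofReal (K * m ^ (θ * (((n : ℝ) + 1) / 2 - n * (n + 1) / 4)
            + (1 - θ) * (((n : ℝ) + 1) * (1 - w) + n * w))
          * ∏ l, gapWeight (-(θ * (n + 1) / 4) + (1 - θ) * w) (θ / 2 + (1 - θ) * (1 - w)) (k l)) := by
  -- all positive quantities are written as exponentials, so that identities between products of
  -- powers become linear identities between exponents
  obtain ⟨κ, hκ⟩ : ∃ κ, Real.exp κ = jacobianConst n := ⟨_, Real.exp_log (jacobianConst_pos n)⟩
  obtain ⟨κ₂, hκ₂⟩ : ∃ κ₂, Real.exp κ₂ = (2 * Real.pi) ^ (n + 1) :=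
    ⟨_, Real.exp_log (pow_pos Real.two_pi_pos _)⟩
  obtain ⟨α, hα⟩ : ∃ α, Real.exp α = ((A + 1 : ℝ≥0) : ℝ) := ⟨_, Real.exp_log (by positivity)⟩
  refine ⟨Real.exp (θ * (κ₂ / 2 - κ / 2) + (1 - θ) * α), (Real.exp_pos _).le, ?_⟩
  intro γ J hJ hγ E hE hEJ m hm hEm k F hF hFS
  set X : ℝ := ∏ l, (2 : ℝ) ^ k l with hX
  set Y : ℝ := ∏ l, min 1 ((2 : ℝ) ^ k l) with hY
  have hXpos : 0 < X := Finset.prod_pos fun l _ => by positivity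
  have hYpos : 0 < Y := Finset.prod_pos fun l _ => by positivity
  have hmn : 0 < m ^ (n : ℝ) := Real.rpow_pos_of_pos hm _
  have hmn1 : 0 < m ^ ((n : ℝ) + 1) := Real.rpow_pos_of_pos hm _
  have hS := measurableSet_boxPiece hE m k
  have hSvol := volume_boxPiece_le hE hm hEm k
  have hHvol := volume_gapBoxSlice_le hm k
  rw [← hX] at hHvol
  rw [← hY] at hSvol
  have hSv : volume (boxPiece E m k) ≠ ⊤ := ne_top_of_le_ne_top ENNReal.ofReal_ne_top hSvol
  have hP : 0 < m ^ (n : ℝ) * X := mul_pos hmn hXpos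
  -- the two endpoint estimates
  have h2 := eLpNorm_two_multiFourier_le hε hJ hγ hS hSv (fun t ht j => hEJ (ht.1 j))
    (fun t ht => strictMono_of_mem_gapBox hm ht.2) hP
    (fun t ht => by
      calc m ^ (n : ℝ) * X = ∏ l, (m * 2 ^ k l) := by
            rw [Finset.prod_mul_distrib, Finset.prod_const, Finset.card_univ, Fintype.card_fin,
              Real.rpow_natCast]
        _ ≤ ∏ l, gap t l := Finset.prod_le_prod (fun l _ => by positivity) fun l _ => (ht.2 l).1)
    hF hFS
  have hq := eLpNorm_multiFourier_le_of_restrictedBound hw0 hw1 hA hJ hγ hS hSv hEJ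
    (by rw [hEm]; exact ENNReal.ofReal_ne_top) (fun t ht j => ht.1 j) (measurableSet_gapBoxSlice m k)
    (fun s h hs => mem_gapBoxSlice.1 hs.2) hF hFS
  have h2' : eLpNorm (multiFourier γ F) 2 volume ≤ ENNReal.ofReal
      (Real.exp κ₂ ^ (1 / 2 : ℝ) * ((Real.exp κ * (m ^ (n : ℝ) * X) ^ (((n : ℝ) + 1) / 2))⁻¹
        * (m ^ ((n : ℝ) + 1) * Y)) ^ (1 / 2 : ℝ)) := by
    rw [hκ, hκ₂, ENNReal.ofReal_mul (by positivity),
      ← ENNReal.ofReal_rpow_of_nonneg (by positivity) (by norm_num),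
      ← ENNReal.ofReal_rpow_of_nonneg (mul_nonneg (inv_nonneg.2
        (mul_nonneg (jacobianConst_pos n).le (by positivity))) (by positivity)) (by norm_num),
      ENNReal.ofReal_mul (inv_nonneg.2 (mul_nonneg (jacobianConst_pos n).le (by positivity)))]
    refine h2.trans ?_
    gcongr
  have hq' : eLpNorm (multiFourier γ F) (critExp n w) volume ≤ ENNReal.ofReal
      (Real.exp α * ((m ^ ((n : ℝ) + 1) * Y) ^ (1 - w) * (m ^ (n : ℝ) * X) ^ w)) := by
    rw [hα, ENNReal.ofReal_mul (by positivity), ENNReal.ofReal_mul (by positivity),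
      ← ENNReal.ofReal_rpow_of_nonneg (by positivity) (by linarith),
      ← ENNReal.ofReal_rpow_of_nonneg (by positivity) hw0, ENNReal.ofReal_coe_nnreal]
    refine hq.trans ?_
    gcongr
  have hmeas := (measurable_multiFourier γ hF).aestronglyMeasurable (μ := volume)
  have hconv := eLpNorm_le_rpow_mul_rpow hmeas hθ0 hθ1 (p := 2) (q := critExp n w)
    (r := (ENNReal.ofReal (θ / 2 + (1 - θ) * (w / homDim n)))⁻¹) (by
      have hD := homDim_pos n
      rw [inv_inv, critExp, inv_inv, ENNReal.ofReal_add (by positivity)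
        (mul_nonneg (by linarith) (by positivity)), mul_comm (1 - θ), ENNReal.ofReal_mul (by positivity),
        ENNReal.ofReal_div_of_pos (by norm_num), div_eq_mul_inv, mul_comm]
      simp)
  refine hconv.trans ?_
  calc _ ≤ (ENNReal.ofReal (Real.exp κ₂ ^ (1 / 2 : ℝ) * ((Real.exp κ * (m ^ (n : ℝ) * X) ^ (((n : ℝ) + 1) / 2))⁻¹
        * (m ^ ((n : ℝ) + 1) * Y)) ^ (1 / 2 : ℝ))) ^ θ
        * (ENNReal.ofReal (Real.exp α * ((m ^ ((n : ℝ) + 1) * Y) ^ (1 - w) * (m ^ (n : ℝ) * X) ^ w))) ^ (1 - θ) := by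
        have : 0 ≤ 1 - θ := by linarith
        gcongr
    _ = _ := by
      rw [ENNReal.ofReal_rpow_of_nonneg (by positivity) hθ0.le,
        ENNReal.ofReal_rpow_of_nonneg (by positivity) (by linarith), ← ENNReal.ofReal_mul (by positivity)]
      congr 1
      have hprod : ∏ l, gapWeight (-(θ * (n + 1) / 4) + (1 - θ) * w) (θ / 2 + (1 - θ) * (1 - w)) (k l)
          = X ^ (-(θ * (n + 1) / 4) + (1 - θ) * w) * Y ^ (θ / 2 + (1 - θ) * (1 - w)) := by
        simp only [gapWeight]
        rw [Finset.prod_mul_distrib, Real.finsetProd_rpow _ _ (fun l _ => by positivity),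
          Real.finsetProd_rpow _ _ (fun l _ => by positivity)]
      rw [hprod]
      obtain ⟨μ, rfl⟩ : ∃ μ, m = Real.exp μ := ⟨_, (Real.exp_log hm).symm⟩
      obtain ⟨ξ, hξ⟩ : ∃ ξ, X = Real.exp ξ := ⟨_, (Real.exp_log hXpos).symm⟩
      obtain ⟨η, hη⟩ : ∃ η, Y = Real.exp η := ⟨_, (Real.exp_log hYpos).symm⟩
      rw [hξ, hη]
      simp only [← Real.exp_mul, ← Real.exp_add, ← Real.exp_neg]
      congr 1
      ring

end PieceBound

section Symmetrization

/-! ### Symmetric integrands and increasing tuples -/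

variable {n : ℕ}

theorem ae_injective_pi (n : ℕ) : ∀ᵐ t : Fin n → ℝ, Function.Injective t := by
  have h : ∀ i j : Fin n, i ≠ j → ∀ᵐ t : Fin n → ℝ, t i ≠ t j := by
    intro i j hij
    have hne : LinearMap.ker ((LinearMap.proj i : (Fin n → ℝ) →ₗ[ℝ] ℝ) - LinearMap.proj j) ≠ ⊤ := by
      intro h
      have : Pi.single i (1 : ℝ) ∈
          LinearMap.ker ((LinearMap.proj i : (Fin n → ℝ) →ₗ[ℝ] ℝ) - LinearMap.proj j) := by
        rw [h]; trivial
      simp [hij] at this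
    have h0 := Measure.addHaar_submodule (volume : Measure (Fin n → ℝ)) _ hne
    rw [ae_iff]
    refine measure_mono_null (fun t ht => ?_) h0
    simpa [sub_eq_zero] using ht
  have h' : ∀ᵐ t : Fin n → ℝ, ∀ i j : Fin n, i ≠ j → t i ≠ t j := by
    refine ae_all_iff.2 fun i => ae_all_iff.2 fun j => ?_
    by_cases hij : i = j
    · simp [hij]
    · filter_upwards [h i j hij] with t ht _ using ht
  filter_upwards [h'] with t ht i j hij
  by_contra hne
  exact ht i j hne hij

theorem sum_perm_indicator_strictMono {t : Fin n → ℝ} (ht : Function.Injective t) (z : ℂ) :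
    ∑ σ : Equiv.Perm (Fin n), {s : Fin n → ℝ | StrictMono s}.indicator (fun _ => z) (t ∘ σ) = z := by
  classical
  rw [Finset.sum_eq_single (Tuple.sort t)]
  · rw [Set.indicator_of_mem]
    exact (Tuple.monotone_sort t).strictMono_of_injective (ht.comp (Equiv.injective _))
  · intro σ _ hσ
    rw [Set.indicator_of_notMem]
    intro hmono
    apply hσ
    have h1 := Tuple.unique_monotone (f := t) (StrictMono.monotone hmono) (Tuple.monotone_sort t)
    ext i
    exact congrArg _ (ht (congrFun h1 i))
  · simp

theorem measurableSet_strictMono (n : ℕ) : MeasurableSet {s : Fin (n + 1) → ℝ | StrictMono s} := by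
  have : {s : Fin (n + 1) → ℝ | StrictMono s} = {s | ∀ l : Fin n, gap s l ∈ Set.Ioi 0} := by
    ext s
    simp only [Set.mem_ofPred_eq, Fin.strictMono_iff_lt_succ, gap, Set.mem_Ioi, sub_pos]
  rw [this]
  exact measurableSet_forall fun l => measurable_gap l measurableSet_Ioi

/-- A symmetric integrand is integrated by its increasing tuples. -/
theorem integral_eq_factorial_mul_integral_strictMono {G : (Fin (n + 1) → ℝ) → ℂ}
    (hG : Integrable G) (hsymm : ∀ (σ : Equiv.Perm (Fin (n + 1))) t, G (t ∘ σ) = G t) :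
    ∫ t, G t = ((n + 1).factorial : ℂ) * ∫ t, {s | StrictMono s}.indicator G t := by
  classical
  have hcongr : ∀ σ : Equiv.Perm (Fin (n + 1)), (fun t : Fin (n + 1) → ℝ => t ∘ σ)
      = MeasurableEquiv.piCongrLeft (fun _ : Fin (n + 1) => ℝ) σ.symm := by
    intro σ
    ext t i
    rw [MeasurableEquiv.coe_piCongrLeft]
    have h1 := Equiv.piCongrLeft_apply_apply (P := fun _ : Fin (n + 1) => ℝ) (e := σ.symm) t (σ i)
    simpa using h1.symm
  have hmp : ∀ σ : Equiv.Perm (Fin (n + 1)),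
      MeasurePreserving (fun t : Fin (n + 1) → ℝ => t ∘ σ) := fun σ => by
    rw [hcongr]
    exact volume_measurePreserving_piCongrLeft (fun _ : Fin (n + 1) => ℝ) σ.symm
  have hemb : ∀ σ : Equiv.Perm (Fin (n + 1)),
      MeasurableEmbedding (fun t : Fin (n + 1) → ℝ => t ∘ σ) := fun σ => by
    rw [hcongr]
    exact MeasurableEquiv.measurableEmbedding _
  have hind := hG.indicator (measurableSet_strictMono n)
  have h1 : ∫ t, G t = ∫ t, ∑ σ : Equiv.Perm (Fin (n + 1)),
      {s : Fin (n + 1) → ℝ | StrictMono s}.indicator G (t ∘ σ) := by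
    refine integral_congr_ae ?_
    filter_upwards [ae_injective_pi (n + 1)] with t ht
    rw [← sum_perm_indicator_strictMono ht (G t)]
    refine Finset.sum_congr rfl fun σ _ => ?_
    by_cases h : StrictMono (t ∘ σ)
    · rw [Set.indicator_of_mem (by exact h), Set.indicator_of_mem (by exact h), hsymm]
    · rw [Set.indicator_of_notMem (by exact h), Set.indicator_of_notMem (by exact h)]
  have hint : ∀ σ ∈ (Finset.univ : Finset (Equiv.Perm (Fin (n + 1)))),
      Integrable fun t : Fin (n + 1) → ℝ => {s | StrictMono s}.indicator G (t ∘ σ) := fun σ _ =>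
    ((hmp σ).integrable_comp_emb (hemb σ)).2 hind
  rw [h1, integral_finsetSum _ hint,
    Finset.sum_congr rfl fun σ _ => (hmp σ).integral_comp (hemb σ) _]
  simp [Finset.card_univ, Fintype.card_perm]

end Symmetrization

section BoxDecomposition

/-! ### The decomposition into gap boxes -/

variable {n : ℕ}

theorem disjoint_gapBox {m : ℝ} (hm : 0 < m) {k k' : Fin n → ℤ} (hk : k ≠ k') :
    Disjoint (gapBox m k) (gapBox m k') := by
  rw [Set.disjoint_left]
  intro t ht ht'
  apply hk
  have key : ∀ (a b : ℤ) (g : ℝ), g ∈ Set.Ico (m * 2 ^ a) (m * 2 ^ (a + 1)) →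
      g ∈ Set.Ico (m * 2 ^ b) (m * 2 ^ (b + 1)) → a ≤ b := by
    intro a b g ha hb
    have h1 := lt_of_mul_lt_mul_left (ha.1.trans_lt hb.2) hm.le
    have h2 := (zpow_lt_zpow_iff_right₀ (by norm_num : (1 : ℝ) < 2)).1 h1
    omega
  ext l
  exact le_antisymm (key _ _ _ (ht l) (ht' l)) (key _ _ _ (ht' l) (ht l))

theorem exists_mem_gapBox {m : ℝ} (hm : 0 < m) {t : Fin (n + 1) → ℝ} (ht : StrictMono t) :
    ∃ k : Fin n → ℤ, t ∈ gapBox m k := by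
  have : ∀ l, ∃ k : ℤ, gap t l ∈ Set.Ico (m * 2 ^ k) (m * 2 ^ (k + 1)) := by
    intro l
    obtain ⟨k, hk⟩ := exists_mem_Ico_zpow (x := gap t l / m) (y := (2 : ℝ))
      (div_pos (gap_pos ht l) hm) (by norm_num)
    refine ⟨k, ?_, ?_⟩
    · rw [mul_comm]; exact (le_div_iff₀ hm).1 hk.1
    · rw [mul_comm]; exact (div_lt_iff₀ hm).1 hk.2
  choose k hk using this
  exact ⟨k, hk⟩

/-- The multi-indices with entries in `[-N, N)`. -/
noncomputable def boxIndices (n N : ℕ) : Finset (Fin n → ℤ) := Fintype.piFinset fun _ => Finset.Ico (-(N : ℤ)) N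

theorem eventually_mem_boxIndices (k : Fin n → ℤ) : ∀ᶠ N in Filter.atTop, k ∈ boxIndices n N := by
  have : ∀ l, ∀ᶠ N : ℕ in Filter.atTop, k l ∈ Finset.Ico (-(N : ℤ)) N := by
    intro l
    filter_upwards [Filter.eventually_ge_atTop ((k l).natAbs + 1)] with N hN
    rw [Finset.mem_Ico]; omega
  filter_upwards [Filter.eventually_all.2 this] with N hN
  exact Fintype.mem_piFinset.2 hN

end BoxDecomposition

section Step

/-! ### The improvement of a restricted bound -/

open Polynomial

variable {n : ℕ}

theorem integrable_exp_mul {α : Type*} [MeasurableSpace α] {μ : Measure α} {F : α → ℂ}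
    (hF : Integrable F μ) {φ : α → ℝ} (hφ : Measurable φ) :
    Integrable (fun t => Complex.exp (Complex.I * (φ t : ℂ)) * F t) μ := by
  refine hF.bdd_mul (c := 1) ?_ (Filter.Eventually.of_forall fun t => (norm_exp_I_mul_ofReal _).le)
  exact (Complex.measurable_exp.comp (measurable_const.mul
    (Complex.measurable_ofReal.comp hφ))).aestronglyMeasurable

theorem measurable_inner_sumCurve (γ : Fin (n + 1) → ℝ[X]) (x : EuclideanSpace ℝ (Fin (n + 1))) :
    Measurable fun t => (inner ℝ x (WithLp.toLp 2 (sumCurve γ t)) : ℝ) := by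
  have := (PiLp.continuous_toLp 2 (fun _ : Fin (n + 1) => ℝ)).comp (continuous_sumCurve γ)
  exact (continuous_const.inner this).measurable

/-- The `d`-th power of the extension operator is the multilinear operator on a tensor power. -/
theorem curveFourier_pow_eq (γ : Fin (n + 1) → ℝ[X]) (f : ℝ → ℂ)
    (x : EuclideanSpace ℝ (Fin (n + 1))) :
    curveFourier γ f x ^ (n + 1) = multiFourier γ (fun t => ∏ j, f (t j)) x := by
  unfold curveFourier multiFourier
  have h := integral_fintype_prod_volume_eq_pow (ι := Fin (n + 1))
    (fun t : ℝ => Complex.exp (Complex.I * ((inner ℝ x (curvePoint γ t) : ℝ) : ℂ)) * f t)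
  rw [Fintype.card_fin] at h
  rw [← h]
  congr 1
  ext t
  rw [Finset.prod_mul_distrib, ← Complex.exp_sum, ← Finset.mul_sum, ← Complex.ofReal_sum, ← inner_sum]
  congr 5
  ext i
  simp [curvePoint, sumCurve]

/-- A restricted bound at `w` implies one at another exponent. The `d`-th power of `E f` is summed over
the gap boxes; the series of gap weights converges for short gaps by the upper bound `hθ1` for `θ`,
and for long gaps by `hθw`, a lower bound for `θ`. The resulting exponent is forced by scaling. -/
theorem exists_restrictedBound_step {ε w θ : ℝ} {A : ℝ≥0} (hn : 1 ≤ n) (hε : DetMargin n ε) (hw0 : 0 ≤ w)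
    (hw1 : w < 1) (hθ0 : 0 < θ) (hθ1 : θ < 4 / ((n : ℝ) + 3))
    (hθw : 4 * (1 - θ) * w < θ * (n + 1)) (hA : RestrictedBound n ε w A) :
    ∃ A' : ℝ≥0, RestrictedBound n ε (((n : ℝ) + 2) * θ / 4 + (1 - θ) * w / (n + 1)) A' := by
  have hn0 : (0 : ℝ) ≤ n := Nat.cast_nonneg n
  have hD := homDim_pos n
  have hθ1' : θ * (n + 3) < 4 := (lt_div_iff₀ (by linarith)).1 hθ1
  have hn1 : (1 : ℝ) ≤ n := by exact_mod_cast hn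
  have hθlt : θ < 1 := by nlinarith
  obtain ⟨K, hK, hpiece⟩ := exists_multiFourier_piece_bound hε hw0 hw1 hθ0 hθlt hA
  set a : ℝ := -(θ * (n + 1) / 4) + (1 - θ) * w with ha
  set b : ℝ := θ / 2 + (1 - θ) * (1 - w) with hb
  obtain ⟨B, hB, hBsum⟩ := exists_gapWeight_sum_le (a := a) (b := b) (by rw [ha]; linarith)
    (by rw [ha, hb]; linarith)
  set e : ℝ := θ * (((n : ℝ) + 1) / 2 - n * (n + 1) / 4)
            + (1 - θ) * (((n : ℝ) + 1) * (1 - w) + n * w) with he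
  set r : ℝ := θ / 2 + (1 - θ) * (w / homDim n) with hr
  set w' : ℝ := ((n : ℝ) + 2) * θ / 4 + (1 - θ) * w / (n + 1) with hw'
  have hr0 : 0 < r := by
    have : 0 ≤ (1 - θ) * (w / homDim n) := mul_nonneg (by linarith) (by positivity)
    linarith
  -- the exponents of the piece bound are those of the `(n + 1)`-st power of the bound at `w'`
  have hrw : (n + 1 : ℝ) * (w' / homDim n) = r := by
    rw [hr, hw', homDim]; field_simp; ring
  have hew : e = (n + 1) * (1 - w') := by
    rw [he, hw']; field_simp; ring
  have hr1 : r ≤ 1 := by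
    have h1 : w / homDim n ≤ 1 := by
      rw [div_le_one hD, homDim]; nlinarith
    nlinarith
  have hc1 : (1 : ℝ≥0∞) ≤ (ENNReal.ofReal r)⁻¹ := by
    rw [ENNReal.one_le_inv]; exact ENNReal.ofReal_le_one.2 hr1
  set C : ℝ := ((n + 1).factorial : ℝ) * (K * B ^ n) with hC
  have hC0 : 0 ≤ C := by positivity
  refine ⟨(C ^ (1 / ((n : ℝ) + 1))).toNNReal, ?_⟩
  intro γ J hJ hγ E hE hEJ hEv f hf hfE
  by_cases hE0 : volume E = 0
  · -- the function vanishes almost everywhere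
    have : ∀ x, curveFourier γ f x = 0 := by
      intro x
      have h1 := enorm_curveFourier_le γ f x
      have h2 : ∫⁻ t, ‖f t‖ₑ ≤ volume E := by
        rw [← lintegral_indicator_one hE]; exact lintegral_mono hfE
      rw [hE0] at h2
      simpa using h1.trans h2
    have h0 : curveFourier γ f = 0 := funext this
    rw [h0, eLpNorm_zero]
    exact zero_le
  set m : ℝ := (volume E).toReal with hm
  have hm0 : 0 < m := ENNReal.toReal_pos hE0 hEv
  have hEm : volume E = ENNReal.ofReal m := (ENNReal.ofReal_toReal hEv).symm
  set F : (Fin (n + 1) → ℝ) → ℂ := fun t => ∏ j, f (t j) with hF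
  have hFm : Measurable F := Finset.measurable_prod _ fun j _ => hf.comp (measurable_pi_apply j)
  have hfI : Integrable f := by
    refine ⟨hf.aestronglyMeasurable, ?_⟩
    rw [hasFiniteIntegral_iff_enorm]
    calc _ ≤ ∫⁻ t, E.indicator 1 t := lintegral_mono hfE
      _ < ⊤ := by rw [lintegral_indicator_one hE]; exact hEv.lt_top
  have hFI : Integrable F := by
    exact Integrable.fintype_prod (f := fun _ : Fin (n + 1) => f) fun _ => hfI
  have hFE : ∀ t, ‖F t‖ₑ ≤ {t : Fin (n + 1) → ℝ | ∀ j, t j ∈ E}.indicator 1 t := by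
    intro t
    by_cases ht : ∀ j, t j ∈ E
    · rw [Set.indicator_of_mem (by exact ht), hF]
      have h1 : ∀ j, ‖f (t j)‖ₑ ≤ 1 := fun j => by simpa [ht j] using hfE (t j)
      simp only [← ofReal_norm, norm_prod, Pi.one_apply] at h1 ⊢
      rw [ENNReal.ofReal_prod_of_nonneg fun _ _ => norm_nonneg _]
      exact Finset.prod_le_one (fun _ _ => zero_le) fun j _ => h1 j
    · rw [Set.indicator_of_notMem (by exact ht)]
      push Not at ht
      obtain ⟨j, hj⟩ := ht
      have h1 : f (t j) = 0 := by simpa [hj] using hfE (t j)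
      have h2 : F t = 0 := Finset.prod_eq_zero (Finset.mem_univ j) h1
      simp [h2]
  -- the truncations to finitely many gap boxes
  set U : ℕ → Set (Fin (n + 1) → ℝ) := fun N => ⋃ k ∈ boxIndices n N, gapBox m k with hU
  have hUm : ∀ N, MeasurableSet (U N) := fun N =>
    Finset.measurableSet_biUnion _ fun k _ => measurableSet_gapBox m k
  have hsum : ∀ N x, multiFourier γ ((U N).indicator F) x
      = ∑ k ∈ boxIndices n N, multiFourier γ ((gapBox m k).indicator F) x := by
    intro N x
    have h1 : ∀ k ∈ boxIndices n N, Integrable fun t => Complex.exp (Complex.I *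
        ((inner ℝ x (WithLp.toLp 2 (sumCurve γ t)) : ℝ) : ℂ)) * (gapBox m k).indicator F t :=
      fun k _ => integrable_exp_mul (hFI.indicator (measurableSet_gapBox m k))
        (measurable_inner_sumCurve γ x)
    unfold multiFourier
    rw [← integral_finsetSum _ h1]
    congr 1
    ext t
    rw [← Finset.mul_sum, hU]
    congr 1
    exact Finset.indicator_biUnion_apply (boxIndices n N) (fun k => gapBox m k)
      (fun k _ k' _ hkk' => disjoint_gapBox hm0 hkk') t
  have hbox : ∀ k, eLpNorm (multiFourier γ ((gapBox m k).indicator F)) (ENNReal.ofReal r)⁻¹ volume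
      ≤ ENNReal.ofReal (K * m ^ e * ∏ l, gapWeight a b (k l)) := by
    intro k
    refine hpiece γ J hJ hγ E hE hEJ m hm0 hEm k _ (hFm.indicator (measurableSet_gapBox m k)) ?_
    intro t
    by_cases ht : t ∈ gapBox m k
    · rw [Set.indicator_of_mem ht]
      refine (hFE t).trans ?_
      by_cases h : ∀ j, t j ∈ E
      · rw [Set.indicator_of_mem (by exact h), Set.indicator_of_mem (by exact ⟨h, ht⟩)]
      · rw [Set.indicator_of_notMem (by exact h)]; exact zero_le
    · rw [Set.indicator_of_notMem ht]; simp
  have hUN : ∀ N, eLpNorm (multiFourier γ ((U N).indicator F)) (ENNReal.ofReal r)⁻¹ volume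
      ≤ ENNReal.ofReal (K * m ^ e * B ^ n) := by
    intro N
    have h1 : multiFourier γ ((U N).indicator F)
        = ∑ k ∈ boxIndices n N, multiFourier γ ((gapBox m k).indicator F) := by
      ext x; rw [hsum, Finset.sum_apply]
    rw [h1]
    refine (eLpNorm_sum_le (fun k _ => (measurable_multiFourier γ
      (hFm.indicator (measurableSet_gapBox m k))).aestronglyMeasurable) hc1).trans ?_
    refine (Finset.sum_le_sum fun k _ => hbox k).trans ?_
    rw [← ENNReal.ofReal_sum_of_nonneg fun k _ => mul_nonneg (by positivity)
      (Finset.prod_nonneg fun l _ => gapWeight_nonneg _ _ _), ← Finset.mul_sum]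
    refine ENNReal.ofReal_le_ofReal ?_
    refine mul_le_mul_of_nonneg_left ?_ (by positivity)
    have h2 := Finset.prod_univ_sum (fun _ : Fin n => Finset.Ico (-(N : ℤ)) N)
      (fun _ k => gapWeight a b k)
    rw [boxIndices, ← h2, Finset.prod_const, Finset.card_univ, Fintype.card_fin]
    exact pow_le_pow_left₀ (Finset.sum_nonneg fun k _ => gapWeight_nonneg _ _ _) (hBsum N) n
  have hlim : eLpNorm (multiFourier γ ({s | StrictMono s}.indicator F)) (ENNReal.ofReal r)⁻¹ volume
      ≤ ENNReal.ofReal (K * m ^ e * B ^ n) := by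
    refine Lp.eLpNorm_le_of_ae_tendsto (u := Filter.atTop)
      (f := fun N : ℕ => multiFourier γ ((U N).indicator F))
      (Filter.Eventually.of_forall hUN)
      (fun N => (measurable_multiFourier γ (hFm.indicator (hUm N))).aestronglyMeasurable)
      (Filter.Eventually.of_forall fun x => ?_)
    unfold multiFourier
    refine tendsto_integral_of_dominated_convergence (fun t => ‖F t‖) (fun N => ?_) hFI.norm
      (fun N => Filter.Eventually.of_forall fun t => ?_) (Filter.Eventually.of_forall fun t => ?_)
    · exact (integrable_exp_mul (hFI.indicator (hUm N)) (measurable_inner_sumCurve γ x)).1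
    · rw [norm_mul, norm_exp_I_mul_ofReal, one_mul]
      exact norm_indicator_le_norm_self _ _
    · refine Filter.Tendsto.const_mul _ ?_
      by_cases ht : StrictMono t
      · rw [Set.indicator_of_mem (by exact ht)]
        obtain ⟨k, hk⟩ := exists_mem_gapBox hm0 ht
        refine tendsto_const_nhds.congr' ?_
        filter_upwards [eventually_mem_boxIndices k] with N hN
        exact (Set.indicator_of_mem (Set.mem_iUnion₂.2 ⟨k, hN, hk⟩) F).symm
      · rw [Set.indicator_of_notMem (by exact ht)]
        refine tendsto_const_nhds.congr fun N => ?_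
        rw [Set.indicator_of_notMem]
        intro h
        obtain ⟨k, -, hk⟩ := Set.mem_iUnion₂.1 h
        exact ht (strictMono_of_mem_gapBox hm0 hk)
  -- all orderings contribute equally
  have hpow : ∀ x, curveFourier γ f x ^ (n + 1)
      = ((n + 1).factorial : ℂ) * multiFourier γ ({s | StrictMono s}.indicator F) x := by
    intro x
    rw [curveFourier_pow_eq]
    unfold multiFourier
    rw [integral_eq_factorial_mul_integral_strictMono
      (integrable_exp_mul hFI (measurable_inner_sumCurve γ x))]
    · congr 2
      ext t
      rw [Set.indicator_mul_right]
    · intro σ t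
      have h1 : sumCurve γ (t ∘ σ) = sumCurve γ t := by
        ext i
        exact Equiv.sum_comp σ (fun j => (γ i).eval (t j))
      have h2 : F (t ∘ σ) = F t := Equiv.prod_comp σ (fun j => f (t j))
      rw [h1]
      exact congrArg _ h2
  have hfinal : eLpNorm (curveFourier γ f) (critExp n w') volume ^ ((n : ℝ) + 1)
      ≤ ENNReal.ofReal (C * m ^ e) := by
    have h1 := eLpNorm_norm_rpow (p := (ENNReal.ofReal r)⁻¹) (μ := volume) (curveFourier γ f)
      (q := (n : ℝ) + 1) (by positivity)
    have h2 : (ENNReal.ofReal r)⁻¹ * ENNReal.ofReal ((n : ℝ) + 1) = critExp n w' := by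
      have hw'0 : 0 < w' / homDim n := by
        by_contra hcon
        push Not at hcon
        nlinarith
      rw [critExp, ← ENNReal.ofReal_inv_of_pos hr0, ← ENNReal.ofReal_inv_of_pos hw'0,
        ← ENNReal.ofReal_mul (by positivity), ← hrw]
      congr 1
      field_simp
    rw [h2] at h1
    rw [← h1]
    have h3 : eLpNorm (fun x => ‖curveFourier γ f x‖ ^ ((n : ℝ) + 1)) (ENNReal.ofReal r)⁻¹ volume
        = eLpNorm (((n + 1).factorial : ℂ) • multiFourier γ ({s | StrictMono s}.indicator F))
          (ENNReal.ofReal r)⁻¹ volume := by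
      refine eLpNorm_congr_norm_ae (Filter.Eventually.of_forall fun x => ?_)
      rw [Pi.smul_apply, smul_eq_mul, ← hpow, norm_pow, Real.norm_of_nonneg (by positivity)]
      exact_mod_cast Real.rpow_natCast _ (n + 1)
    rw [h3, eLpNorm_const_smul]
    calc _ ≤ ENNReal.ofReal ((n + 1).factorial : ℝ) * ENNReal.ofReal (K * m ^ e * B ^ n) := by
          gcongr
          rw [← ofReal_norm]
          simp
      _ = _ := by
          rw [← ENNReal.ofReal_mul (by positivity), hC]
          congr 1; ring
  calc eLpNorm (curveFourier γ f) (critExp n w') volume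
      = (eLpNorm (curveFourier γ f) (critExp n w') volume ^ ((n : ℝ) + 1)) ^ (1 / ((n : ℝ) + 1)) := by
        rw [← ENNReal.rpow_mul, mul_one_div_cancel (by positivity), ENNReal.rpow_one]
    _ ≤ (ENNReal.ofReal (C * m ^ e)) ^ (1 / ((n : ℝ) + 1)) := by gcongr
    _ = _ := by
        rw [ENNReal.ofReal_rpow_of_nonneg (by positivity) (by positivity),
          Real.mul_rpow hC0 (by positivity), ENNReal.ofReal_mul (by positivity), hEm,
          ENNReal.ofReal_rpow_of_pos hm0, ← Real.rpow_mul hm0.le]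
        congr 3
        rw [hew]; field_simp

end Step

section Iteration

/-! ### The full restricted range -/

variable {n : ℕ}

/-- The trivial `L¹ → L^∞` estimate, from which the iteration starts. -/
theorem restrictedBound_zero (n : ℕ) (ε : ℝ) : RestrictedBound n ε 0 1 := by
  intro γ J _ _ E hE _ _ f _ hfE
  rw [critExp_zero, eLpNorm_exponent_top]
  refine eLpNormEssSup_le_of_ae_enorm_bound (Filter.Eventually.of_forall fun x => ?_)
  refine (enorm_curveFourier_le γ f x).trans ((lintegral_mono hfE).trans ?_)
  rw [lintegral_indicator_one hE]
  simp

/-- The improvement in terms of the new exponent `w`: it is attained by a suitable `θ` as soon as `w`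
is below the image of `w₀` under an affine contraction with fixed point `D / (D + 1)`, where
`D = homDim n`, and not too small; `hlow` is the convergence for long gaps. -/
theorem exists_restrictedBound_of_lt {ε w₀ w : ℝ} {A : ℝ≥0} (hn : 1 ≤ n) (hε : DetMargin n ε)
    (hw₀ : 0 ≤ w₀) (hw₀1 : w₀ < 1) (hA : RestrictedBound n ε w₀ A)
    (hw : w < ((n : ℝ) + 2) / (n + 3) + (n - 1) * w₀ / ((n + 1) * (n + 3)))
    (hlow : w₀ * (n + 3) / (n + 1 + 4 * w₀) < w) :
    ∃ A' : ℝ≥0, RestrictedBound n ε w A' := by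
  have hn1 : (1 : ℝ) ≤ n := by exact_mod_cast hn
  set d : ℝ := (n : ℝ) + 1 with hd
  have hd2 : 2 ≤ d := by linarith
  have e2 : (n : ℝ) + 2 = d + 1 := by rw [hd]; ring
  have e3 : (n : ℝ) + 3 = d + 2 := by rw [hd]; ring
  have e1 : (n : ℝ) - 1 = d - 2 := by rw [hd]; ring
  rw [e2, e3, e1] at hw
  rw [e3] at hlow
  have hslope : 0 < (d + 1) / 4 - w₀ / d := by
    have : w₀ / d ≤ 1 / 2 := by rw [div_le_iff₀ (by linarith)]; linarith
    linarith
  set s : ℝ := (d + 1) / 4 - w₀ / d with hs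
  set θ : ℝ := (w - w₀ / d) / s with hθ
  have hθs : θ * s = w - w₀ / d := div_mul_cancel₀ _ hslope.ne'
  have hlowθ : 4 * w₀ / (d + 4 * w₀) < θ := by
    rw [hθ, lt_div_iff₀ hslope]
    have : 4 * w₀ / (d + 4 * w₀) * s = w₀ * (d + 2) / (d + 4 * w₀) - w₀ / d := by
      rw [hs]; field_simp; ring
    linarith
  have hθ0 : 0 < θ := lt_of_le_of_lt (by positivity) hlowθ
  have hθ1 : θ < 4 / (d + 2) := by
    rw [hθ, div_lt_iff₀ hslope]
    have : 4 / (d + 2) * s = (d + 1) / (d + 2) + (d - 2) * w₀ / (d * (d + 2)) - w₀ / d := by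
      rw [hs]; field_simp; ring
    linarith
  have hlow2 : 4 * (1 - θ) * w₀ < θ * d := by
    rw [div_lt_iff₀ (by linarith)] at hlowθ
    nlinarith
  have := exists_restrictedBound_step hn hε hw₀ hw₀1 hθ0 (by rw [e3]; exact hθ1) hlow2 hA
  have hw' : ((n : ℝ) + 2) * θ / 4 + (1 - θ) * w₀ / (n + 1) = w := by
    rw [e2, ← hd]
    have h := hθs
    rw [hs] at h
    have : (d + 1) * θ / 4 + (1 - θ) * w₀ / d = θ * ((d + 1) / 4 - w₀ / d) + w₀ / d := by ring
    rw [this, h]; ring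
  rwa [hw'] at this

/-- The restricted bound below the fixed point `D / (D + 1)` of the contraction, which corresponds to
`q = D + 1`: the iterates of `0` converge to it. -/
theorem exists_restrictedBound {ε w : ℝ} (hn : 1 ≤ n) (hε : DetMargin n ε)
    (hw0 : 0 ≤ w) (hw : w < homDim n / (homDim n + 1)) :
    ∃ A : ℝ≥0, RestrictedBound n ε w A := by
  have hn1 : (1 : ℝ) ≤ n := by exact_mod_cast hn
  have hstar : homDim n / (homDim n + 1)
      = ((n : ℝ) + 1) * (n + 2) / ((n + 1) ^ 2 + (n + 1) + 2) := by
    rw [homDim]; field_simp; ring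
  rw [hstar] at hw
  set d : ℝ := (n : ℝ) + 1 with hd
  have hd2 : 2 ≤ d := by linarith
  have e2 : (n : ℝ) + 2 = d + 1 := by rw [hd]; ring
  have e3 : (n : ℝ) + 3 = d + 2 := by rw [hd]; ring
  have e1 : (n : ℝ) - 1 = d - 2 := by rw [hd]; ring
  rw [e2] at hw
  set W : ℝ := d * (d + 1) / (d ^ 2 + d + 2) with hW
  have hW0 : 0 < W := by positivity
  have hW1 : W < 1 := by rw [hW, div_lt_one (by positivity)]; linarith
  set c : ℝ := (d - 2) / (d * (d + 2)) with hc
  have hc0 : 0 ≤ c := div_nonneg (by linarith) (by positivity)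
  have hc1 : c < 1 := by rw [hc, div_lt_one (by positivity)]; nlinarith
  have hfix : (d + 1) / (d + 2) = (1 - c) * W := by
    rw [hc, hW]; field_simp; ring
  have hφ : ∀ w₀ : ℝ, (d + 1) / (d + 2) + (d - 2) * w₀ / (d * (d + 2)) = (1 - c) * W + c * w₀ := by
    intro w₀; rw [hfix, hc]; ring
  -- the `k`-th iterate of `0` under the contraction `x ↦ (1 - c) W + c x` is `W - c ^ k W`
  have key : ∀ k : ℕ, ∀ w : ℝ, 0 ≤ w → w < W - c ^ k * W → ∃ A : ℝ≥0, RestrictedBound n ε w A := by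
    intro k
    induction k with
    | zero => intro w h0 h1; simp at h1; linarith
    | succ k ih =>
      intro w h0 h1
      rcases h0.eq_or_lt with rfl | h0
      · exact ⟨1, restrictedBound_zero n ε⟩
      rcases lt_or_ge w ((1 - c) * W) with h2 | h2
      · refine exists_restrictedBound_of_lt hn hε le_rfl one_pos (restrictedBound_zero n ε) ?_ ?_
        · rw [e2, e3, e1, ← hd, hφ]; linarith
        · rw [zero_mul, zero_div]; exact h0
      · set b : ℝ := W - c ^ k * W with hb
        have hck : 0 ≤ c ^ k := pow_nonneg hc0 k
        have hck1 : c ^ k ≤ 1 := pow_le_one₀ hc0 hc1.le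
        have hbW : b ≤ W := by rw [hb]; nlinarith
        have hb0 : 0 ≤ b := by rw [hb]; nlinarith
        have h3 : w < (1 - c) * W + c * b := by
          rw [hb]; rw [pow_succ] at h1; linarith
        set δ : ℝ := (1 - c) * W + c * b - w with hδ
        have hδ0 : 0 < δ := by rw [hδ]; linarith
        set w₀ : ℝ := max 0 (b - δ / 2) with hw₀
        have hw₀0 : 0 ≤ w₀ := le_max_left _ _
        have hw₀b : w₀ ≤ b := max_le hb0 (by linarith)
        obtain ⟨A, hA⟩ : ∃ A : ℝ≥0, RestrictedBound n ε w₀ A := by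
          rcases le_total (b - δ / 2) 0 with h | h
          · rw [hw₀, max_eq_left h]; exact ⟨1, restrictedBound_zero n ε⟩
          · rw [hw₀, max_eq_right h]; exact ih _ h (by linarith)
        refine exists_restrictedBound_of_lt hn hε hw₀0 (by linarith) hA ?_ ?_
        · rw [e2, e3, e1, ← hd, hφ]
          have h4 : b - δ / 2 ≤ w₀ := le_max_right _ _
          nlinarith
        · refine lt_of_lt_of_le ?_ h2
          rw [← hfix, e3, div_lt_div_iff₀ (by linarith) (by linarith)]
          have : w₀ < 1 := by linarith
          nlinarith [mul_pos (show (0 : ℝ) < d by linarith) (show (0 : ℝ) < d by linarith)]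
  have hlim := (tendsto_pow_atTop_nhds_zero_of_lt_one hc0 hc1).mul_const W
  rw [zero_mul] at hlim
  obtain ⟨k, hk⟩ := (hlim.eventually (gt_mem_nhds (show (0 : ℝ) < W - w by linarith))).exists
  exact key k w hw0 (by linarith)

end Iteration

section RestrictedToStrong

/-! ### From restricted to strong type -/

/-- The increment of a power is at most the slope at the larger point times the increment. -/
theorem rpow_sub_rpow_le {a b m : ℝ} (ha : 0 ≤ a) (hab : a ≤ b) (hm : 1 ≤ m) :
    b ^ m - a ^ m ≤ m * ((b - a) * b ^ (m - 1)) := by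
  rcases (ha.trans hab).eq_or_lt with rfl | hb
  · have : a = 0 := le_antisymm hab ha
    simp [this]
  have h := one_add_mul_self_le_rpow_one_add (s := a / b - 1) (by
    have : 0 ≤ a / b := by positivity
    linarith) hm
  rw [add_sub_cancel, Real.div_rpow ha hb.le, le_div_iff₀ (by positivity)] at h
  have h2 : b ^ m = b * b ^ (m - 1) := by
    rw [← Real.rpow_one_add' hb.le (by linarith)]; congr 1; ring
  have h3 : (1 + m * (a / b - 1)) * b ^ m = b ^ m - m * ((b - a) * b ^ (m - 1)) := by
    rw [h2]; field_simp; ring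
  linarith

/-- A summation by parts: the power of a sum is controlled by its increments, the terms being
added in the order of increasing `a`. -/
theorem rpow_sum_le_mul_sum {ι : Type*} (S : Finset ι) (a x : ι → ℝ) (hx : ∀ i, 0 ≤ x i)
    {m : ℝ} (hm : 1 ≤ m) :
    (∑ i ∈ S, x i) ^ m ≤ m * ∑ i ∈ S, x i * (∑ j ∈ S with a j ≤ a i, x j) ^ (m - 1) := by
  classical
  induction S using Finset.induction_on_max_value a with
  | empty => simp [Real.zero_rpow (by linarith : m ≠ 0)]
  | @insert i S hi hmax ih =>
    rw [Finset.sum_insert hi, Finset.sum_insert hi]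
    have h1 : (insert i S).filter (fun j => a j ≤ a i) = insert i S :=
      Finset.filter_true_of_mem fun j hj => by
        rcases Finset.mem_insert.1 hj with rfl | hj
        · exact le_rfl
        · exact hmax j hj
    rw [h1, Finset.sum_insert hi]
    have h2 : ∑ k ∈ S, x k * (∑ j ∈ S with a j ≤ a k, x j) ^ (m - 1)
        ≤ ∑ k ∈ S, x k * (∑ j ∈ insert i S with a j ≤ a k, x j) ^ (m - 1) := by
      refine Finset.sum_le_sum fun k _ => mul_le_mul_of_nonneg_left ?_ (hx k)
      refine Real.rpow_le_rpow (Finset.sum_nonneg fun j _ => hx j) ?_ (by linarith)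
      exact Finset.sum_le_sum_of_subset_of_nonneg
        (Finset.filter_subset_filter _ (Finset.subset_insert i S)) fun j _ _ => hx j
    have h3 := rpow_sub_rpow_le (a := ∑ j ∈ S, x j) (b := x i + ∑ j ∈ S, x j)
      (Finset.sum_nonneg fun j _ => hx j) (by linarith [hx i]) hm
    rw [add_sub_cancel_right] at h3
    nlinarith

/-- Hölder's inequality for `|g| ^ κ |h|`, in terms of reciprocals of the exponents. -/
theorem eLpNorm_rpow_mul_le {X : Type*} [MeasurableSpace X] {μ : Measure X} {g h : X → ℂ}
    (hg : AEStronglyMeasurable g μ) (hh : AEStronglyMeasurable h μ) {κ u v : ℝ}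
    (hκ : 0 < κ) (hu : 0 < u) (hv : 0 < v) :
    eLpNorm (fun x => ‖g x‖ ^ κ * ‖h x‖) (ENNReal.ofReal (κ * u + v))⁻¹ μ
      ≤ eLpNorm g (ENNReal.ofReal u)⁻¹ μ ^ κ * eLpNorm h (ENNReal.ofReal v)⁻¹ μ := by
  have : ENNReal.HolderTriple (ENNReal.ofReal (κ * u))⁻¹ (ENNReal.ofReal v)⁻¹
      (ENNReal.ofReal (κ * u + v))⁻¹ :=
    ⟨by rw [inv_inv, inv_inv, inv_inv, ENNReal.ofReal_add (by positivity) hv.le]⟩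
  have h1 := eLpNorm_smul_le_mul_eLpNorm (μ := μ) (p := (ENNReal.ofReal (κ * u))⁻¹)
    (q := (ENNReal.ofReal v)⁻¹) (r := (ENNReal.ofReal (κ * u + v))⁻¹)
    (φ := fun x => ‖g x‖ ^ κ) (f := fun x => ‖h x‖) hh.norm
    (hg.norm.aemeasurable.pow_const κ).aestronglyMeasurable
  refine h1.trans (le_of_eq ?_)
  rw [eLpNorm_norm, eLpNorm_norm_rpow _ hκ]
  congr 3
  rw [← ENNReal.ofReal_inv_of_pos (by positivity), ← ENNReal.ofReal_inv_of_pos hu,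
    ← ENNReal.ofReal_mul (by positivity)]
  congr 1
  field_simp

theorem summable_rpow_neg_abs {c : ℝ} (hc : 0 < c) :
    Summable fun j : ℤ => (2 : ℝ) ^ (-(c * |(j : ℝ)|)) := by
  have h : Summable fun j : ℕ => (2 : ℝ) ^ (-(c * (j : ℝ))) := by
    have h1 : ∀ j : ℕ, (2 : ℝ) ^ (-(c * (j : ℝ))) = ((2 : ℝ) ^ (-c)) ^ j := fun j => by
      rw [← Real.rpow_natCast, ← Real.rpow_mul (by norm_num)]; congr 1; ring
    simp_rw [h1]
    exact summable_geometric_of_lt_one (by positivity)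
      (Real.rpow_lt_one_of_one_lt_of_neg (by norm_num) (by linarith))
  refine Summable.of_nat_of_neg ?_ ?_
  · simpa using h
  · simpa using h

/-- The gain from exponents off the critical one: one of the perturbations `s = c`, `s = -c` of the
exponents, chosen by the order of `k` and `l`, gains a geometric factor in `|l - k|`. -/
theorem mul_rpow_div_rpow_le {a b c : ℝ} (ha : 0 < a) (hb : 0 < b) (hba : b ≤ a) (hc : 0 < c)
    (hc1 : c ≤ 1) (k l : ℤ) :
    ∃ s : ℝ, (s = c ∨ s = -c) ∧
      (a * 2 ^ (-(k : ℝ))) ^ (-s) * (b * (b * 2 ^ (-(l : ℝ))) ^ s)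
        ≤ a * 2 ^ (-(c * |((l - k : ℤ) : ℝ)|)) := by
  have h2 : ∀ y : ℝ, (0 : ℝ) < 2 ^ y := fun y => by positivity
  have key : ∀ s : ℝ, (a * 2 ^ (-(k : ℝ))) ^ (-s) * (b * (b * 2 ^ (-(l : ℝ))) ^ s)
      = a ^ (-s) * b ^ (1 + s) * 2 ^ (-(s * ((l - k : ℤ) : ℝ))) := by
    intro s
    rw [Real.mul_rpow ha.le (h2 _).le, Real.mul_rpow hb.le (h2 _).le, ← Real.rpow_mul (by norm_num),
      ← Real.rpow_mul (by norm_num), Real.rpow_add hb, Real.rpow_one]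
    have : (2 : ℝ) ^ (-(s * ((l - k : ℤ) : ℝ))) = 2 ^ (-(k : ℝ) * -s) * 2 ^ (-(l : ℝ) * s) := by
      rw [← Real.rpow_add (by norm_num)]; congr 1; push_cast; ring
    rw [this]; ring
  have key2 : ∀ s : ℝ, 0 ≤ 1 + s → a ^ (-s) * b ^ (1 + s) ≤ a := by
    intro s hs
    calc a ^ (-s) * b ^ (1 + s) ≤ a ^ (-s) * a ^ (1 + s) := by gcongr
      _ = a := by rw [← Real.rpow_add ha]; simp
  rcases le_total k l with h | h
  · refine ⟨c, Or.inl rfl, ?_⟩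
    rw [key, abs_of_nonneg (by exact_mod_cast sub_nonneg.2 h)]
    exact mul_le_mul_of_nonneg_right (key2 c (by linarith)) (h2 _).le
  · refine ⟨-c, Or.inr rfl, ?_⟩
    rw [key, abs_of_nonpos (by exact_mod_cast sub_nonpos.2 h)]
    refine (mul_le_mul_of_nonneg_right (key2 (-c) (by linarith)) (h2 _).le).trans (le_of_eq ?_)
    congr 2; ring

/-- A replacement for real interpolation in the form needed here. The numbers `a k` are the
contributions of the levels `2 ^ k` to the `L^p` norm, where `1 / p = 1 - w`; a level is bounded in
a range of Lebesgue exponents around the critical one, with a gain or loss that is a power of the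
measure `(a k * 2 ^ (-k)) ^ p` of the level set.

With `κ = 1 / (p - 1)`, summation by parts bounds `(Σ |g k|) ^ p` by the sum over `k` of
`G k ^ (p - 1)`, where `G k` is the sum of `|g k| ^ κ |g l|` over the `l` with `a l ≤ a k`. In
such a product the exponents of the two factors are moved in opposite directions, which makes the
sum over `l` a geometric series; what remains is the sum of the `a k ^ p`. -/
theorem eLpNorm_sum_rpow_le_of_levels {X : Type*} [MeasurableSpace X] {μ : Measure X}
    {D w c A B : ℝ} (hD : 1 ≤ D) (hw0 : 0 < w) (hw1 : w < 1) (hwD : w ≤ D * (1 - w))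
    (hc : 0 < c) (hc1 : c ≤ 1) (hcw : c * (1 - w) < w) (hcw' : c < 1) (hA : 0 ≤ A)
    (hB : ∑' j : ℤ, (2 : ℝ) ^ (-(c * |(j : ℝ)|)) ≤ B)
    (S : Finset ℤ) (g : ℤ → X → ℂ) (hg : ∀ k, AEStronglyMeasurable (g k) μ)
    (a : ℤ → ℝ) (ha : ∀ k ∈ S, 0 < a k)
    (hbd : ∀ k ∈ S, ∀ s : ℝ, (|s| = c ∨ |s| = c * (w / (1 - w))) →
      eLpNorm (g k) (ENNReal.ofReal ((w - s * (1 - w)) / D))⁻¹ μ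
        ≤ ENNReal.ofReal (A * (a k * (a k * 2 ^ (-(k : ℝ))) ^ s))) :
    eLpNorm (∑ k ∈ S, g k) (ENNReal.ofReal (w / D))⁻¹ μ ^ (1 - w)⁻¹
      ≤ ENNReal.ofReal ((1 - w)⁻¹ * (A ^ ((1 - w)⁻¹) * B ^ (w / (1 - w))) *
          ∑ k ∈ S, a k ^ (1 - w)⁻¹) := by
  have hw1' : 0 < 1 - w := by linarith
  set p : ℝ := (1 - w)⁻¹ with hp
  set κ : ℝ := (1 - w) / w with hκ
  have hκ0 : 0 < κ := by positivity
  have hp0 : 0 < p := by positivity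
  have hp1 : 1 ≤ p := by rw [hp]; exact (one_le_inv₀ hw1').2 (by linarith)
  have hpm : p - 1 = w / (1 - w) := by rw [hp]; field_simp; ring
  have hpm0 : 0 < p - 1 := by rw [hpm]; positivity
  have hκp : κ * (p - 1) = 1 := by rw [hpm, hκ]; field_simp
  have hB0 : 0 ≤ B := le_trans (tsum_nonneg fun j => by positivity) hB
  -- two levels, with exponents moved in opposite directions
  have hpair : ∀ k ∈ S, ∀ l ∈ S, a l ≤ a k →
      eLpNorm (fun x => ‖g k x‖ ^ κ * ‖g l x‖) (ENNReal.ofReal (1 / D))⁻¹ μ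
        ≤ ENNReal.ofReal (A ^ (κ + 1) * a k ^ (κ + 1) * 2 ^ (-(c * |((l - k : ℤ) : ℝ)|))) := by
    intro k hk l hl hlk
    obtain ⟨s, hs, hsle⟩ := mul_rpow_div_rpow_le (ha k hk) (ha l hl) hlk hc hc1 k l
    have hsabs : |s| = c := by
      rcases hs with rfl | rfl
      · exact abs_of_pos hc
      · rw [abs_neg, abs_of_pos hc]
    have hsle1 := (abs_le.1 hsabs.le)
    have hv : 0 < (w - s * (1 - w)) / D := by
      refine div_pos ?_ (by linarith)
      nlinarith
    have hu : 0 < (w - (-(s / κ)) * (1 - w)) / D := by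
      refine div_pos ?_ (by linarith)
      have : w - (-(s / κ)) * (1 - w) = w * (1 + s) := by rw [hκ]; field_simp; ring
      rw [this]
      exact mul_pos hw0 (by linarith)
    have h1 := eLpNorm_rpow_mul_le (hg k) (hg l) hκ0 hu hv
    have hexp : κ * ((w - (-(s / κ)) * (1 - w)) / D) + (w - s * (1 - w)) / D = 1 / D := by
      rw [hκ]; field_simp; ring
    rw [hexp] at h1
    refine h1.trans ?_
    have h2 := hbd k hk (-(s / κ)) (Or.inr (by
      rw [abs_neg, abs_div, hsabs, abs_of_pos hκ0, hκ]; field_simp))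
    have h3 := hbd l hl s (Or.inl hsabs)
    have hak := ha k hk
    have hal := ha l hl
    calc _ ≤ ENNReal.ofReal (A * (a k * (a k * 2 ^ (-(k : ℝ))) ^ (-(s / κ)))) ^ κ
          * ENNReal.ofReal (A * (a l * (a l * 2 ^ (-(l : ℝ))) ^ s)) := by gcongr
      _ = ENNReal.ofReal (A ^ (κ + 1) * a k ^ κ *
            ((a k * 2 ^ (-(k : ℝ))) ^ (-s) * (a l * (a l * 2 ^ (-(l : ℝ))) ^ s))) := by
          rw [ENNReal.ofReal_rpow_of_nonneg (by positivity) hκ0.le,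
            ← ENNReal.ofReal_mul (by positivity)]
          congr 1
          rw [Real.mul_rpow hA (by positivity), Real.mul_rpow hak.le (by positivity),
            ← Real.rpow_mul (by positivity), Real.rpow_add_one' hA (by positivity)]
          have : -(s / κ) * κ = -s := by field_simp
          rw [this]; ring
      _ ≤ _ := by
          refine ENNReal.ofReal_le_ofReal ?_
          rw [Real.rpow_add_one hak.ne' κ]
          calc _ ≤ A ^ (κ + 1) * a k ^ κ * (a k * 2 ^ (-(c * |((l - k : ℤ) : ℝ)|))) := by gcongr
            _ = _ := by ring
  -- one level against all smaller contributions: a geometric series in `|l - k|`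
  have hone : (1 : ℝ≥0∞) ≤ (ENNReal.ofReal (1 / D))⁻¹ := by
    rw [ENNReal.one_le_inv]
    exact ENNReal.ofReal_le_one.2 ((div_le_one (by linarith)).2 hD)
  have hGm : ∀ k l, AEStronglyMeasurable (fun x => ‖g k x‖ ^ κ * ‖g l x‖) μ := fun k l =>
    (((hg k).norm.aemeasurable.pow_const κ).mul (hg l).norm.aemeasurable).aestronglyMeasurable
  set G : ℤ → X → ℝ := fun k => ∑ l ∈ S with a l ≤ a k, fun x => ‖g k x‖ ^ κ * ‖g l x‖ with hG
  have hGm' : ∀ k, AEStronglyMeasurable (G k) μ := fun k =>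
    Finset.aestronglyMeasurable_sum _ fun l _ => hGm k l
  have hGx : ∀ k x, G k x = ‖g k x‖ ^ κ * ∑ l ∈ S with a l ≤ a k, ‖g l x‖ := by
    intro k x
    simp only [hG, Finset.sum_apply, Finset.mul_sum]
  have hGbd : ∀ k ∈ S, eLpNorm (G k) (ENNReal.ofReal (1 / D))⁻¹ μ
      ≤ ENNReal.ofReal (A ^ (κ + 1) * a k ^ (κ + 1) * B) := by
    intro k hk
    have hak := ha k hk
    refine (eLpNorm_sum_le (fun l _ => hGm k l) hone).trans ?_
    refine (Finset.sum_le_sum fun l hl => hpair k hk l (Finset.mem_filter.1 hl).1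
      (Finset.mem_filter.1 hl).2).trans ?_
    rw [← ENNReal.ofReal_sum_of_nonneg fun l _ => by positivity, ← Finset.mul_sum]
    refine ENNReal.ofReal_le_ofReal (mul_le_mul_of_nonneg_left ?_ (by positivity))
    have hsum := summable_rpow_neg_abs hc
    have h4 := hsum.sum_le_tsum ((S.filter fun l => a l ≤ a k).map (Equiv.subRight k).toEmbedding)
      (fun j _ => by positivity)
    rw [Finset.sum_map] at h4
    exact h4.trans hB
  -- assemble
  have hq1 : (1 : ℝ≥0∞) ≤ (ENNReal.ofReal (w / (D * (1 - w))))⁻¹ := by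
    rw [ENNReal.one_le_inv]
    exact ENNReal.ofReal_le_one.2 ((div_le_one (by positivity)).2 hwD)
  have hmulinv : ∀ {u v : ℝ}, 0 < u → 0 < v →
      (ENNReal.ofReal u)⁻¹ * ENNReal.ofReal v = (ENNReal.ofReal (u / v))⁻¹ := by
    intro u v hu hv
    rw [← ENNReal.ofReal_inv_of_pos hu, ← ENNReal.ofReal_inv_of_pos (by positivity),
      ← ENNReal.ofReal_mul (by positivity)]
    congr 1; field_simp
  have hstep1 : eLpNorm (∑ k ∈ S, g k) (ENNReal.ofReal (w / D))⁻¹ μ ^ p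
      = eLpNorm (fun x => ‖(∑ k ∈ S, g k) x‖ ^ p) (ENNReal.ofReal (w / (D * (1 - w))))⁻¹ μ := by
    rw [eLpNorm_norm_rpow _ hp0, hmulinv (by positivity) hp0]
    congr 3
    rw [hp]; field_simp
  have hstep2 : ∀ k, eLpNorm (fun x => p * ‖G k x‖ ^ (p - 1))
      (ENNReal.ofReal (w / (D * (1 - w))))⁻¹ μ
      = ENNReal.ofReal p * eLpNorm (G k) (ENNReal.ofReal (1 / D))⁻¹ μ ^ (p - 1) := by
    intro k
    have h5 := eLpNorm_const_smul p (fun x => ‖G k x‖ ^ (p - 1))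
      (ENNReal.ofReal (w / (D * (1 - w))))⁻¹ μ
    rw [show (p • fun x => ‖G k x‖ ^ (p - 1)) = fun x => p * ‖G k x‖ ^ (p - 1) from rfl] at h5
    rw [h5, eLpNorm_norm_rpow _ hpm0, hmulinv (by positivity) hpm0, Real.enorm_of_nonneg hp0.le]
    congr 4
    rw [hpm]; field_simp
  have hstep3 : eLpNorm (fun x => ‖(∑ k ∈ S, g k) x‖ ^ p) (ENNReal.ofReal (w / (D * (1 - w))))⁻¹ μ
      ≤ eLpNorm (∑ k ∈ S, fun x => p * ‖G k x‖ ^ (p - 1))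
        (ENNReal.ofReal (w / (D * (1 - w))))⁻¹ μ := by
    refine eLpNorm_mono_real fun x => ?_
    rw [Real.norm_of_nonneg (by positivity), Finset.sum_apply, Finset.sum_apply]
    calc ‖∑ k ∈ S, g k x‖ ^ p ≤ (∑ k ∈ S, ‖g k x‖) ^ p :=
          Real.rpow_le_rpow (norm_nonneg _) (norm_sum_le _ _) hp0.le
      _ ≤ _ := rpow_sum_le_mul_sum S a _ (fun k => norm_nonneg (g k x)) hp1
      _ = _ := by
          rw [Finset.mul_sum]
          refine Finset.sum_congr rfl fun k _ => ?_
          have hs0 : 0 ≤ ∑ l ∈ S with a l ≤ a k, ‖g l x‖ :=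
            Finset.sum_nonneg fun l _ => norm_nonneg _
          rw [hGx, Real.norm_of_nonneg (by positivity), Real.mul_rpow (by positivity) hs0,
            ← Real.rpow_mul (norm_nonneg _), hκp, Real.rpow_one]
  rw [hstep1]
  refine hstep3.trans ((eLpNorm_sum_le (fun k _ =>
    (((hGm' k).norm.aemeasurable.pow_const _).const_mul p).aestronglyMeasurable) hq1).trans ?_)
  have hterm : ∀ k ∈ S, eLpNorm (fun x => p * ‖G k x‖ ^ (p - 1))
      (ENNReal.ofReal (w / (D * (1 - w))))⁻¹ μ
      ≤ ENNReal.ofReal (p * (A ^ p * B ^ (w / (1 - w))) * a k ^ p) := by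
    intro k hk
    have hak := ha k hk
    rw [hstep2]
    calc _ ≤ ENNReal.ofReal p * ENNReal.ofReal (A ^ (κ + 1) * a k ^ (κ + 1) * B) ^ (p - 1) := by
          gcongr; exact hGbd k hk
      _ = _ := by
          rw [ENNReal.ofReal_rpow_of_nonneg (by positivity) hpm0.le,
            ← ENNReal.ofReal_mul hp0.le, Real.mul_rpow (by positivity) hB0,
            Real.mul_rpow (by positivity) (by positivity), ← Real.rpow_mul hA,
            ← Real.rpow_mul hak.le]
          have : (κ + 1) * (p - 1) = p := by linarith
          rw [this, hpm]; congr 1; ring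
  refine (Finset.sum_le_sum hterm).trans (le_of_eq ?_)
  rw [← ENNReal.ofReal_sum_of_nonneg, ← Finset.mul_sum]
  intro k hk
  have hak := ha k hk
  positivity

end RestrictedToStrong

section StrongType

/-! ### The strong-type estimate for good curves -/

variable {n : ℕ}

theorem curveFourier_const_mul {d : ℕ} (γ : Fin d → ℝ[X]) (c : ℂ) (f : ℝ → ℂ) :
    curveFourier γ (fun t => c * f t) = c • curveFourier γ f := by
  ext x
  rw [Pi.smul_apply, smul_eq_mul, curveFourier, curveFourier, ← integral_const_mul]
  congr 1; ext t; ring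

theorem measurable_inner_curvePoint {d : ℕ} (γ : Fin d → ℝ[X]) (x : EuclideanSpace ℝ (Fin d)) :
    Measurable fun t => inner ℝ x (curvePoint γ t) :=
  (continuous_const.inner (continuous_curvePoint γ)).measurable

/-- Dominated convergence for the extension operator. -/
theorem tendsto_curveFourier {d : ℕ} (γ : Fin d → ℝ[X]) {f : ℝ → ℂ} (hf : Integrable f)
    {F : ℕ → ℝ → ℂ} (hF : ∀ N, AEStronglyMeasurable (F N) volume) (hle : ∀ N t, ‖F N t‖ ≤ ‖f t‖)
    (hlim : ∀ t, Filter.Tendsto (fun N => F N t) Filter.atTop (nhds (f t)))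
    (x : EuclideanSpace ℝ (Fin d)) :
    Filter.Tendsto (fun N => curveFourier γ (F N) x) Filter.atTop (nhds (curveFourier γ f x)) := by
  unfold curveFourier
  refine tendsto_integral_of_dominated_convergence (fun t => ‖f t‖) (fun N => ?_) hf.norm
    (fun N => Filter.Eventually.of_forall fun t => ?_) (Filter.Eventually.of_forall fun t => ?_)
  · exact (integrable_exp_mul (hf.mono (hF N) (Filter.Eventually.of_forall (hle N)))
      (measurable_inner_curvePoint γ x)).1
  · rw [norm_mul, norm_exp_I_mul_ofReal, one_mul]
    exact hle N t
  · exact (hlim t).const_mul _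

theorem RestrictedBound.mono {ε w : ℝ} {A A' : ℝ≥0} (h : RestrictedBound n ε w A) (hA : A ≤ A') :
    RestrictedBound n ε w A' := fun γ J hJ hγ E hE hEJ hEv f hf hfE =>
  (h γ J hJ hγ E hE hEJ hEv f hf hfE).trans (by gcongr)

/-- The set where the size of `f` is in the dyadic interval `[2 ^ k, 2 ^ (k + 1))`. -/
def levelSet (f : ℝ → ℂ) (k : ℤ) : Set ℝ := {t | ‖f t‖ ∈ Set.Ico ((2 : ℝ) ^ k) (2 ^ (k + 1))}

theorem measurableSet_levelSet {f : ℝ → ℂ} (hf : Measurable f) (k : ℤ) :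
    MeasurableSet (levelSet f k) := hf.norm measurableSet_Ico

theorem disjoint_levelSet (f : ℝ → ℂ) {k l : ℤ} (h : k ≠ l) :
    Disjoint (levelSet f k) (levelSet f l) := by
  wlog hkl : k < l generalizing k l
  · exact (this h.symm (lt_of_le_of_ne (not_lt.1 hkl) h.symm)).symm
  refine Set.disjoint_left.2 fun t h1 h2 => ?_
  have h3 : (2 : ℝ) ^ (k + 1) ≤ 2 ^ l := zpow_le_zpow_right₀ (by norm_num) (by omega)
  have := h1.2
  have := h2.1
  linarith

theorem volume_levelSet_ne_top {f : ℝ → ℂ} (hf : Integrable f) (k : ℤ) :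
    volume (levelSet f k) ≠ ⊤ :=
  ((measure_mono fun _ ht => ht.1).trans_lt
    (hf.measure_norm_ge_lt_top (ε := (2 : ℝ) ^ k) (by positivity))).ne

theorem eLpNorm_curveFourier_levelSet_le {ε w : ℝ} {A : ℝ≥0} (h : RestrictedBound n ε w A)
    {γ : Fin (n + 1) → ℝ[X]} {J : Set ℝ} (hJ : J.OrdConnected) (hγ : GoodCurve ε γ J)
    {f : ℝ → ℂ} (hf : Measurable f) (hfI : Integrable f) (hfJ : ∀ t ∉ J, f t = 0) (k : ℤ) :
    eLpNorm (curveFourier γ ((levelSet f k).indicator f)) (critExp n w) volume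
      ≤ ENNReal.ofReal (2 * 2 ^ k) * (A * volume (levelSet f k) ^ (1 - w)) := by
  set E := levelSet f k with hE
  set c : ℝ := 2 ^ (k + 1) with hc
  have hc0 : 0 < c := by positivity
  have hc2 : (2 : ℝ) * 2 ^ k = c := by rw [hc, zpow_add_one₀ (by norm_num)]; ring
  have hEm := measurableSet_levelSet hf k
  have hEJ : E ⊆ J := by
    intro t ht
    by_contra hcon
    have h1 := ht.1
    rw [hfJ t hcon, norm_zero] at h1
    have : (0 : ℝ) < 2 ^ k := by positivity
    linarith
  have h1 := h γ J hJ hγ E hEm hEJ (volume_levelSet_ne_top hfI k)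
    (fun t => ((c⁻¹ : ℝ) : ℂ) * E.indicator f t) ((hf.indicator hEm).const_mul _) (by
      intro t
      by_cases ht : t ∈ E
      · rw [Set.indicator_of_mem ht, Set.indicator_of_mem ht, Pi.one_apply, ← ofReal_norm,
          ENNReal.ofReal_le_one, norm_mul, Complex.norm_real, Real.norm_of_nonneg (by positivity),
          inv_mul_le_one₀ hc0]
        exact ht.2.le
      · simp [ht])
  have h2 : curveFourier γ (E.indicator f)
      = (c : ℂ) • curveFourier γ (fun t => ((c⁻¹ : ℝ) : ℂ) * E.indicator f t) := by
    rw [curveFourier_const_mul, smul_smul, ← Complex.ofReal_mul, mul_inv_cancel₀ hc0.ne',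
      Complex.ofReal_one, one_smul]
  rw [h2, eLpNorm_const_smul, hc2]
  have h3 : ‖(c : ℂ)‖ₑ = ENNReal.ofReal c := by
    rw [← ofReal_norm, Complex.norm_real, Real.norm_of_nonneg hc0.le]
  rw [h3]
  gcongr

/-- The strong-type estimate for good curves on the full range of exponents; the bound does not
depend on the curve. The function is decomposed into dyadic level sets, and the restricted bounds at
exponents on both sides of `w` enter. -/
theorem exists_strongBound {ε w : ℝ} (hn : 1 ≤ n) (hε : DetMargin n ε)
    (hw0 : 0 < w) (hw : w < homDim n / (homDim n + 1)) :
    ∃ A : ℝ≥0, ∀ (γ : Fin (n + 1) → ℝ[X]) (J : Set ℝ), J.OrdConnected → GoodCurve ε γ J →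
      ∀ f : ℝ → ℂ, Measurable f → Integrable f → (∀ t ∉ J, f t = 0) →
        eLpNorm (curveFourier γ f) (critExp n w) volume
          ≤ A * eLpNorm f (ENNReal.ofReal (1 - w))⁻¹ volume := by
  have hD := homDim_pos n
  have hD1 : 1 ≤ homDim n := by
    rw [homDim]
    have : (1 : ℝ) ≤ n := by exact_mod_cast hn
    nlinarith
  set W := homDim n / (homDim n + 1) with hW
  have hW1 : W < 1 := by rw [hW, div_lt_one (by linarith)]; linarith
  have hw1 : w < 1 := hw.trans hW1
  have hw1' : 0 < 1 - w := by linarith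
  have hwD : w ≤ homDim n * (1 - w) := by
    rw [hW, lt_div_iff₀ (by linarith)] at hw; linarith
  -- the perturbed exponents `w - s (1 - w)` have to stay in `[0, W)`
  set c : ℝ := min (w / 2) ((W - w) / 2) with hc
  have hc0 : 0 < c := lt_min (by linarith) (by linarith)
  have hcw : c ≤ w / 2 := min_le_left _ _
  have hcW : c ≤ (W - w) / 2 := min_le_right _ _
  have hrange : ∀ s : ℝ, (|s| = c ∨ |s| = c * (w / (1 - w))) →
      0 ≤ w - s * (1 - w) ∧ w - s * (1 - w) < W := by
    intro s hs
    have h1 : |s * (1 - w)| ≤ c := by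
      rw [abs_mul, abs_of_pos hw1']
      rcases hs with h | h
      · rw [h]; nlinarith
      · rw [h]
        have : c * (w / (1 - w)) * (1 - w) = c * w := by field_simp
        rw [this]; nlinarith
    have h2 := abs_le.1 h1
    constructor <;> linarith
  have hAs : ∀ s : ℝ, ∃ A : ℝ≥0, (|s| = c ∨ |s| = c * (w / (1 - w))) →
      RestrictedBound n ε (w - s * (1 - w)) A := by
    intro s
    by_cases hs : |s| = c ∨ |s| = c * (w / (1 - w))
    · obtain ⟨A, hA⟩ := exists_restrictedBound hn hε (hrange s hs).1 (hrange s hs).2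
      exact ⟨A, fun _ => hA⟩
    · exact ⟨0, fun h => absurd h hs⟩
  choose A' hA' using hAs
  set c' : ℝ := c * (w / (1 - w)) with hc'
  set A : ℝ≥0 := A' c + A' (-c) + A' c' + A' (-c') + 1 with hA
  have hA0 : (0 : ℝ≥0) < A := by rw [hA]; positivity
  have hAbd : ∀ s : ℝ, (|s| = c ∨ |s| = c') → RestrictedBound n ε (w - s * (1 - w)) A := by
    intro s hs
    refine (hA' s hs).mono ?_
    have hc'0 : 0 < c' := by positivity
    have : s = c ∨ s = -c ∨ s = c' ∨ s = -c' := by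
      rcases hs with h | h
      · rcases (abs_eq hc0.le).1 h with h | h <;> simp [h]
      · rcases (abs_eq hc'0.le).1 h with h | h <;> simp [h]
    rw [hA, ← NNReal.coe_le_coe]
    push_cast
    have h1 := (A' c).coe_nonneg
    have h2 := (A' (-c)).coe_nonneg
    have h3 := (A' c').coe_nonneg
    have h4 := (A' (-c')).coe_nonneg
    rcases this with rfl | rfl | h | h
    · linarith
    · linarith
    · rw [h]; linarith
    · rw [h]; linarith
  set B : ℝ := ∑' j : ℤ, (2 : ℝ) ^ (-(c * |(j : ℝ)|)) with hB
  set p : ℝ := (1 - w)⁻¹ with hp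
  have hp0 : 0 < p := by positivity
  set K : ℝ := p * ((2 * A : ℝ) ^ p * B ^ (w / (1 - w))) with hK
  have hB0 : 0 < B := (summable_rpow_neg_abs hc0).tsum_pos (fun j => by positivity) 0 (by positivity)
  have hK0 : 0 < K := by positivity
  refine ⟨(K ^ (1 / p)).toNNReal, fun γ J hJ hγ f hf hfI hfJ => ?_⟩
  have hpe : (ENNReal.ofReal (1 - w))⁻¹ = ENNReal.ofReal p := by
    rw [hp, ENNReal.ofReal_inv_of_pos hw1']
  rw [hpe]
  set e : ℤ → ℝ := fun k => (volume (levelSet f k)).toReal with he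
  have hee : ∀ k, volume (levelSet f k) = ENNReal.ofReal (e k) := fun k =>
    (ENNReal.ofReal_toReal (volume_levelSet_ne_top hfI k)).symm
  have he0 : ∀ k, 0 ≤ e k := fun k => ENNReal.toReal_nonneg
  set g : ℤ → EuclideanSpace ℝ (Fin (n + 1)) → ℂ :=
    fun k => curveFourier γ ((levelSet f k).indicator f) with hg
  have hg0 : ∀ k, e k = 0 → g k = 0 := by
    intro k hk
    ext x
    have h1 := enorm_curveFourier_le γ ((levelSet f k).indicator f) x
    have h2 : ∫⁻ t, ‖(levelSet f k).indicator f t‖ₑ = 0 := by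
      simp_rw [enorm_indicator_eq_indicator_enorm]
      rw [lintegral_indicator (measurableSet_levelSet hf k)]
      refine setLIntegral_measure_zero _ _ ?_
      rw [hee, hk, ENNReal.ofReal_zero]
    rw [h2] at h1
    simpa using h1
  set a : ℤ → ℝ := fun k => 2 ^ k * e k ^ (1 - w) with ha
  have hsum : ∀ S : Finset ℤ, ∑ k ∈ S, ENNReal.ofReal (a k ^ p)
      ≤ eLpNorm f (ENNReal.ofReal p) volume ^ p := by
    intro S
    rw [eLpNorm_eq_lintegral_rpow_enorm_toReal (by simpa using hp0) ENNReal.ofReal_ne_top,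
      ENNReal.toReal_ofReal hp0.le, ← ENNReal.rpow_mul, one_div_mul_cancel hp0.ne',
      ENNReal.rpow_one]
    calc ∑ k ∈ S, ENNReal.ofReal (a k ^ p)
        ≤ ∑ k ∈ S, ∫⁻ t in levelSet f k, ‖f t‖ₑ ^ p := by
          refine Finset.sum_le_sum fun k _ => ?_
          have h1 : a k ^ p = (2 ^ k) ^ p * e k := by
            rw [ha, Real.mul_rpow (by positivity) (Real.rpow_nonneg (he0 k) _),
              ← Real.rpow_mul (he0 k), hp, mul_inv_cancel₀ hw1'.ne', Real.rpow_one]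
          rw [h1, ENNReal.ofReal_mul (by positivity), ← hee, ← setLIntegral_const]
          refine setLIntegral_mono_ae (by fun_prop) (Filter.Eventually.of_forall fun t ht => ?_)
          rw [← ENNReal.ofReal_rpow_of_pos (by positivity), ← ofReal_norm]
          gcongr
          exact ht.1
      _ = ∫⁻ t in ⋃ k ∈ S, levelSet f k, ‖f t‖ₑ ^ p := by
          rw [lintegral_biUnion_finset (fun k _ l _ h => disjoint_levelSet f h)
            fun k _ => measurableSet_levelSet hf k]
      _ ≤ _ := setLIntegral_le_lintegral _ _
  have hfin : ∀ S : Finset ℤ, eLpNorm (∑ k ∈ S, g k) (critExp n w) volume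
      ≤ (K ^ (1 / p)).toNNReal * eLpNorm f (ENNReal.ofReal p) volume := by
    intro S
    have h1 := eLpNorm_sum_rpow_le_of_levels (μ := volume) (A := 2 * A) hD1 hw0 hw1 hwD hc0
      (by linarith) (by nlinarith) (by linarith) (by positivity) le_rfl
      (S.filter fun k => e k ≠ 0) g (fun k => (measurable_curveFourier γ (hf.indicator
        (measurableSet_levelSet hf k))).aestronglyMeasurable) a (by
          intro k hk
          have : 0 < e k := lt_of_le_of_ne (he0 k) (Finset.mem_filter.1 hk).2.symm
          positivity) (by
        intro k hk s hs
        have hek : 0 < e k := lt_of_le_of_ne (he0 k) (Finset.mem_filter.1 hk).2.symm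
        refine (eLpNorm_curveFourier_levelSet_le (hAbd s hs) hJ hγ hf hfI hfJ k).trans
          (le_of_eq ?_)
        rw [hee, ENNReal.ofReal_rpow_of_pos hek, ← ENNReal.ofReal_coe_nnreal,
          ← ENNReal.ofReal_mul (by positivity), ← ENNReal.ofReal_mul (by positivity)]
        congr 1
        have h2 : a k * 2 ^ (-(k : ℝ)) = e k ^ (1 - w) := by
          rw [ha, Real.rpow_neg (by norm_num), Real.rpow_intCast]
          field_simp
        rw [h2, ← Real.rpow_mul hek.le]
        have h3 : e k ^ (1 - (w - s * (1 - w))) = e k ^ (1 - w) * e k ^ ((1 - w) * s) := by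
          rw [← Real.rpow_add hek]; congr 1; ring
        rw [h3, ha]; ring)
    have h4 : ∑ k ∈ S with e k ≠ 0, g k = ∑ k ∈ S, g k :=
      Finset.sum_filter_of_ne fun k _ hgk hek => hgk (hg0 k hek)
    rw [h4] at h1
    have h5 : eLpNorm (∑ k ∈ S, g k) (critExp n w) volume ^ p
        ≤ ENNReal.ofReal K * eLpNorm f (ENNReal.ofReal p) volume ^ p := by
      refine h1.trans ?_
      rw [ENNReal.ofReal_mul hK0.le, ENNReal.ofReal_sum_of_nonneg fun k _ => by
        have := he0 k
        positivity]
      gcongr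
      exact hsum _
    calc eLpNorm (∑ k ∈ S, g k) (critExp n w) volume
        = (eLpNorm (∑ k ∈ S, g k) (critExp n w) volume ^ p) ^ (1 / p) := by
          rw [← ENNReal.rpow_mul, mul_one_div_cancel hp0.ne', ENNReal.rpow_one]
      _ ≤ (ENNReal.ofReal K * eLpNorm f (ENNReal.ofReal p) volume ^ p) ^ (1 / p) := by gcongr
      _ = _ := by
          rw [ENNReal.mul_rpow_of_nonneg _ _ (by positivity), ← ENNReal.rpow_mul,
            mul_one_div_cancel hp0.ne', ENNReal.rpow_one,
            ENNReal.ofReal_rpow_of_pos hK0]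
          rfl
  set F : ℕ → ℝ → ℂ := fun N =>
    (⋃ k ∈ Finset.Ico (-(N : ℤ)) N, levelSet f k).indicator f with hF
  have hFsum : ∀ N, curveFourier γ (F N) = ∑ k ∈ Finset.Ico (-(N : ℤ)) N, g k := by
    intro N
    ext x
    rw [Finset.sum_apply]
    simp only [hg, curveFourier]
    rw [← integral_finsetSum _ fun k _ => integrable_exp_mul
      (hfI.indicator (measurableSet_levelSet hf k)) (measurable_inner_curvePoint γ x)]
    congr 1
    ext t
    rw [← Finset.mul_sum]
    congr 1
    exact Finset.indicator_biUnion_apply _ _ (fun k _ l _ h => disjoint_levelSet f h) t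
  have hUm : ∀ N : ℕ, MeasurableSet (⋃ k ∈ Finset.Ico (-(N : ℤ)) N, levelSet f k) := fun N =>
    Finset.measurableSet_biUnion _ fun k _ => measurableSet_levelSet hf k
  refine Lp.eLpNorm_le_of_ae_tendsto (u := Filter.atTop) (f := fun N => curveFourier γ (F N))
    (Filter.Eventually.of_forall fun N => by rw [hFsum]; exact hfin _)
    (fun N => (measurable_curveFourier γ (hf.indicator (hUm N))).aestronglyMeasurable)
    (Filter.Eventually.of_forall fun x => tendsto_curveFourier γ hfI
      (fun N => (hf.indicator (hUm N)).aestronglyMeasurable)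
      (fun N t => norm_indicator_le_norm_self _ _) (fun t => ?_) x)
  by_cases ht : f t = 0
  · refine tendsto_const_nhds.congr fun N => ?_
    rw [ht]
    exact (Set.indicator_apply_eq_zero.2 fun _ => ht).symm
  · obtain ⟨k, hk⟩ := exists_mem_Ico_zpow (norm_pos_iff.2 ht) (one_lt_two (α := ℝ))
    refine tendsto_const_nhds.congr' ?_
    filter_upwards [Filter.eventually_gt_atTop k.natAbs] with N hN
    refine (Set.indicator_of_mem (Set.mem_iUnion₂.2 ⟨k, ?_, hk⟩) f).symm
    rw [Finset.mem_Ico]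
    omega

end StrongType

section Wronskian

/-! ### The Wronskian of linearly independent polynomials -/

open Polynomial

theorem tendsto_eval_div_pow (q : ℝ[X]) {e : ℕ} (he : q.natDegree ≤ e) :
    Filter.Tendsto (fun t : ℝ => q.eval t / t ^ e) Filter.atTop (nhds (q.coeff e)) := by
  have h : ∀ᶠ t : ℝ in Filter.atTop,
      ∑ k ∈ Finset.range (e + 1), q.coeff k * (t⁻¹) ^ (e - k) = q.eval t / t ^ e := by
    filter_upwards [Filter.eventually_gt_atTop 0] with t ht
    rw [eval_eq_sum_range' (Nat.lt_succ_of_le he), Finset.sum_div]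
    refine Finset.sum_congr rfl fun k hk => ?_
    have hke : k ≤ e := Nat.lt_succ_iff.1 (Finset.mem_range.1 hk)
    rw [inv_pow, ← div_eq_mul_inv, div_eq_div_iff (by positivity) (by positivity), mul_assoc,
      ← pow_add, Nat.add_sub_cancel' hke]
  refine Filter.Tendsto.congr' h ?_
  have h2 : q.coeff e = ∑ k ∈ Finset.range (e + 1), q.coeff k * (0 : ℝ) ^ (e - k) := by
    rw [Finset.sum_range_succ, Nat.sub_self, pow_zero, mul_one, Finset.sum_eq_zero, zero_add]
    intro k hk
    rw [zero_pow (Nat.sub_ne_zero_of_lt (Finset.mem_range.1 hk)), mul_zero]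
  rw [h2]
  exact tendsto_finsetSum _ fun k _ => ((tendsto_inv_atTop_zero).pow _).const_mul _

theorem coeff_X_pow_mul_iterate_derivative (p : ℝ[X]) (j e : ℕ) :
    (X ^ j * derivative^[j] p).coeff e = p.coeff e * (e.descFactorial j : ℝ) := by
  rw [coeff_X_pow_mul']
  split_ifs with h
  · rw [coeff_iterate_derivative, Nat.sub_add_cancel h, nsmul_eq_mul, mul_comm]
  · rw [Nat.descFactorial_eq_zero_iff_lt.2 (not_le.1 h)]; simp

/-- If the degrees are pairwise distinct, the Wronskian does not vanish: after scaling its rows and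
columns by powers of `t`, the limit at infinity is a determinant of falling factorials of the
degrees, hence a Vandermonde determinant. -/
theorem wronskian_ne_zero_of_natDegree_injective {d : ℕ} (g : Fin d → ℝ[X]) (h0 : ∀ i, g i ≠ 0)
    (hg : Function.Injective fun i => (g i).natDegree) :
    (Matrix.of fun i j : Fin d => derivative^[(j : ℕ)] (g i)).det ≠ 0 := by
  intro hW
  set e : Fin d → ℕ := fun i => (g i).natDegree with he
  have hlim : Filter.Tendsto (fun t : ℝ => (Matrix.of fun i j : Fin d =>
      (X ^ (j : ℕ) * derivative^[(j : ℕ)] (g i)).eval t / t ^ e i).det) Filter.atTop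
      (nhds (Matrix.of fun i j : Fin d =>
        (g i).leadingCoeff * ((e i).descFactorial j : ℝ)).det) := by
    refine (Continuous.tendsto (continuous_id.matrix_det) _).comp ?_
    refine tendsto_pi_nhds.2 fun i => tendsto_pi_nhds.2 fun j => ?_
    have h1 : (X ^ (j : ℕ) * derivative^[(j : ℕ)] (g i)).natDegree ≤ e i := by
      rw [natDegree_le_iff_coeff_eq_zero]
      intro m hm
      rw [coeff_X_pow_mul_iterate_derivative, coeff_eq_zero_of_natDegree_lt hm, zero_mul]
    have h2 := tendsto_eval_div_pow _ h1
    rw [coeff_X_pow_mul_iterate_derivative] at h2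
    exact h2
  have hzero : ∀ᶠ t : ℝ in Filter.atTop, (0 : ℝ) = (Matrix.of fun i j : Fin d =>
      (X ^ (j : ℕ) * derivative^[(j : ℕ)] (g i)).eval t / t ^ e i).det := by
    refine Filter.Eventually.of_forall fun t => ?_
    have h1 : (Matrix.of fun i j : Fin d =>
        (X ^ (j : ℕ) * derivative^[(j : ℕ)] (g i)).eval t / t ^ e i)
        = Matrix.of fun i j : Fin d => (t ^ e i)⁻¹ * (Matrix.of fun i j : Fin d =>
          t ^ (j : ℕ) * (derivative^[(j : ℕ)] (g i)).eval t) i j := by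
      ext i j
      simp [div_eq_inv_mul]
    have h2 : (Matrix.of fun i j : Fin d => t ^ (j : ℕ) * (derivative^[(j : ℕ)] (g i)).eval t)
        = Matrix.of fun i j : Fin d => t ^ (j : ℕ) * ((evalRingHom t).mapMatrix
          (Matrix.of fun i j : Fin d => derivative^[(j : ℕ)] (g i))) i j := by
      ext i j
      simp
    rw [h1, Matrix.det_mul_column, h2, Matrix.det_mul_row, ← RingHom.map_det, hW]
    simp
  have hdet0 := tendsto_nhds_unique hlim (tendsto_const_nhds.congr' hzero)
  have h3 : (Matrix.of fun i j : Fin d => (g i).leadingCoeff * ((e i).descFactorial j : ℝ))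
      = Matrix.of fun i j : Fin d => (g i).leadingCoeff * (Matrix.of fun i j : Fin d =>
        (descPochhammer ℝ (j : ℕ)).eval (e i : ℝ)) i j := by
    ext i j
    simp [descPochhammer_eval_eq_descFactorial]
  rw [h3, Matrix.det_mul_column, mul_eq_zero] at hdet0
  rcases hdet0 with h | h
  · obtain ⟨i, -, hi⟩ := Finset.prod_eq_zero_iff.1 h
    exact h0 i (leadingCoeff_eq_zero.1 hi)
  · rw [← Matrix.det_eval_matrixOfPolynomials_eq_det_vandermonde (fun i => (e i : ℝ))
      (fun j : Fin d => descPochhammer ℝ (j : ℕ)) (fun j => descPochhammer_natDegree ℝ j)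
      (fun j => monic_descPochhammer ℝ j), Matrix.det_vandermonde_eq_zero_iff] at h
    obtain ⟨i, j, hij, hne⟩ := h
    exact hne (hg (by exact_mod_cast hij))

/-- The Wronskian of linearly independent polynomials does not vanish identically. Row operations
lower the sum of the degrees until the degrees are pairwise distinct. -/
theorem wronskian_ne_zero {d : ℕ} (g : Fin d → ℝ[X]) (hg : LinearIndependent ℝ g) :
    (Matrix.of fun i j : Fin d => derivative^[(j : ℕ)] (g i)).det ≠ 0 := by
  induction hm : ∑ i, (g i).natDegree using Nat.strong_induction_on generalizing g with
  | _ m ih =>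
  by_cases hinj : Function.Injective fun i => (g i).natDegree
  · exact wronskian_ne_zero_of_natDegree_injective g (fun i => hg.ne_zero i) hinj
  -- two equal degrees: subtract a multiple of one row from the other
  simp only [Function.Injective] at hinj
  push Not at hinj
  obtain ⟨i, i', hdeg, hne⟩ := hinj
  set c : ℝ := (g i).leadingCoeff / (g i').leadingCoeff with hc
  have hl : (g i').leadingCoeff ≠ 0 := leadingCoeff_ne_zero.2 (hg.ne_zero i')
  have hl' : (g i).leadingCoeff ≠ 0 := leadingCoeff_ne_zero.2 (hg.ne_zero i)
  have hc0 : c ≠ 0 := div_ne_zero hl' hl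
  set g' : Fin d → ℝ[X] := Function.update g i (g i - C c * g i') with hg'
  have hind : LinearIndependent ℝ g' := by
    rw [Fintype.linearIndependent_iff] at hg ⊢
    intro a ha
    have h1 : ∑ k, (a k - if k = i' then a i * c else 0) • g k = 0 := by
      rw [← ha]
      have h2 : ∀ k, a k • g' k = a k • g k - if k = i then (a i * c) • g i' else 0 := by
        intro k
        by_cases hk : k = i
        · subst hk
          rw [hg', Function.update_self, if_pos rfl, smul_sub, mul_smul, smul_eq_C_mul c]
        · rw [hg', Function.update_of_ne hk, if_neg hk, sub_zero]
      simp_rw [h2, sub_smul, Finset.sum_sub_distrib, ite_smul, zero_smul]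
      simp
    have h3 := hg _ h1
    have hai : a i = 0 := by simpa [hne] using h3 i
    intro k
    have := h3 k
    simpa [hai] using this
  have hlt : ∑ k, (g' k).natDegree < m := by
    rw [← hm]
    refine Finset.sum_lt_sum (fun k _ => ?_) ⟨i, Finset.mem_univ i, ?_⟩
    swap
    all_goals
      have hi : (g' i).natDegree < (g i).natDegree := by
        refine natDegree_lt_natDegree (hind.ne_zero i) ?_
        rw [hg', Function.update_self]
        refine degree_sub_lt_left ?_ (hg.ne_zero i) ?_
        · rw [degree_C_mul hc0, degree_eq_natDegree (hg.ne_zero i),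
            degree_eq_natDegree (hg.ne_zero i')]
          exact_mod_cast hdeg
        · rw [leadingCoeff_mul, leadingCoeff_C, hc, div_mul_cancel₀ _ hl]
    · exact hi
    · by_cases hk : k = i
      · rw [hk]; exact hi.le
      · rw [hg', Function.update_of_ne hk]
  have h4 := ih _ hlt g' hind rfl
  have h5 : (Matrix.of fun i j : Fin d => derivative^[(j : ℕ)] (g' i))
      = (Matrix.of fun i j : Fin d => derivative^[(j : ℕ)] (g i)).updateRow i
        ((Matrix.of fun i j : Fin d => derivative^[(j : ℕ)] (g i)) i
          + (-C c) • (Matrix.of fun i j : Fin d => derivative^[(j : ℕ)] (g i)) i') := by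
    ext1 k j
    by_cases hk : k = i
    · subst hk
      rw [Matrix.updateRow_self]
      simp only [Matrix.of_apply, hg', Function.update_self, Pi.add_apply, Pi.smul_apply]
      rw [iterate_derivative_sub, iterate_derivative_C_mul, smul_eq_mul]
      ring
    · rw [Matrix.updateRow_ne hk]
      simp only [Matrix.of_apply, hg', Function.update_of_ne hk]
  rwa [h5, Matrix.det_updateRow_add_smul_self _ hne] at h4

end Wronskian

section Compactness

/-! ### Compactness of normalised curves -/

open Polynomial

variable {d N : ℕ}

/-- The matrix of the derivatives of orders `1, …, d`, whose determinant is the torsion. -/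
noncomputable def torsionMatrix (γ : Fin d → ℝ[X]) (t : ℝ) : Matrix (Fin d) (Fin d) ℝ :=
  Matrix.of fun i j : Fin d => (derivative^[(j : ℕ) + 1] (γ i)).eval t

theorem det_torsionMatrix (γ : Fin d → ℝ[X]) (t : ℝ) : (torsionMatrix γ t).det = torsion γ t := rfl

/-- The linear image of a curve under a matrix. -/
noncomputable def mulCurve (c : Matrix (Fin d) (Fin d) ℝ) (γ : Fin d → ℝ[X]) : Fin d → ℝ[X] :=
  fun i => ∑ j, C (c i j) * γ j

theorem torsionMatrix_mulCurve (c : Matrix (Fin d) (Fin d) ℝ) (γ : Fin d → ℝ[X]) (t : ℝ) :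
    torsionMatrix (mulCurve c γ) t = c * torsionMatrix γ t := by
  ext i j
  rw [Matrix.mul_apply, torsionMatrix, Matrix.of_apply, mulCurve, iterate_derivative_sum,
    eval_finsetSum]
  refine Finset.sum_congr rfl fun k _ => ?_
  rw [iterate_derivative_C_mul, eval_C_mul]
  rfl

/-- The polynomial without constant term with the given coefficients. -/
noncomputable def coeffPoly (v : EuclideanSpace ℝ (Fin N)) : ℝ[X] :=
  ∑ k : Fin N, C (v k) * X ^ ((k : ℕ) + 1)

theorem coeff_coeffPoly (v : EuclideanSpace ℝ (Fin N)) (k : Fin N) :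
    (coeffPoly v).coeff (k + 1) = v k := by
  rw [coeffPoly, finsetSum_coeff, Finset.sum_eq_single k]
  · simp
  · intro l _ hl
    rw [coeff_C_mul, coeff_X_pow, if_neg, mul_zero]
    intro h
    exact hl (Fin.ext (by omega))
  · simp

theorem derivative_coeffPoly_eq (p : ℝ[X]) (hp : p.natDegree ≤ N) :
    derivative (coeffPoly (WithLp.toLp 2 fun k : Fin N => p.coeff (k + 1))) = derivative p := by
  have h := p.as_sum_range' (N + 1) (Nat.lt_succ_of_le hp)
  rw [Finset.sum_range_succ'] at h
  have h2 : p = coeffPoly (WithLp.toLp 2 fun k : Fin N => p.coeff (k + 1)) + C (p.coeff 0) := by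
    conv_lhs => rw [h]
    rw [coeffPoly, Finset.sum_range]
    simp [C_mul_X_pow_eq_monomial]
  conv_rhs => rw [h2]
  simp

theorem coeffPoly_sum_smul {ι : Type*} (s : Finset ι) (a : ι → ℝ)
    (v : ι → EuclideanSpace ℝ (Fin N)) :
    coeffPoly (∑ i ∈ s, a i • v i) = ∑ i ∈ s, C (a i) * coeffPoly (v i) := by
  simp only [coeffPoly, Finset.mul_sum]
  rw [Finset.sum_comm]
  refine Finset.sum_congr rfl fun k _ => ?_
  simp only [WithLp.ofLp_sum, WithLp.ofLp_smul, Finset.sum_apply, Pi.smul_apply, smul_eq_mul,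
    map_sum, Finset.sum_mul, C_mul, mul_assoc]

theorem torsionMatrix_congr {γ γ' : Fin d → ℝ[X]} (h : ∀ i, derivative (γ i) = derivative (γ' i))
    (t : ℝ) : torsionMatrix γ t = torsionMatrix γ' t := by
  ext i j
  simp only [torsionMatrix, Matrix.of_apply, Function.iterate_succ_apply, h]

/-- A curve with nonzero torsion is a linear image of a curve whose coefficient vectors are
orthonormal. -/
theorem exists_orthonormal_factorization {γ : Fin d → ℝ[X]} (hγ : ∀ i, (γ i).natDegree ≤ N)
    {s₀ : ℝ} (h0 : torsion γ s₀ ≠ 0) :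
    ∃ (c : Matrix (Fin d) (Fin d) ℝ) (b : Fin d → EuclideanSpace ℝ (Fin N)), Orthonormal ℝ b ∧
      ∀ s, torsionMatrix γ s = c * torsionMatrix (fun i => coeffPoly (b i)) s := by
  set G : Fin d → EuclideanSpace ℝ (Fin N) :=
    fun i => WithLp.toLp 2 fun k : Fin N => (γ i).coeff (k + 1) with hG
  have hGd : ∀ i, derivative (coeffPoly (G i)) = derivative (γ i) := fun i =>
    derivative_coeffPoly_eq _ (hγ i)
  have hind : LinearIndependent ℝ G := by
    rw [Fintype.linearIndependent_iff]
    intro a ha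
    have h1 : Matrix.vecMul a (torsionMatrix γ s₀) = 0 := by
      ext j
      have h2 : ∑ i, C (a i) * coeffPoly (G i) = 0 := by
        rw [← coeffPoly_sum_smul, ha]; simp [coeffPoly]
      have h3 := congrArg (fun p => (derivative^[(j : ℕ) + 1] p).eval s₀) h2
      simp only [iterate_derivative_sum, eval_finsetSum, iterate_derivative_C_mul, eval_C_mul,
        iterate_derivative_zero, eval_zero] at h3
      rw [← torsionMatrix_congr hGd]
      exact h3
    exact fun i => congrFun (Matrix.eq_zero_of_vecMul_eq_zero h0 h1) i
  set W := Submodule.span ℝ (Set.range G) with hW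
  have hdim : Module.finrank ℝ W = d := by
    rw [finrank_span_eq_card hind, Fintype.card_fin]
  set B : OrthonormalBasis (Fin d) ℝ W := (stdOrthonormalBasis ℝ W).reindex (finCongr hdim) with hB
  have hGW : ∀ i, G i ∈ W := fun i => Submodule.subset_span ⟨i, rfl⟩
  refine ⟨Matrix.of fun i j => B.repr ⟨G i, hGW i⟩ j, fun i => (B i : EuclideanSpace ℝ (Fin N)),
    B.orthonormal.comp_linearIsometry W.subtypeₗᵢ, fun s => ?_⟩
  rw [← torsionMatrix_mulCurve]
  have h4 : ∀ i, G i = ∑ j, B.repr ⟨G i, hGW i⟩ j • (B j : EuclideanSpace ℝ (Fin N)) := by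
    intro i
    have := congrArg (W.subtype) (B.sum_repr ⟨G i, hGW i⟩)
    rw [map_sum] at this
    simpa using this.symm
  refine torsionMatrix_congr (fun i => ?_) s
  rw [← hGd]
  conv_lhs => rw [h4 i, coeffPoly_sum_smul]
  rfl

/-- The torsion of a curve with linearly independent coefficient vectors is the Wronskian of the
derivatives of its components, a nonzero polynomial. -/
theorem exists_torsion_ne_zero {b : Fin d → EuclideanSpace ℝ (Fin N)}
    (hb : LinearIndependent ℝ b) :
    ∃ s ∈ Set.Icc (0 : ℝ) 1, torsion (fun i => coeffPoly (b i)) s ≠ 0 := by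
  have hind : LinearIndependent ℝ fun i => derivative (coeffPoly (b i)) := by
    rw [Fintype.linearIndependent_iff] at hb ⊢
    intro a ha
    refine hb a ?_
    ext k
    have h1 : derivative (coeffPoly (∑ i, a i • b i)) = 0 := by
      rw [coeffPoly_sum_smul, derivative_sum, ← ha]
      refine Finset.sum_congr rfl fun i _ => ?_
      rw [derivative_C_mul, smul_eq_C_mul]
    have h2 := congrArg (fun p => p.coeff k) h1
    simp only [coeff_derivative, coeff_coeffPoly, coeff_zero] at h2
    have h3 : ((k : ℕ) : ℝ) + 1 ≠ 0 := by positivity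
    simpa using (mul_eq_zero.1 h2).resolve_right h3
  have hne := wronskian_ne_zero _ hind
  by_contra! hcon
  refine hne (eq_zero_of_infinite_isRoot _ ((Set.Icc_infinite (zero_lt_one (α := ℝ))).mono ?_))
  intro s hs
  have h := hcon s hs
  rw [Set.mem_ofPred_eq, IsRoot.def, ← coe_evalRingHom, RingHom.map_det, ← h, torsion]
  congr 1

theorem continuous_torsionMatrix_coeffPoly :
    Continuous fun z : (Fin d → EuclideanSpace ℝ (Fin N)) × ℝ =>
      torsionMatrix (fun i => coeffPoly (z.1 i)) z.2 := by
  refine continuous_pi fun i => continuous_pi fun j => ?_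
  have : ∀ z : (Fin d → EuclideanSpace ℝ (Fin N)) × ℝ,
      torsionMatrix (fun i => coeffPoly (z.1 i)) z.2 i j
        = ∑ k : Fin N, z.1 i k * (derivative^[(j : ℕ) + 1] (X ^ ((k : ℕ) + 1) : ℝ[X])).eval z.2 := by
    intro z
    simp only [torsionMatrix, Matrix.of_apply, coeffPoly, iterate_derivative_sum, eval_finsetSum,
      iterate_derivative_C_mul, eval_C_mul]
  simp_rw [this]
  refine continuous_finsetSum _ fun k _ => Continuous.mul ?_ ?_
  · exact (EuclideanSpace.proj (𝕜 := ℝ) k).continuous.comp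
      ((continuous_apply i).comp continuous_fst)
  · exact (Polynomial.continuous _).comp continuous_snd

theorem isCompact_orthonormal :
    IsCompact {b : Fin d → EuclideanSpace ℝ (Fin N) | Orthonormal ℝ b} := by
  refine Metric.isCompact_of_isClosed_isBounded ?_ ?_
  · have : {b : Fin d → EuclideanSpace ℝ (Fin N) | Orthonormal ℝ b}
        = ⋂ i, ⋂ j, {b | inner ℝ (b i) (b j) = if i = j then (1 : ℝ) else 0} := by
      ext b
      simp only [Set.mem_ofPred_eq, Set.mem_iInter, orthonormal_iff_ite]
    rw [this]
    exact isClosed_iInter fun i => isClosed_iInter fun j => isClosed_eq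
      ((continuous_apply i).inner (continuous_apply j)) continuous_const
  · refine (Metric.isBounded_closedBall (x := (0 : Fin d → EuclideanSpace ℝ (Fin N)))
      (r := 1)).subset fun b hb => ?_
    rw [mem_closedBall_zero_iff, pi_norm_le_iff_of_nonneg zero_le_one]
    exact fun i => (hb.1 i).le

/-- By compactness of the set of orthonormal systems, the maximum of the torsion over the unit
interval is bounded below on it. -/
theorem exists_torsion_lower_bound (d N : ℕ) :
    ∃ c₀ : ℝ, 0 < c₀ ∧ ∀ b : Fin d → EuclideanSpace ℝ (Fin N), Orthonormal ℝ b →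
      ∃ s ∈ Set.Icc (0 : ℝ) 1, c₀ ≤ |torsion (fun i => coeffPoly (b i)) s| := by
  refine (isCompact_orthonormal (d := d) (N := N)).induction_on
    (p := fun S => ∃ c₀ : ℝ, 0 < c₀ ∧ ∀ b ∈ S,
      ∃ s ∈ Set.Icc (0 : ℝ) 1, c₀ ≤ |torsion (fun i => coeffPoly (b i)) s|) ?_ ?_ ?_ ?_
  · exact ⟨1, one_pos, by simp⟩
  · rintro S T hST ⟨c, hc, h⟩
    exact ⟨c, hc, fun b hb => h b (hST hb)⟩
  · rintro S T ⟨c, hc, h⟩ ⟨c', hc', h'⟩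
    refine ⟨min c c', lt_min hc hc', fun b hb => ?_⟩
    rcases hb with hb | hb
    · obtain ⟨s, hs, hle⟩ := h b hb
      exact ⟨s, hs, (min_le_left _ _).trans hle⟩
    · obtain ⟨s, hs, hle⟩ := h' b hb
      exact ⟨s, hs, (min_le_right _ _).trans hle⟩
  · intro b hb
    obtain ⟨s, hs, hne⟩ := exists_torsion_ne_zero (Orthonormal.linearIndependent hb)
    have hcont : Continuous fun b : Fin d → EuclideanSpace ℝ (Fin N) =>
        |torsion (fun i => coeffPoly (b i)) s| :=
      ((continuous_torsionMatrix_coeffPoly.matrix_det).comp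
        (continuous_id.prodMk continuous_const)).abs
    have hpos := abs_pos.2 hne
    have hev := hcont.continuousAt.eventually (lt_mem_nhds (half_lt_self hpos))
    exact ⟨_, mem_nhdsWithin_of_mem_nhds hev, _, half_pos hpos, fun b' hb' => ⟨s, hs, le_of_lt hb'⟩⟩

/-- A curve whose derivative matrix is the identity at `s₀` and whose torsion is bounded on the
unit interval has derivative matrix close to the identity near `s₀`, uniformly in the curve.

The derivative matrix at `s` is `M(s₀)⁻¹ M(s)`, where `M` belongs to a curve with orthonormal
coefficients. The torsion of the latter is somewhere bounded below, so the bound on the torsion of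
the given curve keeps `det M(s₀)` away from zero; then `M(s₀)⁻¹ M(s)` is uniformly continuous on a
compact set of parameters. -/
theorem exists_torsionMatrix_near_one (d N : ℕ) (R : ℝ) {ε : ℝ} (hε : 0 < ε) :
    ∃ δ : ℝ, 0 < δ ∧ ∀ γ : Fin d → ℝ[X], (∀ i, (γ i).natDegree ≤ N) →
      ∀ s₀ ∈ Set.Icc (0 : ℝ) 1, ∀ s ∈ Set.Icc (0 : ℝ) 1, |s - s₀| < δ →
      torsionMatrix γ s₀ = 1 → (∀ u ∈ Set.Icc (0 : ℝ) 1, |torsion γ u| ≤ R) →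
      ∀ i j, |torsionMatrix γ s i j - (1 : Matrix (Fin d) (Fin d) ℝ) i j| < ε := by
  obtain ⟨c₀, hc₀, hlow⟩ := exists_torsion_lower_bound d N
  set M : (Fin d → EuclideanSpace ℝ (Fin N)) × ℝ → Matrix (Fin d) (Fin d) ℝ :=
    fun z => torsionMatrix (fun i => coeffPoly (z.1 i)) z.2 with hM
  have hMc : Continuous M := continuous_torsionMatrix_coeffPoly
  set κ : ℝ := c₀ / (|R| + 1) with hκ
  have hκ0 : 0 < κ := by positivity
  set Q : Set ((Fin d → EuclideanSpace ℝ (Fin N)) × ℝ × ℝ) :=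
    ({b | Orthonormal ℝ b} ×ˢ (Set.Icc 0 1 ×ˢ Set.Icc 0 1)) ∩
      {z | κ ≤ |(M (z.1, z.2.1)).det|} with hQ
  have hM1 : Continuous fun z : (Fin d → EuclideanSpace ℝ (Fin N)) × ℝ × ℝ => M (z.1, z.2.1) :=
    hMc.comp (by fun_prop)
  have hM2 : Continuous fun z : (Fin d → EuclideanSpace ℝ (Fin N)) × ℝ × ℝ => M (z.1, z.2.2) :=
    hMc.comp (by fun_prop)
  have hQc : IsCompact Q := (isCompact_orthonormal.prod (isCompact_Icc.prod isCompact_Icc)).inter_right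
    (isClosed_le continuous_const hM1.matrix_det.abs)
  set H : Fin d → Fin d → (Fin d → EuclideanSpace ℝ (Fin N)) × ℝ × ℝ → ℝ := fun i j z =>
    ((M (z.1, z.2.1)).det)⁻¹ * ((M (z.1, z.2.1)).adjugate * M (z.1, z.2.2)) i j with hH
  have hHc : ∀ i j, ContinuousOn (H i j) Q := by
    intro i j
    refine ContinuousOn.mul (ContinuousOn.inv₀ hM1.matrix_det.continuousOn fun z hz => ?_)
      ((hM1.matrix_adjugate.matrix_mul hM2).matrix_elem i j).continuousOn
    exact abs_pos.1 (hκ0.trans_le hz.2)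
  have hδ : ∀ i j, ∃ δ > 0, ∀ z ∈ Q, ∀ z' ∈ Q, dist z z' < δ → dist (H i j z) (H i j z') < ε :=
    fun i j => (Metric.uniformContinuousOn_iff.1
      (hQc.uniformContinuousOn_of_continuous (hHc i j))) ε hε
  choose δ hδ0 hδ using hδ
  obtain ⟨δ₀, hδ₀, hδ₀le⟩ : ∃ δ₀ > 0, ∀ i j, δ₀ ≤ δ i j := by
    have h1 : ∀ᶠ x : ℝ in nhdsWithin 0 (Set.Ioi 0), ∀ i j, x ≤ δ i j := by
      rw [Filter.eventually_all]; intro i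
      rw [Filter.eventually_all]; intro j
      exact Filter.Eventually.filter_mono nhdsWithin_le_nhds (ge_mem_nhds (hδ0 i j))
    obtain ⟨x, hx, hx0⟩ := (h1.and self_mem_nhdsWithin).exists
    exact ⟨x, hx0, hx⟩
  refine ⟨δ₀, hδ₀, fun γ hγ s₀ hs₀ s hs hss h1 hR i j => ?_⟩
  have htor : torsion γ s₀ = 1 := by rw [← det_torsionMatrix, h1, Matrix.det_one]
  obtain ⟨c, b, hb, hcb⟩ := exists_orthonormal_factorization hγ (s₀ := s₀) (by rw [htor]; simp)
  have hdet : ∀ u, torsion γ u = c.det * (M (b, u)).det := fun u => by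
    rw [← det_torsionMatrix, hcb, Matrix.det_mul]
  obtain ⟨u, hu, hule⟩ := hlow b hb
  have hcdet : |c.det| * c₀ ≤ |R| + 1 := by
    have h2 := hR u hu
    rw [hdet, abs_mul] at h2
    have : |c.det| * c₀ ≤ |c.det| * |(M (b, u)).det| :=
      mul_le_mul_of_nonneg_left hule (abs_nonneg _)
    linarith [le_abs_self R]
  have hs₀det : |c.det| * |(M (b, s₀)).det| = 1 := by
    rw [← abs_mul, ← hdet, htor, abs_one]
  have hκle : κ ≤ |(M (b, s₀)).det| := by
    rw [hκ, div_le_iff₀ (by positivity)]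
    have hpos : 0 ≤ |(M (b, s₀)).det| := abs_nonneg _
    nlinarith
  have hdet0 : (M (b, s₀)).det ≠ 0 := abs_pos.1 (hκ0.trans_le hκle)
  have hz : (b, s₀, s) ∈ Q := ⟨⟨hb, hs₀, hs⟩, hκle⟩
  have hz' : (b, s₀, s₀) ∈ Q := ⟨⟨hb, hs₀, hs₀⟩, hκle⟩
  have hHeq : ∀ v, H i j (b, s₀, v) = torsionMatrix γ v i j := by
    intro v
    have h3 : c = (M (b, s₀))⁻¹ := by
      have h4 : c * M (b, s₀) = 1 := by rw [← h1]; exact (hcb s₀).symm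
      exact (Matrix.inv_eq_left_inv h4).symm
    rw [hcb v, h3, Matrix.inv_def, Ring.inverse_eq_inv', Matrix.smul_mul, Matrix.smul_apply,
      smul_eq_mul]
  have h5 := hδ i j _ hz _ hz' (by
    refine lt_of_lt_of_le ?_ (hδ₀le i j)
    simp only [Prod.dist_eq, dist_self]
    rw [Real.dist_eq]
    simp [hss])
  rwa [hHeq, hHeq, h1, Real.dist_eq] at h5

end Compactness

section AffineInvariance

/-! ### Affine changes of the curve and of the parameter -/

open Polynomial

variable {d : ℕ}

theorem mulCurve_mulCurve (c c' : Matrix (Fin d) (Fin d) ℝ) (γ : Fin d → ℝ[X]) :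
    mulCurve c (mulCurve c' γ) = mulCurve (c * c') γ := by
  ext1 i
  simp only [mulCurve, Matrix.mul_apply, map_sum, C_mul, Finset.mul_sum, Finset.sum_mul]
  rw [Finset.sum_comm]
  refine Finset.sum_congr rfl fun k _ => Finset.sum_congr rfl fun j _ => ?_
  ring

theorem mulCurve_one (γ : Fin d → ℝ[X]) : mulCurve 1 γ = γ := by
  ext1 i
  simp [mulCurve, Matrix.one_apply]

theorem natDegree_mulCurve_le {c : Matrix (Fin d) (Fin d) ℝ} {γ : Fin d → ℝ[X]} {N : ℕ}
    (hγ : ∀ i, (γ i).natDegree ≤ N) (i : Fin d) : (mulCurve c γ i).natDegree ≤ N :=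
  natDegree_sum_le_of_forall_le _ _ fun j _ => (natDegree_C_mul_le _ _).trans (hγ j)

theorem inner_curvePoint_mulCurve (c : Matrix (Fin d) (Fin d) ℝ) (γ : Fin d → ℝ[X])
    (x : EuclideanSpace ℝ (Fin d)) (t : ℝ) :
    inner ℝ x (curvePoint (mulCurve c γ) t)
      = inner ℝ (Matrix.toEuclideanLin c.transpose x) (curvePoint γ t) := by
  simp only [EuclideanSpace.inner_eq_star_dotProduct, curvePoint, Matrix.ofLp_toLpLin, Matrix.toLin'_apply,
    star_trivial]
  rw [dotProduct_comm, Matrix.mulVec_transpose, dotProduct_comm _ (Matrix.vecMul _ _),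
    ← Matrix.dotProduct_mulVec]
  congr 1
  ext i
  simp [mulCurve, Matrix.mulVec, dotProduct, eval_finsetSum]

theorem curveFourier_mulCurve (c : Matrix (Fin d) (Fin d) ℝ) (γ : Fin d → ℝ[X]) (f : ℝ → ℂ) :
    curveFourier (mulCurve c γ) f
      = fun x => curveFourier γ f (Matrix.toEuclideanLin c.transpose x) := by
  ext x
  simp only [curveFourier, inner_curvePoint_mulCurve]

theorem eLpNorm_curveFourier_mulCurve {c : Matrix (Fin d) (Fin d) ℝ} (hc : c.det ≠ 0)
    (γ : Fin d → ℝ[X]) {f : ℝ → ℂ} (hf : Measurable f) (q : ℝ≥0∞) :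
    eLpNorm (curveFourier (mulCurve c γ) f) q volume
      = ENNReal.ofReal |(c.det)⁻¹| ^ (1 / q).toReal * eLpNorm (curveFourier γ f) q volume := by
  have h : LinearMap.det (Matrix.toEuclideanLin c.transpose) = c.det := by
    rw [Matrix.toEuclideanLin, LinearMap.det_toLpLin, Matrix.det_transpose]
  rw [curveFourier_mulCurve, eLpNorm_comp_linearMap volume (by rw [h]; exact hc)
    (measurable_curveFourier γ hf).aestronglyMeasurable, h]

/-- The curve `s ↦ γ (a + ℓ s)`. -/
noncomputable def rescaleCurve (γ : Fin d → ℝ[X]) (a ℓ : ℝ) : Fin d → ℝ[X] :=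
  fun i => (γ i).comp (C ℓ * X + C a)

theorem curvePoint_rescaleCurve (γ : Fin d → ℝ[X]) (a ℓ s : ℝ) :
    curvePoint (rescaleCurve γ a ℓ) s = curvePoint γ (ℓ * s + a) := by
  simp [curvePoint, rescaleCurve]

theorem iterate_derivative_comp_linear (p : ℝ[X]) (a ℓ : ℝ) (j : ℕ) :
    derivative^[j] (p.comp (C ℓ * X + C a)) = C (ℓ ^ j) * (derivative^[j] p).comp (C ℓ * X + C a) := by
  induction j with
  | zero => simp
  | succ j ih =>
    rw [Function.iterate_succ_apply', ih, derivative_C_mul, derivative_comp,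
      Function.iterate_succ_apply']
    simp [pow_succ]; ring

theorem torsionMatrix_rescaleCurve (γ : Fin d → ℝ[X]) (a ℓ s : ℝ) :
    torsionMatrix (rescaleCurve γ a ℓ) s
      = torsionMatrix γ (ℓ * s + a) * Matrix.diagonal fun j : Fin d => ℓ ^ ((j : ℕ) + 1) := by
  ext i j
  rw [Matrix.mul_diagonal]
  simp only [torsionMatrix, Matrix.of_apply, rescaleCurve, iterate_derivative_comp_linear,
    eval_comp, eval_add, eval_mul, eval_C, eval_X]
  ring

theorem natDegree_rescaleCurve_le {γ : Fin d → ℝ[X]} {N : ℕ} (hγ : ∀ i, (γ i).natDegree ≤ N)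
    (a ℓ : ℝ) (i : Fin d) : (rescaleCurve γ a ℓ i).natDegree ≤ N := by
  refine natDegree_comp_le.trans ?_
  calc _ ≤ (γ i).natDegree * 1 := Nat.mul_le_mul_left _ natDegree_linear_le
    _ ≤ N := by rw [mul_one]; exact hγ i

/-- The orders of the derivatives in the torsion add up to the homogeneous dimension, which is
therefore the power of `ℓ` by which the torsion changes under `s ↦ a + ℓ s`. -/
theorem sum_fin_succ_eq_homDim (n : ℕ) : ((∑ j : Fin (n + 1), ((j : ℕ) + 1) : ℕ) : ℝ) = homDim n := by
  rw [Fin.sum_univ_eq_sum_range (fun j => j + 1) (n + 1)]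
  induction n with
  | zero => norm_num [homDim]
  | succ n ih =>
    rw [Finset.sum_range_succ, Nat.cast_add, ih, homDim, homDim]
    push_cast; ring

theorem torsion_rescaleCurve {n : ℕ} (γ : Fin (n + 1) → ℝ[X]) (a ℓ s : ℝ) :
    torsion (rescaleCurve γ a ℓ) s = torsion γ (ℓ * s + a) * ℓ ^ homDim n := by
  rw [← det_torsionMatrix, torsionMatrix_rescaleCurve, Matrix.det_mul, Matrix.det_diagonal,
    Finset.prod_pow_eq_pow_sum, ← sum_fin_succ_eq_homDim, Real.rpow_natCast, det_torsionMatrix]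

theorem curveFourier_eq_rescale (γ : Fin d → ℝ[X]) (a : ℝ) {ℓ : ℝ} (hℓ : 0 < ℓ) (f : ℝ → ℂ) :
    curveFourier γ f
      = (ℓ : ℂ) • curveFourier (rescaleCurve γ a ℓ) fun s => f (ℓ * s + a) := by
  ext x
  rw [Pi.smul_apply, smul_eq_mul, curveFourier, curveFourier]
  simp only [curvePoint_rescaleCurve]
  have h1 := Measure.integral_comp_mul_left (fun t => Complex.exp (Complex.I *
    ((inner ℝ x (curvePoint γ (t + a)) : ℝ) : ℂ)) * f (t + a)) ℓ
  rw [h1, integral_add_right_eq_self (fun t => Complex.exp (Complex.I *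
    ((inner ℝ x (curvePoint γ t) : ℝ) : ℂ)) * f t), abs_of_pos (inv_pos.2 hℓ), Complex.real_smul,
    ← mul_assoc, ← Complex.ofReal_mul, mul_inv_cancel₀ hℓ.ne', Complex.ofReal_one, one_mul]

theorem eLpNorm_comp_mul_add {f : ℝ → ℂ} (hf : Measurable f) (a : ℝ) {ℓ : ℝ} (hℓ : 0 < ℓ)
    (p : ℝ≥0∞) :
    eLpNorm (fun s => f (ℓ * s + a)) p volume
      = ENNReal.ofReal ℓ⁻¹ ^ (1 / p).toReal * eLpNorm f p volume := by
  have hdet : LinearMap.det (ℓ • LinearMap.id : ℝ →ₗ[ℝ] ℝ) = ℓ := by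
    rw [LinearMap.det_smul]; simp
  have h1 := eLpNorm_comp_linearMap (volume : Measure ℝ) (L := ℓ • LinearMap.id)
    (by rw [hdet]; exact hℓ.ne') (f := fun t => f (t + a))
    (hf.comp (measurable_add_const a)).aestronglyMeasurable p
  rw [hdet, abs_of_pos (inv_pos.2 hℓ)] at h1
  have h2 : eLpNorm (fun t => f (t + a)) p volume = eLpNorm f p volume :=
    eLpNorm_comp_measurePreserving hf.aestronglyMeasurable (measurePreserving_add_right volume a)
  rw [h2] at h1
  exact h1

theorem integrable_comp_mul_add {f : ℝ → ℂ} (hf : Integrable f) (a : ℝ) {ℓ : ℝ} (hℓ : 0 < ℓ) :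
    Integrable fun s => f (ℓ * s + a) :=
  (hf.comp_add_right a).comp_mul_left' hℓ.ne'

end AffineInvariance

section CompactIntervals

/-! ### The estimate on compact intervals -/

open Polynomial

variable {n : ℕ}

theorem one_div_critExp_toReal {w : ℝ} (hw : 0 ≤ w) : (1 / critExp n w).toReal = w / homDim n := by
  rw [critExp, one_div, inv_inv, ENNReal.toReal_ofReal (div_nonneg hw (homDim_pos n).le)]

/-- The estimate near a point `s₀` of the unit interval: the linear map normalising the
derivative matrix at `s₀` turns the curve into a good one, at the cost of a power of the torsion. -/
theorem exists_bound_near_point (hn : 1 ≤ n) (N : ℕ) (R : ℝ) {w : ℝ} (hw0 : 0 < w)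
    (hw : w < homDim n / (homDim n + 1)) :
    ∃ (δ : ℝ) (A : ℝ≥0), 0 < δ ∧ ∀ γ : Fin (n + 1) → ℝ[X], (∀ i, (γ i).natDegree ≤ N) →
      ∀ c₁ : ℝ, 0 < c₁ →
      (∀ s ∈ Set.Icc (0 : ℝ) 1, c₁ ≤ |torsion γ s| ∧ |torsion γ s| ≤ R * c₁) →
      ∀ s₀ ∈ Set.Icc (0 : ℝ) 1, ∀ f : ℝ → ℂ, Measurable f → Integrable f →
      (∀ s, s ∉ Set.Icc (0 : ℝ) 1 ∩ Metric.ball s₀ δ → f s = 0) →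
      eLpNorm (curveFourier γ f) (critExp n w) volume
        ≤ A * ENNReal.ofReal (c₁ ^ (-(w / homDim n)))
          * eLpNorm f (ENNReal.ofReal (1 - w))⁻¹ volume := by
  have hD := homDim_pos n
  obtain ⟨ε, hε0, hε⟩ := exists_detMargin n
  obtain ⟨A, hA⟩ := exists_strongBound hn hε hw0 hw
  set ε' : ℝ := min (1 / 2) (ε / 2) with hε'
  have hε'0 : 0 < ε' := lt_min (by norm_num) (by linarith)
  obtain ⟨δ, hδ0, hδ⟩ := exists_torsionMatrix_near_one (n + 1) N R hε'0
  refine ⟨δ, (((2 : ℝ) ^ (n + 1)) ^ (w / homDim n)).toNNReal * A, hδ0, ?_⟩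
  intro γ hγ c₁ hc₁ htor s₀ hs₀ f hf hfI hfS
  set P := torsionMatrix γ s₀ with hP
  have hPdet : P.det = torsion γ s₀ := rfl
  have hP0 : P.det ≠ 0 := abs_pos.1 (hc₁.trans_le (hPdet ▸ (htor s₀ hs₀).1))
  set β := mulCurve P⁻¹ γ with hβ
  have hβ1 : torsionMatrix β s₀ = 1 := by
    rw [hβ, torsionMatrix_mulCurve]
    exact Matrix.nonsing_inv_mul _ (isUnit_iff_ne_zero.2 hP0)
  have hβR : ∀ u ∈ Set.Icc (0 : ℝ) 1, |torsion β u| ≤ R := by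
    intro u hu
    rw [← det_torsionMatrix, hβ, torsionMatrix_mulCurve, Matrix.det_mul, Matrix.det_nonsing_inv,
      Ring.inverse_eq_inv', det_torsionMatrix, det_torsionMatrix, abs_mul, abs_inv,
      inv_mul_le_iff₀ (hc₁.trans_le (htor s₀ hs₀).1)]
    have hR0 : 0 ≤ R := by
      have := (htor s₀ hs₀).1.trans (htor s₀ hs₀).2
      nlinarith
    have := mul_le_mul_of_nonneg_left (htor s₀ hs₀).1 hR0
    linarith [(htor u hu).2]
  have hnear := fun s hs hss => hδ β (natDegree_mulCurve_le hγ) s₀ hs₀ s hs hss hβ1 hβR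
  -- the factor `2` makes room for the lower bound `1` of the diagonal entries
  set η := mulCurve (Matrix.diagonal fun _ => (2 : ℝ)) β with hη
  have hηe : ∀ s i j, (derivative^[((j : Fin (n + 1)) : ℕ) + 1] (η i)).eval s
      = 2 * torsionMatrix β s i j := by
    intro s i j
    have h1 : torsionMatrix η s i j = 2 * torsionMatrix β s i j := by
      rw [hη, torsionMatrix_mulCurve, Matrix.diagonal_mul]
    exact h1
  have hgood : GoodCurve ε η (Set.Icc (0 : ℝ) 1 ∩ Metric.ball s₀ δ) := by
    have hdiag : ∀ i, ∀ t ∈ Set.Icc (0 : ℝ) 1 ∩ Metric.ball s₀ δ,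
        1 ≤ (derivative^[((i : Fin (n + 1)) : ℕ) + 1] (η i)).eval t := by
      intro i t ht
      have h1 := hnear t ht.1 ht.2 i i
      rw [Matrix.one_apply_eq] at h1
      rw [hηe]
      have h2 := (abs_lt.1 h1).1
      have h3 : ε' ≤ 1 / 2 := min_le_left _ _
      linarith
    refine ⟨hdiag, fun i j hij s hs t ht => ?_⟩
    have h1 := hnear s hs.1 hs.2 i j
    rw [Matrix.one_apply_ne hij, sub_zero] at h1
    have h2 := hdiag i t ht
    rw [hηe, abs_mul, abs_two]
    have h3 : ε' ≤ ε / 2 := min_le_right _ _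
    nlinarith
  have hS : (Set.Icc (0 : ℝ) 1 ∩ Metric.ball s₀ δ).OrdConnected := by
    rw [Real.ball_eq_Ioo]
    exact Set.ordConnected_Icc.inter Set.ordConnected_Ioo
  have hmain := hA η _ hS hgood f hf hfI hfS
  set c : Matrix (Fin (n + 1)) (Fin (n + 1)) ℝ := P * Matrix.diagonal fun _ => (1 / 2 : ℝ) with hc
  have hcη : mulCurve c η = γ := by
    rw [hη, hβ, mulCurve_mulCurve, mulCurve_mulCurve, hc, Matrix.mul_assoc P,
      Matrix.diagonal_mul_diagonal]
    norm_num
    rw [Matrix.mul_nonsing_inv _ (isUnit_iff_ne_zero.2 hP0), mulCurve_one]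
  have hcdet : c.det = P.det * (1 / 2) ^ (n + 1) := by
    rw [hc, Matrix.det_mul, Matrix.det_diagonal]; simp
  have hc0 : c.det ≠ 0 := by rw [hcdet]; exact mul_ne_zero hP0 (by positivity)
  rw [← hcη, eLpNorm_curveFourier_mulCurve hc0 η hf, one_div_critExp_toReal hw0.le]
  have hfac : ENNReal.ofReal |(c.det)⁻¹| ^ (w / homDim n)
      ≤ ENNReal.ofReal (((2 : ℝ) ^ (n + 1)) ^ (w / homDim n))
        * ENNReal.ofReal (c₁ ^ (-(w / homDim n))) := by
    have hpos : 0 < w / homDim n := by positivity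
    rw [ENNReal.ofReal_rpow_of_nonneg (abs_nonneg _) hpos.le, ← ENNReal.ofReal_mul (by positivity)]
    refine ENNReal.ofReal_le_ofReal ?_
    rw [Real.rpow_neg hc₁.le, ← Real.inv_rpow hc₁.le, ← Real.mul_rpow (by positivity)
      (by positivity)]
    refine Real.rpow_le_rpow (abs_nonneg _) ?_ hpos.le
    rw [hcdet, mul_inv, abs_mul, abs_inv, hPdet, mul_comm]
    have : |((1 / 2 : ℝ) ^ (n + 1))⁻¹| = 2 ^ (n + 1) := by
      rw [abs_of_pos (by positivity), one_div, inv_pow, inv_inv]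
    rw [this]
    gcongr
    exact (htor s₀ hs₀).1
  calc _ ≤ (ENNReal.ofReal (((2 : ℝ) ^ (n + 1)) ^ (w / homDim n))
        * ENNReal.ofReal (c₁ ^ (-(w / homDim n)))) *
        (A * eLpNorm f (ENNReal.ofReal (1 - w))⁻¹ volume) := by gcongr
    _ = _ := by
      rw [ENNReal.coe_mul]
      change _ = ENNReal.ofReal _ * _ * _ * _
      ring

/-- The unit interval is covered by boundedly many intervals on which the local estimate holds. -/
theorem exists_bound_unit_interval (hn : 1 ≤ n) (N : ℕ) (R : ℝ) {w : ℝ} (hw0 : 0 < w)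
    (hw : w < homDim n / (homDim n + 1)) :
    ∃ A : ℝ≥0, ∀ γ : Fin (n + 1) → ℝ[X], (∀ i, (γ i).natDegree ≤ N) →
      ∀ c₁ : ℝ, 0 < c₁ →
      (∀ s ∈ Set.Icc (0 : ℝ) 1, c₁ ≤ |torsion γ s| ∧ |torsion γ s| ≤ R * c₁) →
      ∀ f : ℝ → ℂ, Measurable f → Integrable f → (∀ s ∉ Set.Icc (0 : ℝ) 1, f s = 0) →
      eLpNorm (curveFourier γ f) (critExp n w) volume
        ≤ A * ENNReal.ofReal (c₁ ^ (-(w / homDim n)))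
          * eLpNorm f (ENNReal.ofReal (1 - w))⁻¹ volume := by
  have hD := homDim_pos n
  obtain ⟨δ, A, hδ, hA⟩ := exists_bound_near_point hn N R hw0 hw
  obtain ⟨K, hK⟩ := exists_nat_gt (1 / δ)
  have hK0 : (0 : ℝ) < K := (by positivity : 0 < 1 / δ).trans hK
  have hKδ : 1 / (K : ℝ) < δ := by
    rw [div_lt_iff₀ hδ] at hK
    rw [div_lt_iff₀ hK0]; linarith
  refine ⟨(K + 1 : ℕ) * A, fun γ hγ c₁ hc₁ htor f hf hfI hfS => ?_⟩
  set T : ℕ → Set ℝ := fun k => Set.Ico ((k : ℝ) / K) ((k + 1) / K) with hT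
  have hTm : ∀ k, MeasurableSet (T k) := fun k => measurableSet_Ico
  have hTfloor : ∀ k s, s ∈ T k ↔ (0 ≤ s ∧ ⌊s * K⌋₊ = k) := by
    intro k s
    constructor
    · rintro ⟨h1, h2⟩
      have h0 : 0 ≤ s := le_trans (by positivity) h1
      refine ⟨h0, (Nat.floor_eq_iff (by positivity)).2 ⟨?_, ?_⟩⟩
      · exact (div_le_iff₀ hK0).1 h1
      · exact (lt_div_iff₀ hK0).1 h2
    · rintro ⟨h0, h1⟩
      obtain ⟨h2, h3⟩ := (Nat.floor_eq_iff (by positivity)).1 h1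
      exact ⟨(div_le_iff₀ hK0).2 h2, (lt_div_iff₀ hK0).2 h3⟩
  have hfsum : ∀ s, f s = ∑ k ∈ Finset.range (K + 1), (T k).indicator f s := by
    intro s
    by_cases hs : s ∈ Set.Icc (0 : ℝ) 1
    · rw [Finset.sum_eq_single ⌊s * K⌋₊]
      · exact (Set.indicator_of_mem ((hTfloor _ _).2 ⟨hs.1, rfl⟩) f).symm
      · intro k _ hk
        exact Set.indicator_of_notMem (fun h => hk ((hTfloor _ _).1 h).2.symm) f
      · intro hcon
        refine absurd (Finset.mem_range.2 (Nat.lt_succ_of_le ?_)) hcon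
        exact Nat.floor_le_of_le (by nlinarith [hs.2])
    · rw [Finset.sum_eq_zero]
      · exact hfS s hs
      · intro k _
        exact Set.indicator_apply_eq_zero.2 fun _ => hfS s hs
  have hsum : curveFourier γ f
      = ∑ k ∈ Finset.range (K + 1), curveFourier γ ((T k).indicator f) := by
    ext x
    rw [Finset.sum_apply]
    simp only [curveFourier]
    rw [← integral_finsetSum _ fun k _ => integrable_exp_mul (hfI.indicator (hTm k))
      (measurable_inner_curvePoint γ x)]
    congr 1
    ext s
    rw [← Finset.mul_sum, ← hfsum]
  have hone : 1 ≤ critExp n w := by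
    rw [critExp, ENNReal.one_le_inv]
    refine ENNReal.ofReal_le_one.2 ((div_le_one hD).2 ?_)
    have h1 : homDim n / (homDim n + 1) ≤ homDim n := div_le_self hD.le (by linarith)
    linarith
  rw [hsum]
  refine (eLpNorm_sum_le (fun k _ =>
    (measurable_curveFourier γ (hf.indicator (hTm k))).aestronglyMeasurable) hone).trans ?_
  have hterm : ∀ k ∈ Finset.range (K + 1), eLpNorm (curveFourier γ ((T k).indicator f))
      (critExp n w) volume ≤ A * ENNReal.ofReal (c₁ ^ (-(w / homDim n)))
        * eLpNorm f (ENNReal.ofReal (1 - w))⁻¹ volume := by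
    intro k hk
    have hkK : (k : ℝ) ≤ K := by exact_mod_cast Nat.lt_succ_iff.1 (Finset.mem_range.1 hk)
    refine (hA γ hγ c₁ hc₁ htor ((k : ℝ) / K) ⟨by positivity, (div_le_one hK0).2 hkK⟩ _
      (hf.indicator (hTm k)) (hfI.indicator (hTm k)) fun s hs => ?_).trans ?_
    · refine Set.indicator_apply_eq_zero.2 fun hsT => hfS s fun hsI => hs ⟨hsI, ?_⟩
      rw [Metric.mem_ball, Real.dist_eq, abs_of_nonneg (sub_nonneg.2 hsT.1)]
      have h2 := hsT.2
      rw [add_div] at h2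
      linarith
    · gcongr
      exact eLpNorm_indicator_le f
  refine (Finset.sum_le_card_nsmul _ _ _ hterm).trans (le_of_eq ?_)
  rw [Finset.card_range, nsmul_eq_mul]
  push_cast
  ring

/-- The estimate is invariant under affine changes of the parameter, so the unit interval can be
replaced by any compact interval without a change of the constant. -/
theorem exists_bound_compact_interval (hn : 1 ≤ n) (N : ℕ) (R : ℝ) {w : ℝ} (hw0 : 0 < w)
    (hw : w < homDim n / (homDim n + 1)) :
    ∃ A : ℝ≥0, ∀ γ : Fin (n + 1) → ℝ[X], (∀ i, (γ i).natDegree ≤ N) →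
      ∀ C₁ : ℝ, 0 < C₁ → ∀ a b : ℝ, a < b →
      (∀ t ∈ Set.Icc a b, C₁ ≤ |torsion γ t| ∧ |torsion γ t| ≤ R * C₁) →
      ∀ f : ℝ → ℂ, Measurable f → Integrable f → (∀ t ∉ Set.Icc a b, f t = 0) →
      eLpNorm (curveFourier γ f) (critExp n w) volume
        ≤ A * ENNReal.ofReal (C₁ ^ (-(w / homDim n)))
          * eLpNorm f (ENNReal.ofReal (1 - w))⁻¹ volume := by
  have hD := homDim_pos n
  have hw1 : w < 1 := hw.trans ((div_lt_one (by linarith)).2 (by linarith))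
  obtain ⟨A, hA⟩ := exists_bound_unit_interval hn N R hw0 hw
  refine ⟨A, fun γ hγ C₁ hC₁ a b hab htor f hf hfI hfS => ?_⟩
  set ℓ : ℝ := b - a with hℓ
  have hℓ0 : 0 < ℓ := sub_pos.2 hab
  have hℓD : 0 < ℓ ^ homDim n := Real.rpow_pos_of_pos hℓ0 _
  have hIcc : ∀ s : ℝ, ℓ * s + a ∈ Set.Icc a b ↔ s ∈ Set.Icc (0 : ℝ) 1 := by
    intro s
    constructor
    · rintro ⟨h1, h2⟩
      constructor
      · by_contra hcon; nlinarith
      · by_contra hcon; nlinarith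
    · rintro ⟨h1, h2⟩
      constructor <;> nlinarith
  have h1 := hA (rescaleCurve γ a ℓ) (natDegree_rescaleCurve_le hγ a ℓ) (C₁ * ℓ ^ homDim n)
    (by positivity) (fun s hs => by
      rw [torsion_rescaleCurve, abs_mul, abs_of_pos hℓD, ← mul_assoc]
      have := htor _ ((hIcc s).2 hs)
      exact ⟨mul_le_mul_of_nonneg_right this.1 hℓD.le, mul_le_mul_of_nonneg_right this.2 hℓD.le⟩)
    (fun s => f (ℓ * s + a)) (hf.comp (by fun_prop)) (integrable_comp_mul_add hfI a hℓ0)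
    fun s hs => hfS _ fun h => hs ((hIcc s).1 h)
  rw [curveFourier_eq_rescale γ a hℓ0, eLpNorm_const_smul]
  have hnorm : ‖(ℓ : ℂ)‖ₑ = ENNReal.ofReal ℓ := by
    rw [← ofReal_norm, Complex.norm_real, Real.norm_of_nonneg hℓ0.le]
  rw [eLpNorm_comp_mul_add hf a hℓ0, one_div, inv_inv,
    ENNReal.toReal_ofReal (by linarith)] at h1
  rw [hnorm]
  -- the powers of `ℓ` from the change of variables, the torsion and the norm of `f` cancel
  have hscale : ENNReal.ofReal ℓ * (ENNReal.ofReal ((C₁ * ℓ ^ homDim n) ^ (-(w / homDim n)))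
      * ENNReal.ofReal ℓ⁻¹ ^ (1 - w)) = ENNReal.ofReal (C₁ ^ (-(w / homDim n))) := by
    rw [ENNReal.ofReal_rpow_of_pos (by positivity), ← ENNReal.ofReal_mul (by positivity),
      ← ENNReal.ofReal_mul hℓ0.le]
    congr 1
    rw [Real.mul_rpow hC₁.le hℓD.le, ← Real.rpow_mul hℓ0.le, Real.inv_rpow hℓ0.le,
      ← Real.rpow_neg hℓ0.le]
    have h2 : homDim n * -(w / homDim n) = -w := by field_simp
    rw [h2]
    have h3 : ℓ * (ℓ ^ (-w) * ℓ ^ (-(1 - w))) = 1 := by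
      have h4 : -w + -(1 - w) = -1 := by ring
      rw [← Real.rpow_add hℓ0, h4, Real.rpow_neg_one, mul_inv_cancel₀ hℓ0.ne']
    calc _ = C₁ ^ (-(w / homDim n)) * (ℓ * (ℓ ^ (-w) * ℓ ^ (-(1 - w)))) := by ring
      _ = _ := by rw [h3, mul_one]
  calc _ ≤ ENNReal.ofReal ℓ * (A * ENNReal.ofReal ((C₁ * ℓ ^ homDim n) ^ (-(w / homDim n)))
        * (ENNReal.ofReal ℓ⁻¹ ^ (1 - w) * eLpNorm f (ENNReal.ofReal (1 - w))⁻¹ volume)) := by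
        gcongr
    _ = A * (ENNReal.ofReal ℓ * (ENNReal.ofReal ((C₁ * ℓ ^ homDim n) ^ (-(w / homDim n)))
        * ENNReal.ofReal ℓ⁻¹ ^ (1 - w))) * eLpNorm f (ENNReal.ofReal (1 - w))⁻¹ volume := by ring
    _ = _ := by rw [hscale]

end CompactIntervals

section GeneralIntervals

/-! ### Arbitrary intervals -/

open Polynomial

variable {n : ℕ}

theorem continuous_torsion {d : ℕ} (γ : Fin d → ℝ[X]) : Continuous (torsion γ) :=
  Continuous.matrix_det (continuous_pi fun _ => continuous_pi fun _ => Polynomial.continuous _)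

theorem curveFourier_congr_ae {d : ℕ} (γ : Fin d → ℝ[X]) {f g : ℝ → ℂ} (h : f =ᵐ[volume] g) :
    curveFourier γ f = curveFourier γ g := by
  ext x
  refine integral_congr_ae ?_
  filter_upwards [h] with t ht
  rw [ht]

/-- The bounds for the torsion pass to the closure of a bounded interval. -/
theorem exists_compact_interval_of_isBounded {J : Set ℝ} (hJ : J.OrdConnected)
    (hJb : Bornology.IsBounded J) (hJ0 : J.Nonempty) {φ : ℝ → ℝ} (hφ : Continuous φ) {c C : ℝ}
    (h : ∀ t ∈ J, c ≤ φ t ∧ φ t ≤ C) :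
    ∃ a b : ℝ, J ⊆ Set.Icc a b ∧ ∀ t ∈ Set.Icc a b, c ≤ φ t ∧ φ t ≤ C := by
  have hcl : ∀ t ∈ closure J, c ≤ φ t ∧ φ t ≤ C := by
    have hclosed : IsClosed {t | c ≤ φ t ∧ φ t ≤ C} :=
      (isClosed_le continuous_const hφ).inter (isClosed_le hφ continuous_const)
    exact fun t ht => closure_minimal (s := J) h hclosed ht
  have hb := hJb.bddBelow
  have ha := hJb.bddAbove
  refine ⟨sInf J, sSup J, fun t ht => ⟨csInf_le hb ht, le_csSup ha ht⟩, fun t ht => ?_⟩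
  rcases ht.1.eq_or_lt with h1 | h1
  · exact hcl t (h1 ▸ csInf_mem_closure hJ0 hb)
  rcases ht.2.eq_or_lt with h2 | h2
  · exact hcl t (h2 ▸ csSup_mem_closure hJ0 ha)
  obtain ⟨x, hx, hxt⟩ := exists_lt_of_csInf_lt hJ0 h1
  obtain ⟨y, hy, hty⟩ := exists_lt_of_lt_csSup hJ0 h2
  exact h t (hJ.out hx hy ⟨hxt.le, hty.le⟩)

/-- An arbitrary interval is exhausted by bounded ones, and the bound passes to the limit by Fatou's
lemma. For `w = 0` the estimate is the trivial `L¹ → L^∞` bound. -/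
theorem exists_bound_interval (hn : 1 ≤ n) (N : ℕ) (R : ℝ) {w : ℝ} (hw0 : 0 ≤ w)
    (hw : w < homDim n / (homDim n + 1)) :
    ∃ A : ℝ≥0, ∀ γ : Fin (n + 1) → ℝ[X], (∀ i, (γ i).natDegree ≤ N) →
      ∀ C₁ : ℝ, 0 < C₁ → ∀ I : Set ℝ, I.OrdConnected →
      (∀ t ∈ I, C₁ ≤ |torsion γ t| ∧ |torsion γ t| ≤ R * C₁) →
      ∀ f : ℝ → ℂ, Measurable f → Integrable f → (∀ t ∉ I, f t = 0) →
      eLpNorm (curveFourier γ f) (critExp n w) volume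
        ≤ A * ENNReal.ofReal (C₁ ^ (-(w / homDim n)))
          * eLpNorm f (ENNReal.ofReal (1 - w))⁻¹ volume := by
  rcases hw0.eq_or_lt with rfl | hw0
  · -- the trivial bound
    refine ⟨1, fun γ _ C₁ _ I _ _ f _ _ _ => ?_⟩
    rw [critExp_zero, eLpNorm_exponent_top]
    refine eLpNormEssSup_le_of_ae_enorm_bound (Filter.Eventually.of_forall fun x => ?_)
    refine (enorm_curveFourier_le γ f x).trans (le_of_eq ?_)
    simp [eLpNorm_one_eq_lintegral_enorm]
  obtain ⟨A, hA⟩ := exists_bound_compact_interval hn N R hw0 hw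
  refine ⟨A, fun γ hγ C₁ hC₁ I hI htor f hf hfI hfS => ?_⟩
  have hm : ∀ M : ℕ, MeasurableSet (Set.Icc (-(M : ℝ)) M) := fun M => measurableSet_Icc
  have hbdd : ∀ M : ℕ, eLpNorm (curveFourier γ ((Set.Icc (-(M : ℝ)) M).indicator f))
      (critExp n w) volume ≤ A * ENNReal.ofReal (C₁ ^ (-(w / homDim n)))
          * eLpNorm f (ENNReal.ofReal (1 - w))⁻¹ volume := by
    intro M
    have hzero : ∀ {g : ℝ → ℂ}, g =ᵐ[volume] 0 → eLpNorm (curveFourier γ g) (critExp n w) volume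
        ≤ A * ENNReal.ofReal (C₁ ^ (-(w / homDim n)))
          * eLpNorm f (ENNReal.ofReal (1 - w))⁻¹ volume := by
      intro g hg
      rw [curveFourier_congr_ae γ hg]
      have : curveFourier γ (0 : ℝ → ℂ) = 0 := by ext x; simp [curveFourier]
      rw [this, eLpNorm_zero]
      exact zero_le
    set J := I ∩ Set.Icc (-(M : ℝ)) M with hJ
    have hgJ : ∀ t ∉ J, (Set.Icc (-(M : ℝ)) M).indicator f t = 0 := fun t ht =>
      Set.indicator_apply_eq_zero.2 fun h => hfS t fun h' => ht ⟨h', h⟩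
    rcases J.eq_empty_or_nonempty with hJe | hJ0
    · refine hzero (Filter.Eventually.of_forall fun t => hgJ t ?_)
      rw [hJe]; simp
    obtain ⟨a, b, hJab, hab⟩ := exists_compact_interval_of_isBounded (hI.inter Set.ordConnected_Icc)
      ((Metric.isBounded_Icc _ _).subset Set.inter_subset_right) hJ0 (continuous_torsion γ).abs
      fun t ht => htor t ht.1
    rcases lt_or_ge a b with hlt | hge
    · refine (hA γ hγ C₁ hC₁ a b hlt hab _ (hf.indicator (hm M)) (hfI.indicator (hm M))
        fun t ht => hgJ t fun h => ht (hJab h)).trans ?_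
      gcongr
      exact eLpNorm_indicator_le f
    · refine hzero ?_
      have hne : ∀ᵐ t : ℝ, t ≠ a := by
        rw [ae_iff]; simp
      filter_upwards [hne] with t ht
      refine hgJ t fun h => ht ?_
      have := hJab h
      exact le_antisymm (this.2.trans hge) this.1
  refine Lp.eLpNorm_le_of_ae_tendsto (u := Filter.atTop) (Filter.Eventually.of_forall hbdd)
    (fun M => (measurable_curveFourier γ (hf.indicator (hm M))).aestronglyMeasurable)
    (Filter.Eventually.of_forall fun x => tendsto_curveFourier γ hfI
      (fun M => (hf.indicator (hm M)).aestronglyMeasurable)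
      (fun M t => norm_indicator_le_norm_self _ _) (fun t => ?_) x)
  refine tendsto_const_nhds.congr' ?_
  filter_upwards [Filter.eventually_ge_atTop ⌈|t|⌉₊] with M hM
  have h1 : |t| ≤ M := (Nat.le_ceil _).trans (by exact_mod_cast hM)
  exact (Set.indicator_of_mem (Set.mem_Icc.2 (abs_le.1 h1)) f).symm

end GeneralIntervals

section AffineArclength

/-! ### The affine arclength measure -/

variable {n : ℕ}

/-- The density `|L_γ|^{2 / (d (d + 1))}` of the affine arclength measure. -/
noncomputable def arclengthDensity {d : ℕ} (γ : Fin d → ℝ[X]) (t : ℝ) : ℝ :=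
  |torsion γ t| ^ ((2 : ℝ) / ((d : ℝ) * ((d : ℝ) + 1)))

theorem arclengthDensity_nonneg {d : ℕ} (γ : Fin d → ℝ[X]) (t : ℝ) : 0 ≤ arclengthDensity γ t :=
  Real.rpow_nonneg (abs_nonneg _) _

theorem measurable_arclengthDensity {d : ℕ} (γ : Fin d → ℝ[X]) :
    Measurable (arclengthDensity γ) := (continuous_torsion γ).abs.measurable.pow_const _

theorem affineArclength_eq {d : ℕ} (γ : Fin d → ℝ[X]) :
    affineArclength γ = volume.withDensity fun t => ENNReal.ofReal (arclengthDensity γ t) := rfl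

theorem arclengthDensity_le (γ : Fin (n + 1) → ℝ[X]) {t C₂ : ℝ} (h : |torsion γ t| ≤ C₂) :
    arclengthDensity γ t ≤ C₂ ^ (1 / homDim n) := by
  have h1 : (2 : ℝ) / (((n + 1 : ℕ) : ℝ) * (((n + 1 : ℕ) : ℝ) + 1)) = 1 / homDim n := by
    rw [homDim]; push_cast; field_simp; ring
  rw [arclengthDensity, h1]
  exact Real.rpow_le_rpow (abs_nonneg _) h (one_div_nonneg.2 (homDim_pos n).le)

theorem integrable_affineArclength_iff {d : ℕ} (γ : Fin d → ℝ[X]) {f : ℝ → ℂ} :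
    Integrable f (affineArclength γ) ↔ Integrable fun t => (arclengthDensity γ t : ℂ) * f t := by
  rw [affineArclength_eq, integrable_withDensity_iff_integrable_smul'
    (measurable_arclengthDensity γ).ennreal_ofReal (by simp)]
  simp only [ENNReal.toReal_ofReal (arclengthDensity_nonneg γ _), Complex.real_smul]

theorem extensionOp_eq_curveFourier {d : ℕ} (γ : Fin d → ℝ[X]) (f : ℝ → ℂ) :
    extensionOp γ f = curveFourier γ fun t => (arclengthDensity γ t : ℂ) * f t := by
  ext x
  rw [extensionOp, curveFourier, affineArclength_eq, integral_withDensity_eq_integral_toReal_smul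
    (measurable_arclengthDensity γ).ennreal_ofReal (by simp)]
  congr 1
  ext t
  rw [ENNReal.toReal_ofReal (arclengthDensity_nonneg γ _), Complex.real_smul]
  ring

/-- Passage between the `L^p` norms for Lebesgue measure and for `λ dt`: since `p w = p - 1`, the
power `λ ^ p` exceeds the density `λ` by the factor `λ ^ (p w) ≤ M ^ (p w)`. -/
theorem eLpNorm_density_mul_indicator_le {d : ℕ} (γ : Fin d → ℝ[X]) {I : Set ℝ}
    {M : ℝ} (hM0 : 0 ≤ M) (hM : ∀ t ∈ I, arclengthDensity γ t ≤ M)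
    (f : ℝ → ℂ) {w : ℝ} (hw0 : 0 ≤ w) (hw1 : w < 1) :
    eLpNorm (fun t => (arclengthDensity γ t : ℂ) * I.indicator f t) (ENNReal.ofReal (1 - w))⁻¹ volume
      ≤ ENNReal.ofReal (M ^ w) * eLpNorm f (ENNReal.ofReal (1 - w))⁻¹ (affineArclength γ) := by
  have hw1' : 0 < 1 - w := by linarith
  set r : ℝ := (1 - w)⁻¹ with hr
  have hr0 : 0 < r := by positivity
  have hr1 : 0 ≤ r - 1 := by
    rw [hr, sub_nonneg, one_le_inv₀ hw1']; linarith
  have hrw : (r - 1) * (1 / r) = w := by rw [hr]; field_simp; ring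
  rw [← ENNReal.ofReal_inv_of_pos hw1', ← hr,
    eLpNorm_eq_lintegral_rpow_enorm_toReal (by simpa using hr0) ENNReal.ofReal_ne_top,
    eLpNorm_eq_lintegral_rpow_enorm_toReal (by simpa using hr0) ENNReal.ofReal_ne_top,
    ENNReal.toReal_ofReal hr0.le, ← hrw, Real.rpow_mul hM0,
    ← ENNReal.ofReal_rpow_of_nonneg (by positivity) (by positivity),
    ← ENNReal.mul_rpow_of_nonneg _ _ (by positivity : (0 : ℝ) ≤ 1 / r)]
  refine ENNReal.rpow_le_rpow ?_ (by positivity)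
  rw [affineArclength_eq, lintegral_withDensity_eq_lintegral_mul_non_measurable _
    (measurable_arclengthDensity γ).ennreal_ofReal (by simp),
    ← lintegral_const_mul' _ _ ENNReal.ofReal_ne_top]
  refine lintegral_mono fun t => ?_
  by_cases ht : t ∈ I
  · have h0 := arclengthDensity_nonneg γ t
    have h1 : ‖(arclengthDensity γ t : ℂ)‖ₑ = ENNReal.ofReal (arclengthDensity γ t) := by
      rw [← ofReal_norm, Complex.norm_real, Real.norm_of_nonneg h0]
    rw [Set.indicator_of_mem ht, enorm_mul, h1, ENNReal.mul_rpow_of_nonneg _ _ hr0.le,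
      Pi.mul_apply, ← mul_assoc]
    gcongr
    rw [ENNReal.ofReal_rpow_of_nonneg h0 hr0.le, ← ENNReal.ofReal_mul (by positivity)]
    refine ENNReal.ofReal_le_ofReal ?_
    calc arclengthDensity γ t ^ r = arclengthDensity γ t ^ (r - 1) * arclengthDensity γ t := by
          rw [← Real.rpow_add_one' h0 (by linarith), sub_add_cancel]
      _ ≤ _ := by gcongr; exact hM t ht
  · rw [Set.indicator_of_notMem ht, mul_zero, enorm_zero, ENNReal.zero_rpow_of_pos hr0]
    exact zero_le

/-- The extension estimate for the affine arclength measure, whenever the integral converges. The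
power of the lower bound `C₁` of the torsion in the estimate for Lebesgue measure and the power of the
upper bound `C₂` that comes from the density combine to a power of `C₂ / C₁`. -/
theorem exists_extensionOp_bound (hn : 1 ≤ n) (N : ℕ) {w : ℝ} (hw0 : 0 ≤ w)
    (hw : w < homDim n / (homDim n + 1)) :
    ∃ C : ℝ → ℝ≥0, ∀ C₁ C₂ : ℝ, 0 < C₁ → ∀ I : Set ℝ, I.OrdConnected →
      ∀ γ : Fin (n + 1) → ℝ[X], (∀ i, (γ i).natDegree ≤ N) →
      (∀ t ∈ I, C₁ ≤ |torsion γ t| ∧ |torsion γ t| ≤ C₂) →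
      ∀ f : ℝ → ℂ, Integrable (I.indicator f) (affineArclength γ) →
        AEStronglyMeasurable (extensionOp γ (I.indicator f)) volume ∧
        eLpNorm (extensionOp γ (I.indicator f)) (critExp n w) volume
          ≤ C (C₂ / C₁) * eLpNorm f (ENNReal.ofReal (1 - w))⁻¹ (affineArclength γ) := by
  have hD := homDim_pos n
  have hw1 : w < 1 := hw.trans ((div_lt_one (by linarith)).2 (by linarith))
  choose A hA using fun R => exists_bound_interval hn N R hw0 hw
  refine ⟨fun R => A R * (R ^ (w / homDim n)).toNNReal, ?_⟩
  intro C₁ C₂ hC₁ I hI γ hγ htor f hfI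
  have hIm : MeasurableSet I := hI.measurableSet
  set h : ℝ → ℂ := fun t => (arclengthDensity γ t : ℂ) * I.indicator f t with hh
  have hhI : Integrable h := (integrable_affineArclength_iff γ).1 hfI
  -- a measurable representative that still vanishes off `I`
  set h' : ℝ → ℂ := I.indicator (hhI.1.mk h) with hh'
  have hh'm : Measurable h' := hhI.1.stronglyMeasurable_mk.measurable.indicator hIm
  have hae : h =ᵐ[volume] h' := by
    filter_upwards [hhI.1.ae_eq_mk] with t ht
    by_cases htI : t ∈ I
    · rw [hh', Set.indicator_of_mem htI]; exact ht
    · simp [hh, hh', htI]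
  have hE : extensionOp γ (I.indicator f) = curveFourier γ h' := by
    rw [extensionOp_eq_curveFourier]
    exact curveFourier_congr_ae γ hae
  rw [hE]
  refine ⟨(measurable_curveFourier γ hh'm).aestronglyMeasurable, ?_⟩
  rcases I.eq_empty_or_nonempty with hIe | ⟨t₀, ht₀⟩
  · have h0 : h' = 0 := by rw [hh', hIe, Set.indicator_empty]; rfl
    have : curveFourier γ h' = 0 := by ext x; simp [h0, curveFourier]
    rw [this, eLpNorm_zero]
    exact zero_le
  have hC₂ : 0 < C₂ := hC₁.trans_le ((htor t₀ ht₀).1.trans (htor t₀ ht₀).2)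
  have hRC : C₂ / C₁ * C₁ = C₂ := div_mul_cancel₀ _ hC₁.ne'
  have h1 := hA (C₂ / C₁) γ hγ C₁ hC₁ I hI (by rw [hRC]; exact htor) h' hh'm (hhI.congr hae)
    fun t ht => Set.indicator_of_notMem ht _
  refine h1.trans ?_
  rw [← eLpNorm_congr_ae hae]
  have h2 := eLpNorm_density_mul_indicator_le γ (I := I) (M := C₂ ^ (1 / homDim n)) (by positivity)
    (fun t ht => arclengthDensity_le γ (htor t ht).2) f hw0 hw1
  have h3 : ENNReal.ofReal (C₁ ^ (-(w / homDim n))) * ENNReal.ofReal ((C₂ ^ (1 / homDim n)) ^ w)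
      = ENNReal.ofReal ((C₂ / C₁) ^ (w / homDim n)) := by
    rw [← ENNReal.ofReal_mul (by positivity), ← Real.rpow_mul hC₂.le, Real.div_rpow hC₂.le hC₁.le,
      Real.rpow_neg hC₁.le, one_div_mul_eq_div]
    congr 1
    field_simp
  calc _ ≤ A (C₂ / C₁) * ENNReal.ofReal (C₁ ^ (-(w / homDim n)))
        * (ENNReal.ofReal ((C₂ ^ (1 / homDim n)) ^ w)
          * eLpNorm f (ENNReal.ofReal (1 - w))⁻¹ (affineArclength γ)) := by gcongr
    _ = A (C₂ / C₁) * (ENNReal.ofReal (C₁ ^ (-(w / homDim n)))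
        * ENNReal.ofReal ((C₂ ^ (1 / homDim n)) ^ w))
          * eLpNorm f (ENNReal.ofReal (1 - w))⁻¹ (affineArclength γ) := by ring
    _ = _ := by rw [h3, ENNReal.coe_mul]; rfl

/-- A bounded interval on which the torsion is bounded has finite affine arclength. -/
theorem integrable_indicator_of_isBounded (γ : Fin (n + 1) → ℝ[X]) {I : Set ℝ} (hI : I.OrdConnected)
    (hIb : Bornology.IsBounded I) {C₂ : ℝ} (htor : ∀ t ∈ I, |torsion γ t| ≤ C₂) {p : ℝ≥0∞}
    (hp : 1 ≤ p) {f : ℝ → ℂ} (hf : MemLp f p (affineArclength γ)) :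
    Integrable (I.indicator f) (affineArclength γ) := by
  have hIm : MeasurableSet I := hI.measurableSet
  have hfin : affineArclength γ I < ⊤ := by
    rw [affineArclength_eq, withDensity_apply _ hIm]
    refine (setLIntegral_mono' (g := fun _ => ENNReal.ofReal (C₂ ^ (1 / homDim n))) hIm
      fun t ht => ENNReal.ofReal_le_ofReal (arclengthDensity_le γ (htor t ht))).trans_lt ?_
    rw [setLIntegral_const]
    exact ENNReal.mul_lt_top ENNReal.ofReal_lt_top hIb.measure_lt_top
  have : IsFiniteMeasure ((affineArclength γ).restrict I) := ⟨by simpa using hfin⟩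
  rw [integrable_indicator_iff hIm]
  exact memLp_one_iff_integrable.1 ((hf.restrict I).mono_exponent hp)

theorem extensionOp_congr_ae {d : ℕ} (γ : Fin d → ℝ[X]) {f g : ℝ → ℂ}
    (h : f =ᵐ[affineArclength γ] g) : extensionOp γ f = extensionOp γ g := by
  ext x
  refine integral_congr_ae ?_
  filter_upwards [h] with t ht
  rw [ht]

theorem extensionOp_add {d : ℕ} (γ : Fin d → ℝ[X]) {f g : ℝ → ℂ}
    (hf : Integrable f (affineArclength γ)) (hg : Integrable g (affineArclength γ)) :
    extensionOp γ (f + g) = extensionOp γ f + extensionOp γ g := by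
  ext x
  rw [Pi.add_apply, extensionOp, extensionOp, extensionOp,
    ← integral_add (integrable_exp_mul hf (measurable_inner_curvePoint γ x))
      (integrable_exp_mul hg (measurable_inner_curvePoint γ x))]
  congr 1
  ext t
  rw [Pi.add_apply, mul_add]

theorem extensionOp_smul {d : ℕ} (γ : Fin d → ℝ[X]) (c : ℂ) (f : ℝ → ℂ) :
    extensionOp γ (c • f) = c • extensionOp γ f := by
  ext x
  rw [Pi.smul_apply, smul_eq_mul, extensionOp, extensionOp, ← integral_const_mul]
  congr 1
  ext t
  rw [Pi.smul_apply, smul_eq_mul]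
  ring

/-- The operator extends by continuity from the subspace of those `f` for which the integral
converges, which is dense for finite `p` because it contains the simple functions. -/
theorem exists_linearMap_of_bound {d : ℕ} (γ : Fin d → ℝ[X]) {I : Set ℝ} (hI : MeasurableSet I)
    {p q : ℝ≥0∞} (hp : 1 ≤ p) (hp' : p ≠ ⊤) (hq : 1 ≤ q) {C : ℝ≥0}
    (hbound : ∀ f : ℝ → ℂ, MemLp f p (affineArclength γ) →
      Integrable (I.indicator f) (affineArclength γ) →
      MemLp (extensionOp γ (I.indicator f)) q volume ∧
      eLpNorm (extensionOp γ (I.indicator f)) q volume ≤ C * eLpNorm f p (affineArclength γ)) :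
    ∃ T : Lp ℂ p (affineArclength γ) →ₗ[ℂ] Lp ℂ q (volume : Measure (EuclideanSpace ℝ (Fin d))),
      (∀ f, ‖T f‖ ≤ C * ‖f‖) ∧
      ∀ f : Lp ℂ p (affineArclength γ), Integrable (I.indicator f) (affineArclength γ) →
        T f =ᵐ[volume] extensionOp γ (I.indicator f) := by
  have : Fact (1 ≤ p) := ⟨hp⟩
  have : Fact (1 ≤ q) := ⟨hq⟩
  set μ := affineArclength γ with hμ
  have hadd : ∀ f g : Lp ℂ p μ, I.indicator ⇑(f + g) =ᵐ[μ] I.indicator f + I.indicator g := by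
    intro f g
    rw [← Set.indicator_add']
    exact (Lp.coeFn_add f g).indicator
  have hsmul : ∀ (c : ℂ) (f : Lp ℂ p μ), I.indicator ⇑(c • f) =ᵐ[μ] c • I.indicator f := by
    intro c f
    filter_upwards [Lp.coeFn_smul c f] with t ht
    by_cases htI : t ∈ I
    · rw [Pi.smul_apply, Set.indicator_of_mem htI, Set.indicator_of_mem htI, ht, Pi.smul_apply]
    · rw [Pi.smul_apply, Set.indicator_of_notMem htI, Set.indicator_of_notMem htI, smul_zero]
  let S : Submodule ℂ (Lp ℂ p μ) :=
    { carrier := {f | Integrable (I.indicator f) μ}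
      add_mem' := fun {f g} hf hg => (hf.add hg).congr (hadd f g).symm
      zero_mem' := by
        refine (integrable_zero ℝ ℂ μ).congr ?_
        filter_upwards [Lp.coeFn_zero ℂ p μ] with t ht
        exact (Set.indicator_apply_eq_zero.2 fun _ => ht).symm
      smul_mem' := fun c f hf => (Integrable.smul c hf).congr (hsmul c f).symm }
  have hS : ∀ f : S, MemLp (extensionOp γ (I.indicator f)) q volume := fun f =>
    (hbound f (Lp.memLp _) f.2).1
  let T₀ : S →ₗ[ℂ] Lp ℂ q (volume : Measure (EuclideanSpace ℝ (Fin d))) :=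
    { toFun := fun f => (hS f).toLp
      map_add' := fun f g => by
        rw [← MemLp.toLp_add]
        refine MemLp.toLp_congr _ _ (Filter.EventuallyEq.of_eq ?_)
        rw [← extensionOp_add γ f.2 g.2]
        exact extensionOp_congr_ae γ (hadd f g)
      map_smul' := fun c f => by
        rw [RingHom.id_apply, ← MemLp.toLp_const_smul]
        refine MemLp.toLp_congr _ _ (Filter.EventuallyEq.of_eq ?_)
        rw [← extensionOp_smul]
        exact extensionOp_congr_ae γ (hsmul c f) }
  have hT₀ : ∀ f : S, ‖T₀ f‖ ≤ C * ‖S.subtype f‖ := by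
    intro f
    have h1 := (hbound f (Lp.memLp _) f.2).2
    change ‖(hS f).toLp‖ ≤ C * ‖(f : Lp ℂ p μ)‖
    rw [Lp.norm_toLp, Lp.norm_def, ← ENNReal.coe_toReal C, ← ENNReal.toReal_mul]
    exact ENNReal.toReal_mono (ENNReal.mul_ne_top ENNReal.coe_ne_top (Lp.eLpNorm_ne_top _)) h1
  have hdense : DenseRange S.subtype := by
    have h1 : Dense (S : Set (Lp ℂ p μ)) := by
      refine (Lp.simpleFunc.dense (E := ℂ) (μ := μ) hp').mono fun f hf => ?_
      set g : Lp.simpleFunc ℂ p μ := ⟨f, hf⟩ with hg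
      have h2 : Integrable f μ := by
        have h3 := Lp.simpleFunc.toSimpleFunc_eq_toFun g
        refine Integrable.congr ?_ h3
        exact (SimpleFunc.memLp_iff_integrable (zero_lt_one.trans_le hp).ne' hp').1
          (Lp.simpleFunc.memLp g)
      exact h2.indicator hI
    simpa [DenseRange] using h1
  refine ⟨(T₀.extendOfNorm S.subtype).toLinearMap,
    fun f => LinearMap.norm_extendOfNorm_apply_le hdense C hT₀ f, fun f hf => ?_⟩
  have h4 := LinearMap.extendOfNorm_eq hdense ⟨C, hT₀⟩ ⟨f, hf⟩
  change (T₀.extendOfNorm S.subtype) f =ᵐ[volume] _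
  rw [show (T₀.extendOfNorm S.subtype) f = T₀ ⟨f, hf⟩ from h4]
  exact (hS ⟨f, hf⟩).coeFn_toLp

end AffineArclength

section Exponents

/-! ### The exponents as functions of one parameter -/

/-- With `w = 1 / p'` the pair `(p, q)` on the critical line is given by `1 / p = 1 - w` and
`1 / q = w / D`, and `q > D + 1` becomes `w < D / (D + 1)`; in particular `p < ∞`. -/
theorem exists_weight_of_exponents {n : ℕ} {p p' q : ℝ≥0∞} (hp : ENNReal.HolderConjugate p p')
    (hq : q = ((n + 1 : ℕ) : ℝ≥0∞) * (((n + 1 : ℕ) : ℝ≥0∞) + 1) / 2 * p')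
    (hq_lower : (((n + 1 : ℕ) : ℝ≥0∞) ^ 2 + ((n + 1 : ℕ) : ℝ≥0∞) + 2) / 2 < q) :
    ∃ w : ℝ, 0 ≤ w ∧ w < homDim n / (homDim n + 1) ∧ p = (ENNReal.ofReal (1 - w))⁻¹ ∧
      q = critExp n w := by
  have hD := homDim_pos n
  have hsum : p⁻¹ + p'⁻¹ = 1 := hp.inv_add_inv_eq_one
  have hle : p'⁻¹ ≤ 1 := hsum ▸ le_add_self
  set w : ℝ := (p'⁻¹).toReal with hw
  have hw' : ENNReal.ofReal w = p'⁻¹ := ENNReal.ofReal_toReal (hle.trans_lt ENNReal.one_lt_top).ne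
  have hw0 : 0 ≤ w := ENNReal.toReal_nonneg
  have hcoef : ((n + 1 : ℕ) : ℝ≥0∞) * (((n + 1 : ℕ) : ℝ≥0∞) + 1) / 2
      = ENNReal.ofReal (homDim n) := by
    rw [homDim, ENNReal.ofReal_div_of_pos (by norm_num), ENNReal.ofReal_mul (by positivity)]
    congr 2
    · rw [← ENNReal.ofReal_natCast]; push_cast; rfl
    · rw [← ENNReal.ofReal_natCast, ← ENNReal.ofReal_one, ← ENNReal.ofReal_add (by positivity)
        (by norm_num)]
      congr 1; push_cast; ring
    · simp
  have hcoef2 : (((n + 1 : ℕ) : ℝ≥0∞) ^ 2 + ((n + 1 : ℕ) : ℝ≥0∞) + 2) / 2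
      = ENNReal.ofReal (homDim n + 1) := by
    rw [ENNReal.ofReal_add hD.le zero_le_one, ← hcoef, ENNReal.ofReal_one, ENNReal.add_div,
      ENNReal.div_self (by norm_num) (by norm_num)]
    congr 2; ring
  rw [hcoef, ← inv_inv p', ← hw'] at hq
  rw [hcoef2] at hq_lower
  have hqc : q = critExp n w := by
    rw [hq, critExp, div_eq_mul_inv, mul_comm w, ENNReal.ofReal_mul (by positivity),
      ENNReal.mul_inv (by left; simpa using hD) (by left; exact ENNReal.ofReal_ne_top),
      ENNReal.ofReal_inv_of_pos hD, inv_inv]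
  refine ⟨w, hw0, ?_, ?_, hqc⟩
  · rcases hw0.eq_or_lt with h | h
    · rw [← h]; positivity
    · rw [hqc, critExp_of_pos h, ENNReal.ofReal_lt_ofReal_iff (by positivity), lt_div_iff₀ h]
        at hq_lower
      rw [lt_div_iff₀ (by linarith)]
      linarith
  · rw [ENNReal.ofReal_sub _ hw0, ENNReal.ofReal_one, hw', ← hsum, ENNReal.add_sub_cancel_right
      (hle.trans_lt ENNReal.one_lt_top).ne, inv_inv]

end Exponents

theorem theorem2p1 (d N : ℕ) (hd : 2 ≤ d) (p p' q : ℝ≥0∞)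
    (hp : ENNReal.HolderConjugate p p')
    (hq : q = (d : ℝ≥0∞) * ((d : ℝ≥0∞) + 1) / 2 * p')
    (hq_lower : ((d : ℝ≥0∞) ^ 2 + (d : ℝ≥0∞) + 2) / 2 < q) :
    ∃ C : ℝ → ℝ≥0, ∀ (C₁ C₂ : ℝ), 0 < C₁ →
      ∀ I : Set ℝ, I.OrdConnected →
      ∀ γ : Fin d → ℝ[X], (∀ i, (γ i).natDegree ≤ N) →
      (∀ t ∈ I, C₁ ≤ |torsion γ t| ∧ |torsion γ t| ≤ C₂) →
        -- on a bounded interval the integral defining the extension operator converges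
        (Bornology.IsBounded I → ∀ f : ℝ → ℂ, MemLp f p (affineArclength γ) →
          Integrable (I.indicator f) (affineArclength γ)) ∧
        -- the estimate, whenever the integral converges
        (∀ f : ℝ → ℂ, MemLp f p (affineArclength γ) →
          Integrable (I.indicator f) (affineArclength γ) →
          MemLp (extensionOp γ (I.indicator f)) q volume ∧
          eLpNorm (extensionOp γ (I.indicator f)) q volume
            ≤ (C (C₂ / C₁) : ℝ≥0∞) * eLpNorm f p (affineArclength γ)) ∧
        -- the bounded extension to all of `L^p`, also for unbounded intervals
        (∃ T : Lp ℂ p (affineArclength γ) →ₗ[ℂ]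
            Lp ℂ q (volume : Measure (EuclideanSpace ℝ (Fin d))),
          (∀ f, ‖T f‖ ≤ (C (C₂ / C₁) : ℝ) * ‖f‖) ∧
          ∀ f : Lp ℂ p (affineArclength γ), Integrable (I.indicator f) (affineArclength γ) →
            T f =ᵐ[volume] extensionOp γ (I.indicator f)) := by
  obtain ⟨n, rfl⟩ : ∃ n, d = n + 1 := ⟨d - 1, by omega⟩
  obtain ⟨w, hw0, hw, hpw, hqw⟩ := exists_weight_of_exponents hp hq hq_lower
  have hD := homDim_pos n
  have hw1 : w < 1 := hw.trans ((div_lt_one (by linarith)).2 (by linarith))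
  have hp1 : 1 ≤ p := by
    rw [hpw, ENNReal.one_le_inv]
    exact ENNReal.ofReal_le_one.2 (by linarith)
  have hp_top : p ≠ ⊤ := by
    rw [hpw, Ne, ENNReal.inv_eq_top, ENNReal.ofReal_eq_zero]
    linarith
  have hq1 : 1 ≤ q := by
    rw [hqw, critExp, ENNReal.one_le_inv]
    refine ENNReal.ofReal_le_one.2 ((div_le_one hD).2 ?_)
    have : homDim n / (homDim n + 1) ≤ homDim n := div_le_self hD.le (by linarith)
    linarith
  obtain ⟨C, hC⟩ := exists_extensionOp_bound (by omega) N hw0 hw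
  refine ⟨C, fun C₁ C₂ hC₁ I hI γ hγ htor => ?_⟩
  have hbound : ∀ f : ℝ → ℂ, MemLp f p (affineArclength γ) →
      Integrable (I.indicator f) (affineArclength γ) →
      MemLp (extensionOp γ (I.indicator f)) q volume ∧
      eLpNorm (extensionOp γ (I.indicator f)) q volume
        ≤ (C (C₂ / C₁) : ℝ≥0∞) * eLpNorm f p (affineArclength γ) := by
    intro f hf hfI
    obtain ⟨h1, h2⟩ := hC C₁ C₂ hC₁ I hI γ hγ htor f hfI
    rw [← hqw, ← hpw] at h2
    exact ⟨⟨h1, h2.trans_lt (ENNReal.mul_lt_top ENNReal.coe_lt_top hf.2)⟩, h2⟩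
  exact ⟨fun hIb f hf => integrable_indicator_of_isBounded γ hI hIb (fun t ht => (htor t ht).2)
    hp1 hf, hbound, exists_linearMap_of_bound γ hI.measurableSet hp1 hp_top hq1 hbound⟩
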